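/- Let $H$ be a complex Hilbert space, let $\mathfrak{Fred}$ be the space of Fredholm operators on $H$ and $\mathfrak{Fred}^{\mathrm{sa}}\subset\mathfrak{Fred}$ the subspace of self-adjoint ones, both in the operator norm topology. Let $\operatorname{spec}_{\mathrm{ess}}$ denote the spectrum in the Calkin algebra. For an operator $A$ and $I\subset\mathbb R$ let $V_I(A)$ be the sum of the eigenspaces of $A$ with eigenvalue in $I$, and $N_I(A)=\dim V_I(A)$. For a finite-dimensional $V$ let $\bigwedge V$ be its top exterior power. *Spectral cover.* For $P\in\mathfrak{Fred}^{\mathrm{sa}}$ call $\mu>0$ admissible if $\pm\mu\notin\operatorname{spec}P$ and $[-\mu,\mu]\cap\operatorname{spec}_{\mathrm{ess}}P=\emptyset$. Let $\operatorname{sp}(P)$ be the set of classes $[\mu,n]$ of pairs of an admissible $\mu$ and $n\in\mathbb Z$, where $(\mu,n)\sim(\nu,m)$ for $\mu<\nu$ if $m-n=N_{(\mu,\nu)}(P)$. The group $\mathbb Z$ acts by $j\cdot[\mu,n]=[\mu,n+j]$, and $\operatorname{sp}\to\mathfrak{Fred}^{\mathrm{sa}}$ is topologized by declaring the local sections $P\mapsto[\mu,n]$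 continuous. *Determinant line bundle.* For $P\in\mathfrak{Fred}$ let $\operatorname{Det}P=\bigwedge\operatorname{Ker}P\otimes(\bigwedge\operatorname{Ker}P^\dagger)^*$. If $P$ is invertible, let $\det P=1\otimes1^*\in\operatorname{Det}P$. For $\mu>0$ with $[0,\mu]\cap\operatorname{spec}_{\mathrm{ess}}(P^\dagger P)=\emptyset$ let $$\operatorname{stab}_\mu\colon\bigwedge V_{[0,\mu]}(P^\dagger P)\otimes\Bigl(\bigwedge V_{[0,\mu]}(PP^\dagger)\Bigr)^*\to\operatorname{Det}P,\qquad (v\wedge w)\otimes(\beta\wedge\alpha)\mapsto\beta\bigl(\textstyle\bigwedge P\,w\bigr)\,v\otimes\alpha,$$ for $v\in\bigwedge\operatorname{Ker}P$, $w\in\bigwedge V_{(0,\mu]}(P^\dagger P)$, $\alpha\in(\bigwedge\operatorname{Ker}P^\dagger)^*$, $\beta\in(\bigwedge V_{(0,\mu]}(PP^\dagger))^*$, where $(\beta\wedge\alpha)(x\wedge y)=\alpha(x)\beta(y)$. The complex line bundle $\operatorname{Det}\to\mathfrak{Fred}$ carries the topology transported along these isomorphisms, over open sets on which $\mu\notin\operatorname{spec}(P^\dagger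 P)$, from the vector bundles $V_{[0,\mu]}(P^\dagger P)$ and $V_{[0,\mu]}(PP^\dagger)$. *Transgression.* Let $S^1=\mathbb R/2\pi\mathbb Z$. The transgression $S\to\operatorname{Map}(S^1,\mathfrak{Fred})$ of $\operatorname{Det}$ has as fibre $S_\gamma$ the set of homotopy classes of nowhere zero continuous sections $\tau$ of $\gamma^*\operatorname{Det}$; $j\in\mathbb Z$ acts by $\tau(t)\mapsto e^{ijt}\tau(t)$, and $S$ is topologized by declaring the sections $\gamma\mapsto[\tau(\cdot,\gamma)]$ given by continuous families of trivializations over open sets of loops to be continuous. **Theorem.** Consider the Atiyah–Singer map $$\mathfrak{Fred}^{\mathrm{sa}}\to\operatorname{Map}(S^1,\mathfrak{Fred}),\qquad P\mapsto P_t=\begin{cases}\cos t+i\sin t\,P&(0\le t\le\pi),\\ \cos t+i\sin t&(\pi\le t\le2\pi).\end{cases}$$ The spectral cover $\operatorname{sp}\to\mathfrak{Fred}^{\mathrm{sa}}$ is canonically isomorphic to the pullback of $S$ along this map. Precisely, there are bijections $\psi_P\colon\operatorname{sp}(P)\to S_{t\mapsto P_t}$, $P\in\mathfrak{Fred}^{\mathrm{sa}}$,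 such that: 1. together the $\psi_P$ form a homeomorphism from the total space of $\operatorname{sp}$ to that of the pullback of $S$; 2. $\psi_P(j\cdot x)=(-j)\cdot\psi_P(x)$ for all $j\in\mathbb Z$ and $x\in\operatorname{sp}(P)$; 3. for every $P$, admissible $\mu$ and $n\in\mathbb Z$, the class $\psi_P([\mu,n])$ is represented by the trivialization $\tau$ with $\tau(t)=\det P_t$ for $\pi\le t\le2\pi$ and $$\tau(t)=e^{i\left(N_{(-\mu,\mu)}(P)-2n\right)t}\,s_t\qquad(0<t<\pi).$$ Here $s_t\in\operatorname{Det}P_t$ is the image under $\operatorname{stab}_{\mu(t)}$, $\mu(t)=\cos^2t+\mu^2\sin^2t$, of the canonical element $1\in\bigwedge V\otimes(\bigwedge V)^*=\mathbb C$, for $V=V_{[0,\mu(t)]}(P_t^\dagger P_t)=V_{[0,\mu(t)]}(P_tP_t^\dagger)$. -/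

import Mathlib

noncomputable section

namespace SpectralCover

open scoped TensorProduct

/-! ### Essential spectrum, spectral subspaces, Fredholm operators -/

section Operators

variable (E F : Type*)
  [NormedAddCommGroup E] [InnerProductSpace ℂ E] [CompleteSpace E]
  [NormedAddCommGroup F] [InnerProductSpace ℂ F] [CompleteSpace F]

/-- The two-sided ideal of compact operators in the algebra of bounded operators. -/
def compactIdeal : TwoSidedIdeal (E →L[ℂ] E) :=
  TwoSidedIdeal.mk' {A | IsCompactOperator A}
    (by simpa using (isCompactOperator_zero (M₁ := E) (M₂ := E)))
    (fun {A B} hA hB => by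
      have := IsCompactOperator.add (f := (A : E → E)) (g := (B : E → E)) hA hB
      simpa using this)
    (fun {A} hA => by
      have := IsCompactOperator.neg (f := (A : E → E)) hA
      simpa using this)
    (fun {A B} hB => by
      have := IsCompactOperator.clm_comp (f := (B : E → E)) hB A
      simpa using this)
    (fun {A B} hA => by
      have := IsCompactOperator.comp_clm (f := (A : E → E)) hA B
      simpa using this)

/-- The Calkin algebra: bounded operators modulo compact operators. -/
abbrev Calkin : Type _ := (compactIdeal E).ringCon.Quotient

variable {E F}

/-- The essential spectrum: the spectrum in the Calkin algebra. -/
def essSpectrum (A : E →L[ℂ] E) : Set ℂ :=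
  spectrum ℂ ((A : Calkin E))

/-- `V_I(A)`: the sum of all eigenspaces of `A` with (real) eigenvalue in `I`. -/
def specSpace (A : E →L[ℂ] E) (I : Set ℝ) : Submodule ℂ E :=
  ⨆ x ∈ I, Module.End.eigenspace (A : E →ₗ[ℂ] E) (x : ℂ)

/-- `N_I(A)`: the number of eigenvalues of `A` in `I`, counted with multiplicity. -/
def specCount (A : E →L[ℂ] E) (I : Set ℝ) : ℕ :=
  Module.finrank ℂ (specSpace A I)

variable (E F) in
/-- The space of Fredholm operators `E → F` in the norm topology. -/
abbrev Fred : Type _ := {P : E →L[ℂ] F // P.IsFredholm}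

variable (E) in
/-- The space of self-adjoint Fredholm operators in the norm topology. -/
abbrev FredSA : Type _ := {P : E →L[ℂ] E // IsSelfAdjoint P ∧ P.IsFredholm}

/-! ### The determinant line -/

/-- The top exterior power `⋀ V` of a finite-dimensional subspace `V ⊆ E`, realised inside the
exterior algebra of `E` as the span of all `v₁ ∧ ⋯ ∧ vₖ`, with `vᵢ ∈ V` and `k = dim V`.  For
subspaces, wedge products are thus products in the exterior algebra of `E`. -/
def topPow (V : Submodule ℂ E) : Submodule ℂ (ExteriorAlgebra ℂ E) :=
  (V.map (ExteriorAlgebra.ι ℂ)) ^ Module.finrank ℂ V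

/-- `Det P = ⋀ Ker P ⊗ (⋀ Ker P†)*`. -/
abbrev DetLine (P : E →L[ℂ] F) : Type _ :=
  topPow P.ker ⊗[ℂ] Module.Dual ℂ (topPow (ContinuousLinearMap.adjoint P).ker)

/-- `V_I(P†P)`. -/
def domSpace (P : E →L[ℂ] F) (I : Set ℝ) : Submodule ℂ E :=
  specSpace ((ContinuousLinearMap.adjoint P).comp P) I

/-- `V_I(PP†)`. -/
def codSpace (P : E →L[ℂ] F) (I : Set ℝ) : Submodule ℂ F :=
  specSpace (P.comp (ContinuousLinearMap.adjoint P)) I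

/-- The graph of the stabilization isomorphism
`stab : ⋀ V_{[0,μ]}(P†P) ⊗ (⋀ V_{[0,μ]}(PP†))* → Det P`,
`stab ((v ∧ w) ⊗ (β ∧ α)) = β (⋀P w) • v ⊗ α`,
for `v ∈ ⋀ Ker P`, `w ∈ ⋀ V_{(0,μ]}(P†P)`, `α ∈ (⋀ Ker P†)*`, `β ∈ (⋀ V_{(0,μ]}(PP†))*`.
`IsStab P μ ξ φ d` says `stab (ξ ⊗ φ) = d`.  The functional `β ∧ α` evaluates as
`(β ∧ α) (x ∧ y) = α x * β y` for `x ∈ ⋀ Ker P†`, `y ∈ ⋀ V_{(0,μ]}(PP†)`. -/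
def IsStab (P : E →L[ℂ] F) (μ : ℝ) (ξ : ExteriorAlgebra ℂ E)
    (φ : Module.Dual ℂ (topPow (codSpace P (Set.Icc 0 μ)))) (d : DetLine P) : Prop :=
  ∃ (v : topPow P.ker) (w : topPow (domSpace P (Set.Ioc 0 μ)))
    (α : Module.Dual ℂ (topPow (ContinuousLinearMap.adjoint P).ker))
    (β : Module.Dual ℂ (topPow (codSpace P (Set.Ioc 0 μ)))),
    ξ = (v : ExteriorAlgebra ℂ E) * (w : ExteriorAlgebra ℂ E) ∧
    (∀ (x : topPow (ContinuousLinearMap.adjoint P).ker)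
       (y : topPow (codSpace P (Set.Ioc 0 μ)))
       (z : topPow (codSpace P (Set.Icc 0 μ))),
       (z : ExteriorAlgebra ℂ F) = (x : ExteriorAlgebra ℂ F) * (y : ExteriorAlgebra ℂ F) →
       φ z = α x * β y) ∧
    ∃ y : topPow (codSpace P (Set.Ioc 0 μ)),
      (y : ExteriorAlgebra ℂ F) =
        ExteriorAlgebra.map (P : E →ₗ[ℂ] F) (w : ExteriorAlgebra ℂ E) ∧
      d = β y • (v ⊗ₜ[ℂ] α)

/-- If `V := V_{[0,μ]}(P†P) = V_{[0,μ]}(PP†)` (as for a normal `P`), then `⋀ V ⊗ (⋀ V)*` is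
canonically `ℂ`; this says that `d ∈ Det P` is the image of `1` under `stab`, that is
`d = stab (ξ ⊗ φ)` for some `ξ ∈ ⋀ V` and `φ ∈ (⋀ V)*` with `φ ξ = 1`. -/
def IsStabOne (P : E →L[ℂ] E) (μ : ℝ) (d : DetLine P) : Prop :=
  ∃ (ξ : topPow (domSpace P (Set.Icc 0 μ)))
    (φ : Module.Dual ℂ (topPow (codSpace P (Set.Icc 0 μ))))
    (z : topPow (codSpace P (Set.Icc 0 μ))),
    (z : ExteriorAlgebra ℂ E) = (ξ : ExteriorAlgebra ℂ E) ∧ φ z = 1 ∧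
    IsStab P μ (ξ : ExteriorAlgebra ℂ E) φ d

/-- The canonical element `det P = 1 ⊗ 1*` of `Det P` for `P` with `Ker P = 0`, `Ker P† = 0`
(so that both exterior powers are spanned by `1`). -/
def IsDetOne (P : E →L[ℂ] F) (d : DetLine P) : Prop :=
  ∃ (v : topPow P.ker)
    (α : Module.Dual ℂ (topPow (ContinuousLinearMap.adjoint P).ker))
    (x : topPow (ContinuousLinearMap.adjoint P).ker),
    (v : ExteriorAlgebra ℂ E) = 1 ∧ (x : ExteriorAlgebra ℂ F) = 1 ∧ α x = 1 ∧ d = v ⊗ₜ[ℂ] α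

/-! ### The determinant line bundle -/

variable (E F) in
/-- The determinant lines over the space of Fredholm operators. -/
def DetBundle (P : Fred E F) : Type _ := DetLine P.1

instance (P : Fred E F) : AddCommGroup (DetBundle E F P) :=
  inferInstanceAs (AddCommGroup (DetLine P.1))

instance (P : Fred E F) : Module ℂ (DetBundle E F P) :=
  inferInstanceAs (Module ℂ (DetLine P.1))

variable (E F) in
/-- Local frames of the determinant line bundle.  Over an open set `U` of Fredholm operators for
which `μ > 0` is sufficiently small and not in the spectrum of `P†P`, continuous frames `e` of
`V_{[0,μ]}(P†P)` and `f` of `V_{[0,μ]}(PP†)` yield the nowhere zero section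
`stab ((e₁ ∧ ⋯ ∧ eₖ) ⊗ (f₁ ∧ ⋯ ∧ fₗ)*)` of the determinant line bundle. -/
structure DetFrame where
  U : Set (Fred E F)
  isOpen_U : IsOpen U
  μ : ℝ
  μ_pos : 0 < μ
  small : ∀ P ∈ U, ∀ x ∈ Set.Icc 0 μ,
    (x : ℂ) ∉ essSpectrum ((ContinuousLinearMap.adjoint P.1).comp P.1)
  gap : ∀ P ∈ U, (μ : ℂ) ∉ spectrum ℂ ((ContinuousLinearMap.adjoint P.1).comp P.1)
  k : ℕ
  e : U → Fin k → E
  continuous_e : Continuous e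
  indep_e : ∀ P : U, LinearIndependent ℂ (e P)
  span_e : ∀ P : U, Submodule.span ℂ (Set.range (e P)) = domSpace P.1.1 (Set.Icc 0 μ)
  l : ℕ
  f : U → Fin l → F
  continuous_f : Continuous f
  indep_f : ∀ P : U, LinearIndependent ℂ (f P)
  span_f : ∀ P : U, Submodule.span ℂ (Set.range (f P)) = codSpace P.1.1 (Set.Icc 0 μ)
  sec : ∀ P : U, DetBundle E F P.1
  isStab_sec : ∀ P : U, ∃ (φ : Module.Dual ℂ (topPow (codSpace P.1.1 (Set.Icc 0 μ))))
    (z : topPow (codSpace P.1.1 (Set.Icc 0 μ))),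
    (z : ExteriorAlgebra ℂ F) = ExteriorAlgebra.ιMulti ℂ l (f P) ∧ φ z = 1 ∧
    IsStab P.1.1 μ (ExteriorAlgebra.ιMulti ℂ k (e P)) φ (sec P)

/-- The topology on the determinant line bundle: the finest topology for which the maps
`U × ℂ → Det`, `(P, c) ↦ c • sec P`, defined by local frames are continuous. -/
instance : TopologicalSpace (Bundle.TotalSpace ℂ (DetBundle E F)) :=
  ⨆ c : DetFrame E F, TopologicalSpace.coinduced
    (fun p : c.U × ℂ => (⟨p.1.1, p.2 • c.sec p.1⟩ : Bundle.TotalSpace ℂ (DetBundle E F)))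
    inferInstance

/-! ### The spectral cover -/

/-- Admissible cutoffs: `μ > 0`, `±μ ∉ spec P`, `[-μ,μ] ∩ spec_ess P = ∅`. -/
def Admissible (P : E →L[ℂ] E) (μ : ℝ) : Prop :=
  0 < μ ∧ (μ : ℂ) ∉ spectrum ℂ P ∧ ((-μ : ℝ) : ℂ) ∉ spectrum ℂ P ∧
    ∀ x ∈ Set.Icc (-μ) μ, (x : ℂ) ∉ essSpectrum P

/-- The identification `(μ, n) ∼ (ν, m)`, for `μ < ν` with `m - n = N_{]μ,ν[}(P)`. -/
def SpRel (P : E →L[ℂ] E) (a b : {μ : ℝ // Admissible P μ} × ℤ) : Prop :=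
  a.1.1 < b.1.1 ∧ b.2 - a.2 = (specCount P (Set.Ioo a.1.1 b.1.1) : ℤ)

/-- The spectral torsor `sp(P)`. -/
def Sp (P : FredSA E) : Type := Quot (SpRel P.1)

/-- The element `[μ, n]` of `sp(P)`. -/
def Sp.mk {P : FredSA E} (μ : ℝ) (h : Admissible P.1 μ) (n : ℤ) : Sp P :=
  Quot.mk _ (⟨μ, h⟩, n)

/-- The action of `j ∈ ℤ` on `sp(P)`: `[μ, n] ↦ [μ, n + j]`. -/
def Sp.shift {P : FredSA E} (j : ℤ) : Sp P → Sp P :=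
  Quot.map (fun a => (a.1, a.2 + j)) (fun a b h => ⟨h.1, by simpa using h.2⟩)

/-- The topology of the spectral cover: the finest one for which all sections
`P ↦ [μ, n]`, on the open set where `μ` is admissible, are continuous. -/
instance : TopologicalSpace (Bundle.TotalSpace ℤ (Sp (E := E))) :=
  ⨆ (μ : ℝ) (n : ℤ), TopologicalSpace.coinduced
    (fun P : {P : FredSA E // Admissible P.1 μ} =>
      (⟨P.1, Sp.mk μ P.2 n⟩ : Bundle.TotalSpace ℤ (Sp (E := E))))
    inferInstance

end Operators

/-! ### Transgression of a complex line bundle -/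

section Transgression

variable {X : Type*} [TopologicalSpace X] (L : X → Type*)
  [∀ x, AddCommGroup (L x)] [∀ x, Module ℂ (L x)] [TopologicalSpace (Bundle.TotalSpace ℂ L)]

/-- Nowhere zero continuous sections of `L` along a loop `γ`; the circle is `ℝ / 2πℤ`. -/
structure LoopTriv (γ : C(Real.Angle, X)) where
  val : ∀ θ, L (γ θ)
  continuous_val : Continuous (fun θ => (⟨γ θ, val θ⟩ : Bundle.TotalSpace ℂ L))
  ne_zero : ∀ θ, val θ ≠ 0

variable {L} in
/-- Homotopy of trivializations along `γ`. -/
def LoopTriv.Homotopic {γ : C(Real.Angle, X)} (τ₀ τ₁ : LoopTriv L γ) : Prop :=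
  ∃ h : ∀ (_ : unitInterval) (θ : Real.Angle), L (γ θ),
    Continuous (fun p : unitInterval × Real.Angle =>
      (⟨γ p.2, h p.1 p.2⟩ : Bundle.TotalSpace ℂ L)) ∧
    (∀ s θ, h s θ ≠ 0) ∧ h 0 = τ₀.val ∧ h 1 = τ₁.val

/-- The fibre over `γ` of the transgression of `L`. -/
def Transg (γ : C(Real.Angle, X)) : Type _ := Quot (LoopTriv.Homotopic (L := L) (γ := γ))

variable {L} in
/-- The homotopy class of a trivialization. -/
def Transg.mk {γ : C(Real.Angle, X)} (τ : LoopTriv L γ) : Transg L γ := Quot.mk _ τ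

variable {L} in
/-- `y = j • x` for the action of `j ∈ ℤ` on homotopy classes by `τ ↦ (θ ↦ e^{ijθ} τ(θ))`. -/
def Transg.IsTranslate {γ : C(Real.Angle, X)} (j : ℤ) (x y : Transg L γ) : Prop :=
  ∃ τ τ' : LoopTriv L γ, x = Transg.mk τ ∧ y = Transg.mk τ' ∧
    ∀ θ, τ'.val θ = ((θ.toCircle ^ j : Circle) : ℂ) • τ.val θ

/-- Continuous families, over an open set `U` of loops, of trivializations along the loops. -/
structure LoopTrivFamily where
  U : Set C(Real.Angle, X)
  isOpen_U : IsOpen U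
  val : ∀ (γ : U) (θ : Real.Angle), L (γ.1 θ)
  continuous_val : Continuous (fun p : U × Real.Angle =>
    (⟨p.1.1 p.2, val p.1 p.2⟩ : Bundle.TotalSpace ℂ L))
  ne_zero : ∀ γ θ, val γ θ ≠ 0

variable {L} in
/-- The member at `γ` of a family of trivializations. -/
def LoopTrivFamily.at (T : LoopTrivFamily L) (γ : T.U) : LoopTriv L γ.1 where
  val := T.val γ
  continuous_val := T.continuous_val.comp (Continuous.prodMk_right γ)
  ne_zero := T.ne_zero γ

/-- The topology of the transgression `S → Map(S¹, X)`: the finest one for which all sections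
`γ ↦ [τ(·, γ)]` defined by continuous families of trivializations are continuous. -/
instance : TopologicalSpace (Bundle.TotalSpace ℤ (Transg L)) :=
  ⨆ T : LoopTrivFamily L, TopologicalSpace.coinduced
    (fun γ : T.U => (⟨γ.1, Transg.mk (T.at γ)⟩ : Bundle.TotalSpace ℤ (Transg L)))
    inferInstance

end Transgression

/-! ### The Atiyah–Singer map -/

section AtiyahSinger

variable {H : Type*} [NormedAddCommGroup H] [InnerProductSpace ℂ H]

/-- `cos t + i sin t P` for `0 ≤ t ≤ π` and `cos t + i sin t` for `π ≤ t ≤ 2π`. -/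
def asOp (P : H →L[ℂ] H) (θ : Real.Angle) : H →L[ℂ] H :=
  if 0 ≤ θ.sin then (θ.cos : ℂ) • 1 + (Complex.I * θ.sin) • P
  else (θ.cos : ℂ) • 1 + (Complex.I * θ.sin) • 1

theorem asOp_of_le_pi (P : H →L[ℂ] H) {t : ℝ} (h0 : 0 ≤ t) (h1 : t ≤ Real.pi) :
    asOp P t = (Real.cos t : ℂ) • 1 + (Complex.I * Real.sin t) • P := by
  simp [asOp, Real.sin_nonneg_of_nonneg_of_le_pi h0 h1]

theorem asOp_of_pi_le (P : H →L[ℂ] H) {t : ℝ} (h0 : Real.pi ≤ t) (h1 : t ≤ 2 * Real.pi) :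
    asOp P t = (Real.cos t : ℂ) • 1 + (Complex.I * Real.sin t) • 1 := by
  have h2 : Real.sin (t - Real.pi) = -Real.sin t := Real.sin_sub_pi t
  have h3 : 0 ≤ Real.sin (t - Real.pi) :=
    Real.sin_nonneg_of_nonneg_of_le_pi (by linarith) (by linarith)
  have h4 : Real.sin t ≤ 0 := by linarith
  rcases h4.eq_or_lt with h5 | h5
  · simp [asOp, h5]
  · simp [asOp, h5.not_ge]

theorem continuous_asOp (P : H →L[ℂ] H) : Continuous (asOp P) := by
  have h1 : Continuous fun θ : Real.Angle => ((θ.cos : ℝ) : ℂ) :=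
    Complex.continuous_ofReal.comp Real.Angle.continuous_cos
  have h2 : Continuous fun θ : Real.Angle => Complex.I * ((θ.sin : ℝ) : ℂ) :=
    continuous_const.mul (Complex.continuous_ofReal.comp Real.Angle.continuous_sin)
  refine Continuous.if_le ((h1.smul continuous_const).add (h2.smul continuous_const))
    ((h1.smul continuous_const).add (h2.smul continuous_const)) continuous_const
    Real.Angle.continuous_sin ?_
  intro θ h
  simp [← h]

theorem isFredholm_of_isUnit {A : H →L[ℂ] H} (h : IsUnit A) : A.IsFredholm := by
  obtain ⟨u, rfl⟩ := h
  refine ContinuousLinearMap.IsFredholm.of_isQuasiInverse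
    (v := ((u⁻¹ : (H →L[ℂ] H)ˣ) : H →L[ℂ] H)) ?_
  have h1 : ((u⁻¹ : (H →L[ℂ] H)ˣ) : H →L[ℂ] H).toLinearMap ∘ₗ (u : H →L[ℂ] H).toLinearMap
      = LinearMap.id := by
    ext x
    exact DFunLike.congr_fun (Units.inv_mul u) x
  have h2 : (u : H →L[ℂ] H).toLinearMap ∘ₗ ((u⁻¹ : (H →L[ℂ] H)ˣ) : H →L[ℂ] H).toLinearMap
      = LinearMap.id := by
    ext x
    exact DFunLike.congr_fun (Units.mul_inv u) x
  simp [LinearMap.IsQuasiInverse, LinearMap.IsLeftQuasiInverse, LinearMap.IsRightQuasiInverse,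
    h1, h2]

theorem isUnit_smul_one {c : ℂ} (hc : c ≠ 0) : IsUnit (c • (1 : H →L[ℂ] H)) := by
  rw [← Algebra.algebraMap_eq_smul_one]
  exact (IsUnit.mk0 c hc).map (algebraMap ℂ (H →L[ℂ] H))

theorem isFredholm_smul {P : H →L[ℂ] H} (hP : P.IsFredholm) {c : ℂ} (hc : c ≠ 0) :
    (c • P).IsFredholm := by
  obtain ⟨v, hv⟩ := hP.exists_isQuasiInverse
  obtain ⟨w, hw⟩ := (isFredholm_of_isUnit (isUnit_smul_one (H := H) hc)).exists_isQuasiInverse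
  refine ContinuousLinearMap.IsFredholm.of_isQuasiInverse (v := v.comp w) ?_
  have h := LinearMap.IsQuasiInverse.comp hv hw
  convert h using 1
  · rfl
  · ext x
    simp

theorem isUnit_asOp_aux [CompleteSpace H] {P : H →L[ℂ] H} (h : IsSelfAdjoint P) {a b : ℝ} (ha : a ≠ 0) :
    IsUnit ((a : ℂ) • (1 : H →L[ℂ] H) + (Complex.I * b) • P) := by
  by_cases hb : b = 0
  · subst hb
    simpa using isUnit_smul_one (H := H) (c := (a : ℂ)) (by exact_mod_cast ha)
  have hb' : (b : ℂ) ≠ 0 := by exact_mod_cast hb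
  have hI : Complex.I * (b : ℂ) ≠ 0 := mul_ne_zero Complex.I_ne_zero hb'
  have hz : (Complex.I * ((a / b : ℝ) : ℂ)) ∉ spectrum ℂ P := by
    intro hm
    have h1 := congrArg Complex.im (h.mem_spectrum_eq_re hm)
    simp at h1
    tauto
  rw [spectrum.notMem_iff] at hz
  have h2 := (isUnit_smul_one (H := H) (neg_ne_zero.mpr hI)).mul hz
  convert h2 using 1
  rw [Algebra.algebraMap_eq_smul_one, smul_one_mul, smul_sub, smul_smul, neg_smul _ P]
  have : -(Complex.I * (b : ℂ)) * (Complex.I * ((a / b : ℝ) : ℂ)) = (a : ℂ) := by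
    push_cast
    field_simp
    simp
  rw [sub_neg_eq_add, this]

theorem isFredholm_asOp [CompleteSpace H] {P : H →L[ℂ] H} (h : IsSelfAdjoint P) (hP : P.IsFredholm)
    (θ : Real.Angle) : (asOp P θ).IsFredholm := by
  have hcs := θ.cos_sq_add_sin_sq
  unfold asOp
  split_ifs with hs
  · by_cases hc : θ.cos = 0
    · have hs0 : θ.sin ≠ 0 := by
        intro h0
        simp [hc, h0] at hcs
      rw [hc]
      simpa using isFredholm_smul hP
        (mul_ne_zero Complex.I_ne_zero (Complex.ofReal_ne_zero.mpr hs0))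
    · exact isFredholm_of_isUnit (isUnit_asOp_aux h hc)
  · rw [← add_smul]
    refine isFredholm_of_isUnit (isUnit_smul_one ?_)
    intro h0
    have h1 := congrArg Complex.im h0
    simp at h1
    exact hs h1.ge

/-- The Atiyah–Singer map from self-adjoint Fredholm operators to loops of Fredholm operators. -/
def asLoop [CompleteSpace H] (P : FredSA H) : C(Real.Angle, Fred H H) where
  toFun θ := ⟨asOp P.1 θ, isFredholm_asOp P.2.1 P.2.2 θ⟩
  continuous_toFun := (continuous_asOp P.1).subtype_mk _

end AtiyahSinger

end SpectralCover

end

/-! Along a loop, the ratio of two trivializations of a line bundle is a map from the circle to the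
nonzero complex numbers. The two are homotopic exactly when this ratio has a continuous logarithm
(`IsLineBundle.mk_eq_mk_iff`). Every such ratio is `e^{ijθ}` times an exponential
(`exists_winding`), and `e^{ijθ}` has a continuous logarithm only for `j = 0`
(`eq_zero_of_hasLog_toCircle`). The fibres of the transgression are therefore torsors under ℤ, and
an equivariant map into them from `sp(P)` is automatically bijective. It remains to see that `τ` is
a trivialization, that its class does not depend on the representative `(μ, n)`, that it has the
right equivariance, and that it varies continuously with `P`.

On the upper half circle the stabilizing space is the fixed space `V = V_{[-μ,μ]}(P)`
(`domSpace_affine`, `codSpace_affine`), and wherever `P_θ` is invertible, `s_θ = det(P_θ|V) • det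
P_θ` (`IsFrameStab.eq_smul_isDetOne`). At `sin θ = 0` this determinant is `(cos θ)^N` and the phase
is `(cos θ)^(N-2n)`. Their product is an even power of `±1`, so `τ` glues with `det P_θ` on the
lower half (`continuous_asSec`).

Enlarging the cutoff from `μ` to `ν` multiplies `s_θ` by the factors `cos θ + i sin θ λ` over the
eigenvalues `λ` of `P` with `μ < |λ| < ν`. If `a` of them are negative and `b` positive, then `N`
grows by `a + b` and `n` by `b`, so the phase changes by `e^{i(a-b)θ}`: one `e^{iθ}` for each
negative and one `e^{-iθ}` for each positive eigenvalue. Each factor with its own phase has real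
part `cos² θ + sin² θ |λ| > 0`, hence a logarithm (`hasLog_eigenvalueFactor`, `mk_asTriv_eq_of_lt`).
Replacing `n` by `n + j` changes `τ` by `e^{-2ijθ}` on the upper half only, which is homotopic to
`e^{-ijθ}` on the whole circle (`mk_asTriv_add`).

The bundle `Det` is a line bundle because sections given by frames at two cutoffs differ by a
quotient of determinants that are continuous in the operator (`IsFrameStab.transition`,
`exists_transition`). Continuous frames exist because, across gaps of the spectrum, spectral
projections come from the continuous functional calculus, depend continuously on the operator, and
have finite rank off the essential spectrum (`exists_localFrame`). On total spaces the map is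
continuous and open because it carries local sections to local sections: trivializations along a
loop extend to nearby loops by a partition of unity (`IsLineBundle.exists_family`), and homotopy of
two continuous families is a locally constant condition (`IsLineBundle.isLocallyConstant_mk_eq`). -/

namespace SpectralCover
open scoped TensorProduct

/-! ### Wedge products of families and their coefficients -/

section Wedge

variable {E : Type*} [NormedAddCommGroup E] [InnerProductSpace ℂ E]

/-- The wedge product of a finite family of vectors. -/
abbrev wedge {k : ℕ} (v : Fin k → E) : ExteriorAlgebra ℂ E := ExteriorAlgebra.ιMulti ℂ k v

theorem wedge_apply {k : ℕ} (v : Fin k → E) :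
    wedge v = (List.ofFn fun i => ExteriorAlgebra.ι ℂ (v i)).prod :=
  ExteriorAlgebra.ιMulti_apply v

theorem wedge_append {m n : ℕ} (a : Fin m → E) (b : Fin n → E) :
    wedge (Fin.append a b) = wedge a * wedge b :=
  (ExteriorAlgebra.ιMulti_mul_ιMulti a b).symm

/-- The alternating form `x ↦ det ⟨bᵢ, xⱼ⟩`. -/
noncomputable def gramDet {k : ℕ} (b : Fin k → E) : E [⋀^Fin k]→ₗ[ℂ] ℂ :=
  (Matrix.detRowAlternating (n := Fin k) (R := ℂ)).compLinearMap
    (LinearMap.pi fun i => (innerSL ℂ (b i)).toLinearMap)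

theorem gramDet_apply {k : ℕ} (b x : Fin k → E) :
    gramDet b x = Matrix.det (Matrix.of fun j i => (inner ℂ (b i) (x j) : ℂ)) := rfl

theorem gramDet_self_ne_zero {k : ℕ} {b : Fin k → E} (hb : LinearIndependent ℂ b) :
    gramDet b b ≠ 0 := by
  have h := Matrix.det_gram_ne_zero_iff_linearIndependent.mpr hb
  rw [gramDet_apply, ← Matrix.det_transpose]
  exact h

theorem linearIndependent_of_gramDet_ne_zero {k : ℕ} {b : Fin k → E} (h : gramDet b b ≠ 0) :
    LinearIndependent ℂ b := by
  refine Matrix.det_gram_ne_zero_iff_linearIndependent (𝕜 := ℂ).mp ?_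
  rw [← Matrix.det_transpose]
  exact h

theorem continuous_gramDet {k : ℕ} :
    Continuous fun p : (Fin k → E) × (Fin k → E) => gramDet p.1 p.2 := by
  simp only [gramDet_apply]
  fun_prop

/-- The coefficient of `x₁ ∧ ⋯ ∧ xₖ` with respect to `b₁ ∧ ⋯ ∧ bₖ`, for `xᵢ` in the span of the
linearly independent family `b`. -/
noncomputable def wedgeCoef {k : ℕ} (b x : Fin k → E) : ℂ := gramDet b x / gramDet b b

/-- The linear functional on the exterior algebra extending `gramDet b`. -/
noncomputable def gramFunctional {k : ℕ} (b : Fin k → E) : ExteriorAlgebra ℂ E →ₗ[ℂ] ℂ :=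
  ExteriorAlgebra.liftAlternating (Pi.single k (gramDet b))

theorem gramFunctional_wedge {k : ℕ} (b x : Fin k → E) :
    gramFunctional b (wedge x) = gramDet b x := by
  simp [gramFunctional, ExteriorAlgebra.liftAlternating_apply_ιMulti]

theorem wedge_ne_zero {k : ℕ} {b : Fin k → E} (hb : LinearIndependent ℂ b) : wedge b ≠ 0 := by
  intro h
  apply gramDet_self_ne_zero hb
  rw [← gramFunctional_wedge, h, map_zero]

/-- After clearing the denominator, both sides are alternating in `x` on the span of `b`. They need
only be compared on permutations of `b`, where both acquire the same sign. -/
theorem wedge_eq_coef_smul {k : ℕ} {b : Fin k → E} (hb : LinearIndependent ℂ b) {x : Fin k → E}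
    (hx : ∀ i, x i ∈ Submodule.span ℂ (Set.range b)) : wedge x = wedgeCoef b x • wedge b := by
  classical
  set V := Submodule.span ℂ (Set.range b)
  let B := Module.Basis.span hb
  have hB : ∀ i, ((B i : V) : E) = b i := fun i => congrArg Subtype.val (Module.Basis.span_apply hb i)
  let f₁ : V [⋀^Fin k]→ₗ[ℂ] ExteriorAlgebra ℂ E :=
    gramDet b b • (ExteriorAlgebra.ιMulti ℂ k).compLinearMap V.subtype
  let f₂ : V [⋀^Fin k]→ₗ[ℂ] ExteriorAlgebra ℂ E :=
    (LinearMap.toSpanSingleton ℂ _ (wedge b)).compAlternatingMap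
      ((gramDet b).compLinearMap V.subtype)
  have key : f₁ = f₂ := by
    refine Module.Basis.ext_alternating B fun σ hσ => ?_
    let s : Equiv.Perm (Fin k) := Equiv.ofBijective σ ((Finite.injective_iff_bijective).mp hσ)
    have hs : (fun i => V.subtype (B (σ i))) = b ∘ s := by
      funext i; simp [hB, s]
    change gramDet b b • wedge (fun i => V.subtype (B (σ i)))
      = gramDet b (fun i => V.subtype (B (σ i))) • wedge b
    rw [hs, wedge, AlternatingMap.map_perm, AlternatingMap.map_perm, smul_comm, smul_assoc]
  have h := DFunLike.congr_fun key (fun i => (⟨x i, hx i⟩ : V))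
  change gramDet b b • wedge x = gramDet b x • wedge b at h
  rw [wedgeCoef, div_eq_inv_mul, mul_smul, ← h, inv_smul_smul₀ (gramDet_self_ne_zero hb)]

theorem wedgeCoef_eq_of_wedge_eq {k : ℕ} {b : Fin k → E} (hb : LinearIndependent ℂ b)
    {x : Fin k → E} {c : ℂ} (h : wedge x = c • wedge b) : wedgeCoef b x = c := by
  have := congrArg (gramFunctional b) h
  rw [map_smul, gramFunctional_wedge, gramFunctional_wedge, smul_eq_mul] at this
  rw [wedgeCoef, this, mul_div_cancel_right₀ _ (gramDet_self_ne_zero hb)]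

theorem wedgeCoef_self {k : ℕ} {b : Fin k → E} (hb : LinearIndependent ℂ b) :
    wedgeCoef b b = 1 := div_self (gramDet_self_ne_zero hb)

theorem wedgeCoef_ne_zero {k : ℕ} {b : Fin k → E} (hb : LinearIndependent ℂ b) {x : Fin k → E}
    (hi : LinearIndependent ℂ x) (hx : ∀ i, x i ∈ Submodule.span ℂ (Set.range b)) :
    wedgeCoef b x ≠ 0 := by
  intro h
  apply wedge_ne_zero hi
  rw [wedge_eq_coef_smul hb hx, h, zero_smul]

theorem continuousOn_wedgeCoef {k : ℕ} :
    ContinuousOn (fun p : (Fin k → E) × (Fin k → E) => wedgeCoef p.1 p.2)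
      {p | LinearIndependent ℂ p.1} :=
  ContinuousOn.div continuous_gramDet.continuousOn
    (continuous_gramDet.comp (continuous_fst.prodMk continuous_fst)).continuousOn
    fun _ hp => gramDet_self_ne_zero hp

theorem isOpen_linearIndependent {k : ℕ} : IsOpen {b : Fin k → E | LinearIndependent ℂ b} := by
  have : {b : Fin k → E | LinearIndependent ℂ b} = {b | gramDet b b ≠ 0} :=
    Set.ext fun b => ⟨gramDet_self_ne_zero, linearIndependent_of_gramDet_ne_zero⟩
  rw [this]
  exact isOpen_ne_fun (continuous_gramDet.comp (continuous_id.prodMk continuous_id))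
    continuous_const

theorem wedge_mul_ι_eq_zero {k : ℕ} (b : Fin k → E) {v : E}
    (hv : v ∈ Submodule.span ℂ (Set.range b)) : wedge b * ExteriorAlgebra.ι ℂ v = 0 := by
  induction hv using Submodule.span_induction with
  | mem x hx =>
    obtain ⟨i, rfl⟩ := hx
    have h1 : ExteriorAlgebra.ι ℂ (b i) = wedge ![b i] := by
      simp [ExteriorAlgebra.ιMulti_apply]
    rw [h1, ExteriorAlgebra.ιMulti_mul_ιMulti]
    apply ExteriorAlgebra.ιMulti_eq_zero_of_not_inj
    intro h
    have := @h (Fin.castAdd 1 i) (Fin.natAdd k 0) (by simp)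
    simp [Fin.ext_iff] at this
    omega
  | zero => simp
  | add x y _ _ hx hy => rw [map_add, mul_add, hx, hy, add_zero]
  | smul c x _ hx => rw [map_smul, mul_smul_comm, hx, smul_zero]

/-- Vectors in the span of `b` are killed by `⋀ b`, so the first vector can be exchanged. It is then
appended to `b`, which only enlarges the span and lets the induction run with general `k`. -/
theorem wedge_mul_wedge_congr {n : ℕ} : ∀ {k : ℕ} (b : Fin k → E) {x y : Fin n → E},
    (∀ i, x i - y i ∈ Submodule.span ℂ (Set.range b)) →
    wedge b * wedge x = wedge b * wedge y := by
  induction n with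
  | zero => intro k b x y _; simp
  | succ n ih =>
    intro k b x y h
    have h0 : wedge b * ExteriorAlgebra.ι ℂ (x 0) = wedge b * ExteriorAlgebra.ι ℂ (y 0) := by
      have := wedge_mul_ι_eq_zero b (h 0)
      rwa [map_sub, mul_sub, sub_eq_zero] at this
    have h1 : ExteriorAlgebra.ι ℂ (x 0) = wedge ![x 0] := by
      simp [ExteriorAlgebra.ιMulti_apply]
    have h2 := ih (Fin.append b ![x 0]) (x := Matrix.vecTail x) (y := Matrix.vecTail y) fun i =>
      Submodule.span_mono (by
        rintro _ ⟨j, rfl⟩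
        exact ⟨Fin.castAdd 1 j, by simp⟩) (h i.succ)
    rw [wedge_append, ← h1] at h2
    have hs : ∀ z : Fin (n + 1) → E,
        wedge z = ExteriorAlgebra.ι ℂ (z 0) * wedge (Matrix.vecTail z) :=
      fun z => ExteriorAlgebra.ιMulti_succ_apply z
    rw [hs x, hs y, ← mul_assoc, ← mul_assoc, h2, h0]

theorem range_append {α : Type*} {m n : ℕ} (a : Fin m → α) (b : Fin n → α) :
    Set.range (Fin.append a b) = Set.range a ∪ Set.range b := by
  ext x
  constructor
  · rintro ⟨i, rfl⟩
    induction i using Fin.addCases with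
    | left i => left; exact ⟨i, by simp⟩
    | right i => right; exact ⟨i, by simp⟩
  · rintro (⟨i, rfl⟩ | ⟨i, rfl⟩)
    · exact ⟨Fin.castAdd n i, by simp⟩
    · exact ⟨Fin.natAdd m i, by simp⟩

theorem span_append {m n : ℕ} (a : Fin m → E) (b : Fin n → E) :
    Submodule.span ℂ (Set.range (Fin.append a b))
      = Submodule.span ℂ (Set.range a) ⊔ Submodule.span ℂ (Set.range b) := by
  rw [range_append, Submodule.span_union]

theorem linearIndependent_append {m n : ℕ} {a : Fin m → E} {b : Fin n → E}
    (ha : LinearIndependent ℂ a) (hb : LinearIndependent ℂ b)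
    (h : Disjoint (Submodule.span ℂ (Set.range a)) (Submodule.span ℂ (Set.range b))) :
    LinearIndependent ℂ (Fin.append a b) := by
  rw [← linearIndependent_equiv finSumFinEquiv]
  have : Fin.append a b ∘ finSumFinEquiv = Sum.elim a b := by
    funext i; rcases i with i | i <;> simp
  rw [this]
  exact ha.sum_type hb h

theorem exists_basis_fin (V : Submodule ℂ E) [FiniteDimensional ℂ V] :
    ∃ b : Fin (Module.finrank ℂ V) → E,
      LinearIndependent ℂ b ∧ Submodule.span ℂ (Set.range b) = V := by
  let B := Module.finBasis ℂ V
  refine ⟨fun i => (B i : E), B.linearIndependent.map' V.subtype V.ker_subtype, ?_⟩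
  have := congrArg (Submodule.map V.subtype) B.span_eq
  rw [Submodule.map_span, Submodule.map_top, Submodule.range_subtype, ← Set.range_comp] at this
  exact this

theorem topPow_eq_span {k : ℕ} {V : Submodule ℂ E} {b : Fin k → E} (hb : LinearIndependent ℂ b)
    (hV : Submodule.span ℂ (Set.range b) = V) : topPow V = Submodule.span ℂ {wedge b} := by
  have hk : Module.finrank ℂ V = k := by
    rw [← hV, finrank_span_eq_card hb, Fintype.card_fin]
  have h1 : V.map (ExteriorAlgebra.ι ℂ) = Submodule.span ℂ (Set.range (ExteriorAlgebra.ι ℂ ∘ b)) := by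
    rw [← hV, Submodule.map_span, ← Set.range_comp]
  rw [topPow, hk, h1, Submodule.span_pow]
  apply le_antisymm
  · rw [Submodule.span_le]
    intro a ha
    obtain ⟨f, rfl⟩ := Set.mem_pow.mp ha
    have hf : ∀ i, ∃ j, ExteriorAlgebra.ι ℂ (b j) = (f i : ExteriorAlgebra ℂ E) := fun i => (f i).2
    choose j hj using hf
    have : (List.ofFn fun i => (f i : ExteriorAlgebra ℂ E)).prod = wedge (b ∘ j) := by
      rw [wedge_apply]
      congr 2
      funext i
      exact (hj i).symm
    rw [this, wedge_eq_coef_smul hb (x := b ∘ j) fun i => Submodule.subset_span ⟨j i, rfl⟩]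
    exact Submodule.smul_mem _ _ (Submodule.mem_span_singleton_self _)
  · rw [Submodule.span_singleton_le_iff_mem]
    apply Submodule.subset_span
    rw [Set.mem_pow]
    exact ⟨fun i => ⟨_, ⟨i, rfl⟩⟩, (wedge_apply b).symm⟩

theorem wedge_mem_topPow {k : ℕ} {V : Submodule ℂ E} {b : Fin k → E} (hb : LinearIndependent ℂ b)
    (hV : Submodule.span ℂ (Set.range b) = V) : wedge b ∈ topPow V := by
  rw [topPow_eq_span hb hV]
  exact Submodule.mem_span_singleton_self _

theorem exists_smul_of_mem_topPow {k : ℕ} {V : Submodule ℂ E} {b : Fin k → E}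
    (hb : LinearIndependent ℂ b) (hV : Submodule.span ℂ (Set.range b) = V)
    {x : ExteriorAlgebra ℂ E} (hx : x ∈ topPow V) : ∃ c : ℂ, x = c • wedge b := by
  rw [topPow_eq_span hb hV, Submodule.mem_span_singleton] at hx
  exact hx.imp fun _ h => h.symm

/-- A functional on `⋀ V` with prescribed value at the wedge product of a basis. -/
theorem exists_dual_topPow {k : ℕ} {V : Submodule ℂ E} {b : Fin k → E}
    (hb : LinearIndependent ℂ b) (hV : Submodule.span ℂ (Set.range b) = V) (c : ℂ) :
    ∃ α : Module.Dual ℂ (topPow V), α ⟨wedge b, wedge_mem_topPow hb hV⟩ = c := by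
  refine ⟨(c / gramDet b b) • (gramFunctional b).comp (topPow V).subtype, ?_⟩
  simp only [LinearMap.smul_apply, LinearMap.comp_apply, Submodule.subtype_apply,
    gramFunctional_wedge, smul_eq_mul]
  exact div_mul_cancel₀ _ (gramDet_self_ne_zero hb)

end Wedge

/-! ### Spectral subspaces -/

section SpecSpace

variable {E F : Type*} [NormedAddCommGroup E] [InnerProductSpace ℂ E]
  [NormedAddCommGroup F] [InnerProductSpace ℂ F]

theorem finiteDimensional_of_span_eq {k : ℕ} {e : Fin k → E} {V : Submodule ℂ E}
    (h : Submodule.span ℂ (Set.range e) = V) : FiniteDimensional ℂ V := by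
  rw [← h]
  exact FiniteDimensional.span_of_finite ℂ (Set.finite_range e)

theorem exists_smul_wedge_of_span_eq {k l : ℕ} {e : Fin k → E} {b : Fin l → E} {V : Submodule ℂ E}
    (he : LinearIndependent ℂ e) (hes : Submodule.span ℂ (Set.range e) = V)
    (hb : LinearIndependent ℂ b) (hbs : Submodule.span ℂ (Set.range b) = V) :
    ∃ x : ℂ, x ≠ 0 ∧ wedge e = x • wedge b := by
  obtain ⟨x, hx⟩ := exists_smul_of_mem_topPow hb hbs (wedge_mem_topPow he hes)
  refine ⟨x, ?_, hx⟩
  rintro rfl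
  exact wedge_ne_zero he (by rw [hx, zero_smul])

theorem specSpace_union (A : E →L[ℂ] E) (I J : Set ℝ) :
    specSpace A (I ∪ J) = specSpace A I ⊔ specSpace A J := by
  simp only [specSpace]
  exact iSup_union

theorem specSpace_mono (A : E →L[ℂ] E) {I J : Set ℝ} (h : I ⊆ J) :
    specSpace A I ≤ specSpace A J := biSup_mono h

theorem disjoint_specSpace (A : E →L[ℂ] E) {I J : Set ℝ} (h : Disjoint I J) :
    Disjoint (specSpace A I) (specSpace A J) := by
  have h1 := Module.End.eigenspaces_iSupIndep (A : Module.End ℂ E)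
  have h2 : ∀ K : Set ℝ, specSpace A K
      = ⨆ z ∈ ((↑) : ℝ → ℂ) '' K, Module.End.eigenspace (A : Module.End ℂ E) z := by
    intro K
    rw [iSup_image]; rfl
  rw [h2, h2]
  exact h1.disjoint_biSup_biSup
    ((Set.disjoint_image_iff Complex.ofReal_injective).mpr h)

theorem eigenspace_le_specSpace (A : E →L[ℂ] E) {I : Set ℝ} {x : ℝ} (hx : x ∈ I) :
    Module.End.eigenspace (A : E →ₗ[ℂ] E) (x : ℂ) ≤ specSpace A I :=
  le_biSup (fun x : ℝ => Module.End.eigenspace (A : E →ₗ[ℂ] E) (x : ℂ)) hx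

theorem mem_eigenspace_iff' (A : E →L[ℂ] E) (c : ℂ) (v : E) :
    v ∈ Module.End.eigenspace (A : E →ₗ[ℂ] E) c ↔ A v = c • v := by
  rw [Module.End.mem_eigenspace_iff]; rfl

variable [CompleteSpace E] [CompleteSpace F]

theorem codSpace_eq (P : E →L[ℂ] F) (I : Set ℝ) :
    codSpace P I = domSpace (ContinuousLinearMap.adjoint P) I := by
  rw [codSpace, domSpace, ContinuousLinearMap.adjoint_adjoint]

theorem domSpace_zero (P : E →L[ℂ] F) : domSpace P {0} = P.ker := by
  rw [domSpace, specSpace, iSup_singleton]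
  ext x
  rw [mem_eigenspace_iff', LinearMap.mem_ker]
  simp only [Complex.ofReal_zero, zero_smul, ContinuousLinearMap.comp_apply]
  constructor
  · intro h
    have : inner ℂ (P x) (P x) = (0 : ℂ) := by
      rw [← ContinuousLinearMap.adjoint_inner_left, h, inner_zero_left]
    exact inner_self_eq_zero.mp this
  · intro h
    rw [show P x = 0 from h, map_zero]

theorem domSpace_Icc (P : E →L[ℂ] F) {μ : ℝ} (hμ : 0 ≤ μ) :
    domSpace P (Set.Icc 0 μ) = P.ker ⊔ domSpace P (Set.Ioc 0 μ) := by
  rw [← domSpace_zero P, domSpace, domSpace, domSpace, ← specSpace_union, ← Set.Ioc_union_left hμ,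
    Set.union_comm]

theorem disjoint_ker_domSpace (P : E →L[ℂ] F) {I : Set ℝ} (hI : (0 : ℝ) ∉ I) :
    Disjoint P.ker (domSpace P I) := by
  rw [← domSpace_zero P]
  exact disjoint_specSpace _ (Set.disjoint_singleton_left.mpr hI)

theorem codSpace_Icc (P : E →L[ℂ] F) {μ : ℝ} (hμ : 0 ≤ μ) :
    codSpace P (Set.Icc 0 μ)
      = (ContinuousLinearMap.adjoint P).ker ⊔ codSpace P (Set.Ioc 0 μ) := by
  rw [codSpace_eq, codSpace_eq, domSpace_Icc _ hμ]

theorem map_domSpace_le (P : E →L[ℂ] F) (I : Set ℝ) :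
    (domSpace P I).map (P : E →ₗ[ℂ] F) ≤ codSpace P I := by
  rw [domSpace, specSpace, Submodule.map_iSup]
  refine iSup_le fun x => ?_
  rw [Submodule.map_iSup]
  refine iSup_le fun hx => ?_
  rintro _ ⟨v, hv, rfl⟩
  refine eigenspace_le_specSpace _ hx ?_
  rw [SetLike.mem_coe, mem_eigenspace_iff'] at hv
  rw [mem_eigenspace_iff']
  change P (ContinuousLinearMap.adjoint P (P v)) = (x : ℂ) • P v
  rw [← map_smul, ← hv]; rfl

/-- On an eigenspace with eigenvalue `x ≠ 0`, the operator `x⁻¹ P†` inverts `P`. -/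
theorem map_domSpace (P : E →L[ℂ] F) {I : Set ℝ} (hI : (0 : ℝ) ∉ I) :
    (domSpace P I).map (P : E →ₗ[ℂ] F) = codSpace P I := by
  refine le_antisymm (map_domSpace_le P I) ?_
  refine iSup₂_le fun x hx w hw => ?_
  have hx0 : (x : ℂ) ≠ 0 := by
    rintro h
    exact hI (Complex.ofReal_eq_zero.mp h ▸ hx)
  rw [mem_eigenspace_iff'] at hw
  refine ⟨(x : ℂ)⁻¹ • ContinuousLinearMap.adjoint P w, ?_, ?_⟩
  · refine eigenspace_le_specSpace _ hx ?_
    rw [mem_eigenspace_iff', map_smul, smul_comm]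
    congr 1
    change ContinuousLinearMap.adjoint P (P (ContinuousLinearMap.adjoint P w)) = _
    rw [← map_smul, ← hw]; rfl
  · change P ((x : ℂ)⁻¹ • ContinuousLinearMap.adjoint P w) = w
    rw [map_smul, inv_smul_eq_iff₀ hx0, ← hw]; rfl

theorem linearIndependent_map_domSpace (P : E →L[ℂ] F) {I : Set ℝ} (hI : (0 : ℝ) ∉ I) {q : ℕ}
    {b : Fin q → E} (hb : LinearIndependent ℂ b)
    (hs : Submodule.span ℂ (Set.range b) ≤ domSpace P I) : LinearIndependent ℂ (P ∘ b) :=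
  hb.map ((disjoint_ker_domSpace P hI).symm.mono_left hs)

theorem span_map_domSpace (P : E →L[ℂ] F) {I : Set ℝ} (hI : (0 : ℝ) ∉ I) {q : ℕ}
    {b : Fin q → E} (hs : Submodule.span ℂ (Set.range b) = domSpace P I) :
    Submodule.span ℂ (Set.range (P ∘ b)) = codSpace P I := by
  rw [← map_domSpace P hI, ← hs, Submodule.map_span, ← Set.range_comp]; rfl

end SpecSpace

/-! ### Stabilization in adapted bases -/

section Stab

variable {E F : Type*}
  [NormedAddCommGroup E] [InnerProductSpace ℂ E] [CompleteSpace E]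
  [NormedAddCommGroup F] [InnerProductSpace ℂ F] [CompleteSpace F]

/-- Bases `b₀` of `Ker P`, `b₁` of `V_{(0,μ]}(P†P)` and `c₀` of `Ker P†`. -/
structure AdaptedBasis (P : E →L[ℂ] F) (μ : ℝ) {p q r : ℕ} (b₀ : Fin p → E) (b₁ : Fin q → E)
    (c₀ : Fin r → F) : Prop where
  pos : 0 ≤ μ
  indep_ker : LinearIndependent ℂ b₀
  span_ker : Submodule.span ℂ (Set.range b₀) = P.ker
  indep : LinearIndependent ℂ b₁
  span : Submodule.span ℂ (Set.range b₁) = domSpace P (Set.Ioc 0 μ)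
  indep_coker : LinearIndependent ℂ c₀
  span_coker : Submodule.span ℂ (Set.range c₀) = (ContinuousLinearMap.adjoint P).ker

/-- The element `⋀ b₀ ⊗ (⋀ c₀)*` of the determinant line. -/
def IsKerElement (P : E →L[ℂ] F) {p r : ℕ} (b₀ : Fin p → E) (c₀ : Fin r → F) (d : DetLine P) :
    Prop :=
  ∃ (v : topPow P.ker)
    (α : Module.Dual ℂ (topPow (ContinuousLinearMap.adjoint P).ker))
    (x : topPow (ContinuousLinearMap.adjoint P).ker),
    (v : ExteriorAlgebra ℂ E) = wedge b₀ ∧ (x : ExteriorAlgebra ℂ F) = wedge c₀ ∧ α x = 1 ∧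
    d = v ⊗ₜ[ℂ] α

namespace AdaptedBasis

variable {P : E →L[ℂ] F} {μ : ℝ} {p q r : ℕ} {b₀ : Fin p → E} {b₁ : Fin q → E} {c₀ : Fin r → F}

theorem indep_dom (h : AdaptedBasis P μ b₀ b₁ c₀) : LinearIndependent ℂ (Fin.append b₀ b₁) := by
  refine linearIndependent_append h.indep_ker h.indep ?_
  rw [h.span_ker, h.span]
  exact disjoint_ker_domSpace P (by simp)

theorem span_dom (h : AdaptedBasis P μ b₀ b₁ c₀) :
    Submodule.span ℂ (Set.range (Fin.append b₀ b₁)) = domSpace P (Set.Icc 0 μ) := by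
  rw [span_append, h.span_ker, h.span, domSpace_Icc P h.pos]

theorem indep_image (h : AdaptedBasis P μ b₀ b₁ c₀) : LinearIndependent ℂ (P ∘ b₁) :=
  linearIndependent_map_domSpace P (by simp) h.indep h.span.le

theorem span_image (h : AdaptedBasis P μ b₀ b₁ c₀) :
    Submodule.span ℂ (Set.range (P ∘ b₁)) = codSpace P (Set.Ioc 0 μ) :=
  span_map_domSpace P (by simp) h.span

theorem indep_cod (h : AdaptedBasis P μ b₀ b₁ c₀) :
    LinearIndependent ℂ (Fin.append c₀ (P ∘ b₁)) := by
  refine linearIndependent_append h.indep_coker h.indep_image ?_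
  rw [h.span_coker, h.span_image, codSpace_eq]
  exact disjoint_ker_domSpace _ (by simp)

theorem span_cod (h : AdaptedBasis P μ b₀ b₁ c₀) :
    Submodule.span ℂ (Set.range (Fin.append c₀ (P ∘ b₁))) = codSpace P (Set.Icc 0 μ) := by
  rw [span_append, h.span_coker, h.span_image, codSpace_Icc P h.pos]

theorem exists_isKerElement (h : AdaptedBasis P μ b₀ b₁ c₀) : ∃ d, IsKerElement P b₀ c₀ d := by
  obtain ⟨α, hα⟩ := exists_dual_topPow h.indep_coker h.span_coker 1
  exact ⟨_, ⟨_, wedge_mem_topPow h.indep_ker h.span_ker⟩, α, _, rfl, rfl, hα, rfl⟩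

/-- All the lines involved are spanned by wedges of the adapted bases, so the existential
quantifiers in `IsStab` reduce to scalars. Using `P ∘ b₁` as basis of `V_{(0,μ]}(PP†)` makes `⋀P`
the identity in coordinates, and no determinant of `P` remains. -/
theorem isStab_iff (h : AdaptedBasis P μ b₀ b₁ c₀) {d₀ : DetLine P} (hd₀ : IsKerElement P b₀ c₀ d₀)
    {ξ : ExteriorAlgebra ℂ E} {φ : Module.Dual ℂ (topPow (codSpace P (Set.Icc 0 μ)))}
    {d : DetLine P} :
    IsStab P μ ξ φ d ↔ ∃ a : ℂ, ξ = a • wedge (Fin.append b₀ b₁) ∧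
      d = (a * φ ⟨wedge (Fin.append c₀ (P ∘ b₁)), wedge_mem_topPow h.indep_cod h.span_cod⟩) • d₀ := by
  obtain ⟨v₀, α₀, x₀, hv₀, hx₀, hα₀, rfl⟩ := hd₀
  set z₀ : topPow (codSpace P (Set.Icc 0 μ)) :=
    ⟨wedge (Fin.append c₀ (P ∘ b₁)), wedge_mem_topPow h.indep_cod h.span_cod⟩
  set y₀ : topPow (codSpace P (Set.Ioc 0 μ)) :=
    ⟨wedge (P ∘ b₁), wedge_mem_topPow h.indep_image h.span_image⟩
  have hz₀ : (z₀ : ExteriorAlgebra ℂ F) = (x₀ : ExteriorAlgebra ℂ F) * y₀ := by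
    rw [hx₀]; exact wedge_append _ _
  have hmap : ∀ c : ℂ, ExteriorAlgebra.map (P : E →ₗ[ℂ] F) (c • wedge b₁)
      = ((c • y₀ : topPow (codSpace P (Set.Ioc 0 μ))) : ExteriorAlgebra ℂ F) := by
    intro c
    rw [map_smul, wedge, ExteriorAlgebra.map_apply_ιMulti]; rfl
  have hx : ∀ x : topPow (ContinuousLinearMap.adjoint P).ker, ∃ c : ℂ, x = c • x₀ := by
    intro x
    obtain ⟨c, hc⟩ := exists_smul_of_mem_topPow h.indep_coker h.span_coker x.2
    exact ⟨c, Subtype.ext (by rw [hc, ← hx₀]; rfl)⟩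
  have hy : ∀ y : topPow (codSpace P (Set.Ioc 0 μ)), ∃ c : ℂ, y = c • y₀ := by
    intro y
    obtain ⟨c, hc⟩ := exists_smul_of_mem_topPow h.indep_image h.span_image y.2
    exact ⟨c, Subtype.ext hc⟩
  constructor
  · rintro ⟨v, w, α, β, hξ, hφ, y, hyw, rfl⟩
    obtain ⟨s, hs⟩ := exists_smul_of_mem_topPow h.indep_ker h.span_ker v.2
    obtain ⟨t, ht⟩ := exists_smul_of_mem_topPow h.indep h.span w.2
    have hv : v = s • v₀ := Subtype.ext (by rw [hs, ← hv₀]; rfl)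
    have hα : α = α x₀ • α₀ := by
      ext x
      obtain ⟨c, rfl⟩ := hx x
      simp [hα₀, mul_comm]
    have hyy : y = t • y₀ := Subtype.ext (by rw [hyw, ht, hmap])
    refine ⟨s * t, ?_, ?_⟩
    · rw [hξ, hs, ht, wedge_append, smul_mul_smul_comm]
    · rw [hφ x₀ y₀ z₀ hz₀, hα, hyy, hv, TensorProduct.smul_tmul_smul, smul_smul]
      simp only [map_smul, smul_eq_mul, LinearMap.smul_apply, hα₀]
      congr 1
      ring
  · rintro ⟨a, rfl, rfl⟩
    obtain ⟨β, hβ⟩ := exists_dual_topPow h.indep_image h.span_image (φ z₀)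
    refine ⟨v₀, ⟨a • wedge b₁, Submodule.smul_mem _ _ (wedge_mem_topPow h.indep h.span)⟩, α₀, β,
      ?_, ?_, a • y₀, (hmap a).symm, ?_⟩
    · rw [wedge_append, hv₀, mul_smul_comm]
    · intro x y z hz
      obtain ⟨s, rfl⟩ := hx x
      obtain ⟨t, rfl⟩ := hy y
      have : z = (s * t) • z₀ := Subtype.ext (by
        rw [hz, Submodule.coe_smul, Submodule.coe_smul, Submodule.coe_smul, hz₀,
          smul_mul_smul_comm])
      rw [this, map_smul, map_smul, map_smul, hα₀, smul_eq_mul, smul_eq_mul, smul_eq_mul]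
      change _ = s * 1 * (t * β y₀)
      rw [show β y₀ = φ z₀ from hβ]
      ring
    · rw [map_smul, show β y₀ = φ z₀ from hβ, smul_eq_mul]

end AdaptedBasis

theorem exists_adaptedBasis {P : E →L[ℂ] F} {μ : ℝ} (hμ : 0 ≤ μ)
    (hV : FiniteDimensional ℂ (domSpace P (Set.Icc 0 μ)))
    (hW : FiniteDimensional ℂ (codSpace P (Set.Icc 0 μ))) :
    ∃ (p q r : ℕ) (b₀ : Fin p → E) (b₁ : Fin q → E) (c₀ : Fin r → F),
      AdaptedBasis P μ b₀ b₁ c₀ := by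
  have h0 : FiniteDimensional ℂ P.ker :=
    Submodule.finiteDimensional_of_le (le_sup_left.trans (domSpace_Icc P hμ).ge)
  have h1 : FiniteDimensional ℂ (domSpace P (Set.Ioc 0 μ)) :=
    Submodule.finiteDimensional_of_le (le_sup_right.trans (domSpace_Icc P hμ).ge)
  have h2 : FiniteDimensional ℂ (ContinuousLinearMap.adjoint P).ker :=
    Submodule.finiteDimensional_of_le (le_sup_left.trans (codSpace_Icc P hμ).ge)
  obtain ⟨b₀, hb₀, hb₀'⟩ := exists_basis_fin P.ker
  obtain ⟨b₁, hb₁, hb₁'⟩ := exists_basis_fin (domSpace P (Set.Ioc 0 μ))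
  obtain ⟨c₀, hc₀, hc₀'⟩ := exists_basis_fin (ContinuousLinearMap.adjoint P).ker
  exact ⟨_, _, _, b₀, b₁, c₀, hμ, hb₀, hb₀', hb₁, hb₁', hc₀, hc₀'⟩

/-- `d = stab ((e₁ ∧ ⋯ ∧ eₖ) ⊗ (f₁ ∧ ⋯ ∧ fₗ)*)` for bases `e` of `V_{[0,μ]}(P†P)` and `f` of
`V_{[0,μ]}(PP†)`. -/
structure IsFrameStab (P : E →L[ℂ] F) (μ : ℝ) {k l : ℕ} (e : Fin k → E) (f : Fin l → F)
    (d : DetLine P) : Prop where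
  pos : 0 ≤ μ
  indep_e : LinearIndependent ℂ e
  span_e : Submodule.span ℂ (Set.range e) = domSpace P (Set.Icc 0 μ)
  indep_f : LinearIndependent ℂ f
  span_f : Submodule.span ℂ (Set.range f) = codSpace P (Set.Icc 0 μ)
  isStab : ∃ (φ : Module.Dual ℂ (topPow (codSpace P (Set.Icc 0 μ))))
    (z : topPow (codSpace P (Set.Icc 0 μ))),
    (z : ExteriorAlgebra ℂ F) = wedge f ∧ φ z = 1 ∧ IsStab P μ (wedge e) φ d

theorem AdaptedBasis.eq_smul_of_isFrameStab {P : E →L[ℂ] F} {μ : ℝ} {p q r k l : ℕ}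
    {b₀ : Fin p → E} {b₁ : Fin q → E} {c₀ : Fin r → F} (h : AdaptedBasis P μ b₀ b₁ c₀)
    {d₀ : DetLine P} (hd₀ : IsKerElement P b₀ c₀ d₀) {e : Fin k → E} {f : Fin l → F}
    {d : DetLine P} (hd : IsFrameStab P μ e f d) {x y : ℂ}
    (hx : wedge e = x • wedge (Fin.append b₀ b₁))
    (hy : wedge f = y • wedge (Fin.append c₀ (P ∘ b₁))) : d = (x / y) • d₀ := by
  obtain ⟨φ, z, hz, hφ, hs⟩ := hd.isStab
  obtain ⟨a, ha, rfl⟩ := (h.isStab_iff hd₀).mp hs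
  have hax : a = x := by
    rw [hx] at ha
    exact (smul_left_injective ℂ (wedge_ne_zero h.indep_dom) ha).symm
  have hz' : z = y • (⟨wedge (Fin.append c₀ (P ∘ b₁)), wedge_mem_topPow h.indep_cod h.span_cod⟩ :
      topPow (codSpace P (Set.Icc 0 μ))) := Subtype.ext (by rw [hz, hy]; rfl)
  rw [hz', map_smul, smul_eq_mul] at hφ
  rw [hax, eq_one_div_of_mul_eq_one_right hφ, mul_one_div]

theorem exists_isFrameStab {P : E →L[ℂ] F} {μ : ℝ} (hμ : 0 ≤ μ) {k l : ℕ} {e : Fin k → E}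
    {f : Fin l → F} (he : LinearIndependent ℂ e)
    (hes : Submodule.span ℂ (Set.range e) = domSpace P (Set.Icc 0 μ)) (hf : LinearIndependent ℂ f)
    (hfs : Submodule.span ℂ (Set.range f) = codSpace P (Set.Icc 0 μ)) :
    ∃ d, IsFrameStab P μ e f d := by
  obtain ⟨p, q, r, b₀, b₁, c₀, h⟩ := exists_adaptedBasis hμ (finiteDimensional_of_span_eq hes)
    (finiteDimensional_of_span_eq hfs)
  obtain ⟨d₀, hd₀⟩ := h.exists_isKerElement
  obtain ⟨x, hx⟩ := exists_smul_of_mem_topPow h.indep_dom h.span_dom (wedge_mem_topPow he hes)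
  obtain ⟨φ, hφ⟩ := exists_dual_topPow hf hfs 1
  exact ⟨_, hμ, he, hes, hf, hfs, φ, _, rfl, hφ, (h.isStab_iff hd₀).mpr ⟨x, hx, rfl⟩⟩

theorem AdaptedBasis.isKerElement_spans {P : E →L[ℂ] F} {μ : ℝ} {p q r : ℕ}
    {b₀ : Fin p → E} {b₁ : Fin q → E} {c₀ : Fin r → F} (h : AdaptedBasis P μ b₀ b₁ c₀)
    {d₀ : DetLine P} (hd₀ : IsKerElement P b₀ c₀ d₀) : d₀ ≠ 0 ∧ ∀ d, ∃ c : ℂ, d = c • d₀ := by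
  obtain ⟨v₀, α₀, x₀, hv₀, hx₀, hα₀, rfl⟩ := hd₀
  have hv : ∀ v : topPow P.ker, ∃ c : ℂ, v = c • v₀ := by
    intro v
    obtain ⟨c, hc⟩ := exists_smul_of_mem_topPow h.indep_ker h.span_ker v.2
    exact ⟨c, Subtype.ext (by rw [hc, ← hv₀]; rfl)⟩
  have hx : ∀ x : topPow (ContinuousLinearMap.adjoint P).ker, ∃ c : ℂ, x = c • x₀ := by
    intro x
    obtain ⟨c, hc⟩ := exists_smul_of_mem_topPow h.indep_coker h.span_coker x.2
    exact ⟨c, Subtype.ext (by rw [hc, ← hx₀]; rfl)⟩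
  constructor
  · intro h0
    obtain ⟨β, hβ⟩ := exists_dual_topPow h.indep_ker h.span_ker 1
    have hv₀' : v₀ = ⟨wedge b₀, wedge_mem_topPow h.indep_ker h.span_ker⟩ := Subtype.ext hv₀
    rw [← hv₀'] at hβ
    -- The functional `v ⊗ α ↦ β v * α x₀` takes the value `1` on `v₀ ⊗ α₀`.
    have := congrArg (TensorProduct.lift
      (LinearMap.mk₂ ℂ (fun (v : topPow P.ker)
        (α : Module.Dual ℂ (topPow (ContinuousLinearMap.adjoint P).ker)) => β v * α x₀)
        (by intros; simp [add_mul]) (by intros; simp [mul_assoc]) (by intros; simp [mul_add])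
        (by intros; simp; ring))) h0
    simp [hβ, hα₀] at this
  · intro d
    induction d using TensorProduct.induction_on with
    | zero => exact ⟨0, by simp⟩
    | tmul v α =>
      obtain ⟨c, rfl⟩ := hv v
      have hα : α = α x₀ • α₀ := by
        ext x
        obtain ⟨c, rfl⟩ := hx x
        simp [hα₀, mul_comm]
      exact ⟨c * α x₀, by rw [hα, TensorProduct.smul_tmul_smul]; simp [hα₀]⟩
    | add a b ha hb =>
      obtain ⟨s, rfl⟩ := ha
      obtain ⟨t, rfl⟩ := hb
      exact ⟨s + t, by rw [add_smul]⟩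

theorem IsFrameStab.spans {P : E →L[ℂ] F} {μ : ℝ} {k l : ℕ} {e : Fin k → E} {f : Fin l → F}
    {d : DetLine P} (h : IsFrameStab P μ e f d) : d ≠ 0 ∧ ∀ d', ∃ c : ℂ, d' = c • d := by
  obtain ⟨p, q, r, b₀, b₁, c₀, hb⟩ := exists_adaptedBasis h.pos
    (finiteDimensional_of_span_eq h.span_e) (finiteDimensional_of_span_eq h.span_f)
  obtain ⟨d₀, hd₀⟩ := hb.exists_isKerElement
  obtain ⟨x, hx0, hx⟩ := exists_smul_wedge_of_span_eq h.indep_e h.span_e hb.indep_dom hb.span_dom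
  obtain ⟨y, hy0, hy⟩ := exists_smul_wedge_of_span_eq h.indep_f h.span_f hb.indep_cod hb.span_cod
  have hd := hb.eq_smul_of_isFrameStab hd₀ h hx hy
  obtain ⟨h1, h2⟩ := hb.isKerElement_spans hd₀
  have hxy : x / y ≠ 0 := div_ne_zero hx0 hy0
  refine ⟨hd ▸ smul_ne_zero hxy h1, fun d' => ?_⟩
  obtain ⟨c, rfl⟩ := h2 d'
  exact ⟨c / (x / y), by rw [hd, smul_smul, div_mul_cancel₀ _ hxy]⟩

/-- Change of cutoff: the transition function between the sections of the determinant line defined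
by frames at cutoffs `μ ≤ μ'`. -/
theorem IsFrameStab.transition {P : E →L[ℂ] F} {μ μ' : ℝ} (hμ : μ ≤ μ') {k l m : ℕ}
    {e : Fin k → E} {f : Fin l → F} {d : DetLine P} (h : IsFrameStab P μ e f d)
    {e' : Fin (k + m) → E} {f' : Fin (l + m) → F} {d' : DetLine P}
    (h' : IsFrameStab P μ' e' f' d') {g : Fin m → E} (hg : ∀ i, g i ∈ domSpace P (Set.Icc 0 μ'))
    (hi : LinearIndependent ℂ (Fin.append e g)) :
    d' = (wedgeCoef f' (Fin.append f (P ∘ g)) / wedgeCoef e' (Fin.append e g)) • d := by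
  have hJ : (0 : ℝ) ∉ Set.Ioc μ μ' := fun h0 => h0.1.not_ge h.pos
  have hV' : domSpace P (Set.Icc 0 μ') = domSpace P (Set.Icc 0 μ) ⊔ domSpace P (Set.Ioc μ μ') := by
    rw [domSpace, domSpace, domSpace, ← specSpace_union, Set.Icc_union_Ioc_eq_Icc h.pos hμ]
  have hVdisj : Disjoint (domSpace P (Set.Icc 0 μ)) (domSpace P (Set.Ioc μ μ')) :=
    disjoint_specSpace _ (Set.disjoint_left.mpr fun x hx hx' => hx'.1.not_ge hx.2)
  have hfV := finiteDimensional_of_span_eq h.span_e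
  have hfV' := finiteDimensional_of_span_eq h'.span_e
  have hfJ : FiniteDimensional ℂ (domSpace P (Set.Ioc μ μ')) :=
    Submodule.finiteDimensional_of_le (le_sup_right.trans hV'.ge)
  obtain ⟨p, q, r, b₀, b₁, c₀, hb⟩ := exists_adaptedBasis h.pos hfV
    (finiteDimensional_of_span_eq h.span_f)
  obtain ⟨d₀, hd₀⟩ := hb.exists_isKerElement
  have hdim : Module.finrank ℂ (domSpace P (Set.Ioc μ μ')) = m := by
    have h1 := Submodule.finrank_sup_add_finrank_inf_eq (domSpace P (Set.Icc 0 μ))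
      (domSpace P (Set.Ioc μ μ'))
    rw [← hV', hVdisj.eq_bot, finrank_bot, ← h.span_e, ← h'.span_e,
      finrank_span_eq_card h.indep_e, finrank_span_eq_card h'.indep_e, Fintype.card_fin,
      Fintype.card_fin] at h1
    omega
  -- The family `g` only completes `e` and may have components in `V_{[0,μ]}`; adapted bases at both
  -- cutoffs need a genuine basis of `V_{(μ,μ']}`.
  obtain ⟨g₁, hg₁, hg₁s⟩ : ∃ b : Fin m → E, LinearIndependent ℂ b ∧
      Submodule.span ℂ (Set.range b) = domSpace P (Set.Ioc μ μ') := by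
    rw [← hdim]; exact exists_basis_fin _
  have hspan1 : Submodule.span ℂ (Set.range (Fin.append b₁ g₁)) = domSpace P (Set.Ioc 0 μ') := by
    rw [span_append, hb.span, hg₁s, domSpace, domSpace, domSpace, ← specSpace_union,
      Set.Ioc_union_Ioc_eq_Ioc h.pos hμ]
  have hb' : AdaptedBasis P μ' b₀ (Fin.append b₁ g₁) c₀ := by
    refine ⟨h'.pos, hb.indep_ker, hb.span_ker, linearIndependent_append hb.indep hg₁ ?_, hspan1,
      hb.indep_coker, hb.span_coker⟩
    rw [hb.span, hg₁s]
    exact disjoint_specSpace _ (Set.disjoint_left.mpr fun x hx hx' => hx'.1.not_ge hx.2)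
  obtain ⟨x, hx0, hx⟩ := exists_smul_wedge_of_span_eq h.indep_e h.span_e hb.indep_dom hb.span_dom
  obtain ⟨y, hy0, hy⟩ := exists_smul_wedge_of_span_eq h.indep_f h.span_f hb.indep_cod hb.span_cod
  obtain ⟨x', hx0', hx'⟩ :=
    exists_smul_wedge_of_span_eq h'.indep_e h'.span_e hb'.indep_dom hb'.span_dom
  obtain ⟨y', hy0', hy'⟩ :=
    exists_smul_wedge_of_span_eq h'.indep_f h'.span_f hb'.indep_cod hb'.span_cod
  have hd := hb.eq_smul_of_isFrameStab hd₀ h hx hy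
  have hd' := hb'.eq_smul_of_isFrameStab hd₀ h' hx' hy'
  -- decompose `g` into components in `V_{[0,μ]}` and `V_{(μ,μ']}`
  have hdec : ∀ i, ∃ w ∈ domSpace P (Set.Ioc μ μ'), g i - w ∈ domSpace P (Set.Icc 0 μ) := by
    intro i
    have := hg i
    rw [hV', Submodule.mem_sup] at this
    obtain ⟨v, hv, w, hw, hvw⟩ := this
    exact ⟨w, hw, by rw [← hvw, add_sub_cancel_right]; exact hv⟩
  choose w hw hgw using hdec
  -- The determinant of `w` relative to `g₁` enters the wedge products in `E` and in `F` alike, and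
  -- cancels in the quotient.
  have hwz := wedge_eq_coef_smul hg₁ (x := w) fun i => hg₁s.symm ▸ hw i
  set z := wedgeCoef g₁ w
  have hPw : wedge (P ∘ w) = z • wedge (P ∘ g₁) := by
    have := congrArg (ExteriorAlgebra.map (P : E →ₗ[ℂ] F)) hwz
    rw [map_smul, wedge, wedge, ExteriorAlgebra.map_apply_ιMulti,
      ExteriorAlgebra.map_apply_ιMulti] at this
    exact this
  have hE : wedge (Fin.append e g) = (z * x / x') • wedge e' := by
    rw [wedge_append, wedge_mul_wedge_congr e (y := w) fun i => h.span_e.symm ▸ hgw i, hwz, hx, hx',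
      smul_smul, div_mul_cancel₀ _ hx0', wedge_append, wedge_append, wedge_append,
      smul_mul_smul_comm, mul_comm z x, mul_assoc]
  have hF : wedge (Fin.append f (P ∘ g)) = (z * y / y') • wedge f' := by
    have hcomp : (P ∘ Fin.append b₁ g₁ : Fin (q + m) → F) = Fin.append (P ∘ b₁) (P ∘ g₁) := by
      funext i
      induction i using Fin.addCases <;> simp
    rw [hcomp] at hy'
    rw [wedge_append, wedge_mul_wedge_congr f (y := P ∘ w) fun i => ?_, hPw, hy, hy',
      smul_smul, div_mul_cancel₀ _ hy0', wedge_append, wedge_append, wedge_append,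
      smul_mul_smul_comm, mul_comm z y, mul_assoc]
    rw [h.span_f]
    have := map_domSpace_le P _ (Submodule.mem_map_of_mem (f := (P : E →ₗ[ℂ] F)) (hgw i))
    simpa using this
  rw [wedgeCoef_eq_of_wedge_eq h'.indep_e hE, wedgeCoef_eq_of_wedge_eq h'.indep_f hF, hd', hd,
    smul_smul]
  have hz0 : z ≠ 0 := by
    intro hz
    apply wedge_ne_zero hi
    rw [hE, hz]; simp
  congr 1
  field_simp

/-- Without kernels, `e` and `P ∘ e` are already adapted bases of the two spectral spaces. The
coefficient is the determinant of `P` in the frames `e` and `f`. -/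
theorem IsFrameStab.eq_smul_isDetOne {P : E →L[ℂ] F} {μ : ℝ} {k : ℕ} {e : Fin k → E}
    {f : Fin k → F} {d d₁ : DetLine P} (h : IsFrameStab P μ e f d) (hP : P.ker = ⊥)
    (hP' : (ContinuousLinearMap.adjoint P).ker = ⊥) (h₁ : IsDetOne P d₁) :
    d = wedgeCoef f (P ∘ e) • d₁ ∧ wedgeCoef f (P ∘ e) ≠ 0 := by
  have hb : AdaptedBasis P μ (Fin.elim0 : Fin 0 → E) e (Fin.elim0 : Fin 0 → F) := by
    refine ⟨h.pos, linearIndependent_empty_type, by simp [hP], h.indep_e, ?_,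
      linearIndependent_empty_type, by simp [hP']⟩
    rw [h.span_e, domSpace_Icc P h.pos, hP, bot_sup_eq]
  have hk : IsKerElement P (Fin.elim0 : Fin 0 → E) (Fin.elim0 : Fin 0 → F) d₁ := by
    obtain ⟨v, α, x, hv, hx, hα, rfl⟩ := h₁
    exact ⟨v, α, x, by rw [hv]; simp, by rw [hx]; simp, hα, rfl⟩
  obtain ⟨y, hy0, hy⟩ := exists_smul_wedge_of_span_eq h.indep_f h.span_f hb.indep_cod hb.span_cod
  have hd := hb.eq_smul_of_isFrameStab hk h (x := 1) (by rw [wedge_append]; simp) hy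
  have hc : wedgeCoef f (P ∘ e) = 1 / y := by
    refine wedgeCoef_eq_of_wedge_eq h.indep_f ?_
    rw [hy, wedge_append]
    simp [smul_smul, hy0]
  rw [hc]
  exact ⟨hd, one_div_ne_zero hy0⟩

end Stab
open Filter Topology

/-! ### Operators invertible modulo compact operators -/

section Essential

variable {E : Type*} [NormedAddCommGroup E] [InnerProductSpace ℂ E]

theorem calkin_eq_iff {A B : E →L[ℂ] E} :
    (A : Calkin E) = (B : Calkin E) ↔ IsCompactOperator (A - B) := by
  rw [RingCon.eq, TwoSidedIdeal.rel_iff, compactIdeal, TwoSidedIdeal.mem_mk']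
  rfl

theorem isUnit_calkin_of_compact {A B C : E →L[ℂ] E} (h₁ : IsCompactOperator (A * B - 1 : E →L[ℂ] E))
    (h₂ : IsCompactOperator (C * A - 1 : E →L[ℂ] E)) : IsUnit (A : Calkin E) := by
  have e₁ : (A : Calkin E) * (B : Calkin E) = 1 := calkin_eq_iff.mpr h₁
  have e₂ : (C : Calkin E) * (A : Calkin E) = 1 := calkin_eq_iff.mpr h₂
  exact isUnit_iff_exists.mpr ⟨B, e₁, by rwa [left_inv_eq_right_inv e₂ e₁] at e₂⟩

theorem notMem_essSpectrum_iff {A : E →L[ℂ] E} {z : ℂ} :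
    z ∉ essSpectrum A ↔ IsUnit ((A - algebraMap ℂ (E →L[ℂ] E) z : E →L[ℂ] E) : Calkin E) := by
  rw [essSpectrum, spectrum.notMem_iff, ← IsUnit.neg_iff, neg_sub]
  rfl

theorem exists_left_inverse_mod_compact {A : E →L[ℂ] E} (h : IsUnit (A : Calkin E)) :
    ∃ B K : E →L[ℂ] E, IsCompactOperator K ∧ B * A = 1 + K := by
  obtain ⟨b, -, hb⟩ := isUnit_iff_exists.mp h
  obtain ⟨B, rfl⟩ := (compactIdeal E).ringCon.mk'_surjective b
  have h1 : ((B * A : E →L[ℂ] E) : Calkin E) = ((1 : E →L[ℂ] E) : Calkin E) := hb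
  exact ⟨B, B * A - 1, calkin_eq_iff.mp h1, by abel⟩

theorem notMem_essSpectrum_of_sub_isUnit {A U K : E →L[ℂ] E} {z : ℂ} (hU : IsUnit U)
    (hK : IsCompactOperator K) (h : A - algebraMap ℂ (E →L[ℂ] E) z = U + K) :
    z ∉ essSpectrum A := by
  have e : ((A - algebraMap ℂ (E →L[ℂ] E) z : E →L[ℂ] E) : Calkin E) = (U : Calkin E) := by
    rw [calkin_eq_iff, h, add_sub_cancel_left]
    exact hK
  rw [notMem_essSpectrum_iff, e]
  exact hU.map (compactIdeal E).ringCon.mk'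

theorem isCompactOperator_of_range_le {F : Type*} [NormedAddCommGroup F] [InnerProductSpace ℂ F]
    {K : E →L[ℂ] F} {W : Submodule ℂ F}
    [FiniteDimensional ℂ W] (h : ∀ x, K x ∈ W) : IsCompactOperator K := by
  have : LocallyCompactSpace W := .of_finiteDimensional_of_complete ℂ W
  have h1 := isCompactOperator_of_locallyCompactSpace_dom (K.codRestrict W h)
  exact h1.clm_comp W.subtypeL

/-- On the kernel `K = -1`, so the identity of the kernel is compact. -/
theorem finiteDimensional_ker_of_compact {T B K : E →L[ℂ] E} (hK : IsCompactOperator K)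
    (h : B * T = 1 + K) : FiniteDimensional ℂ T.ker := by
  have hx : ∀ x ∈ T.ker, K x = -x := by
    intro x hx
    have := DFunLike.congr_fun h x
    simp only [mul_apply_eq_comp, show T x = 0 from hx, map_zero,
      add_apply, one_apply_eq_self] at this
    exact eq_neg_of_add_eq_zero_right this.symm
  have h1 : IsCompactOperator ((K : E →ₗ[ℂ] E).restrict (p := T.ker) (q := T.ker)
      (fun x hx' => by
        change K x ∈ _
        rw [hx x hx']
        exact Submodule.neg_mem _ hx')) := by
    refine IsCompactOperator.restrict (f := (K : E →ₗ[ℂ] E)) hK _ ?_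
    exact ContinuousLinearMap.isClosed_ker T
  have h2 : IsCompactOperator (id : T.ker → T.ker) := by
    convert! h1.neg
    ext x
    simp [hx x.1 x.2]
  exact FiniteDimensional.of_isCompactOperator_id (𝕜 := ℂ) h2

/-- Otherwise there are unit vectors `xₙ ⊥ Ker T` with `T xₙ → 0`. Along a subsequence `K xₙ`
converges, hence so does `xₙ = B T xₙ - K xₙ`; the limit is a unit vector lying both in `Ker T` and
in its orthogonal complement. -/
theorem exists_bound_orthogonal_ker_of_compact {T B K : E →L[ℂ] E} (hK : IsCompactOperator K)
    (h : B * T = 1 + K) : ∃ c > 0, ∀ x ∈ T.kerᗮ, c * ‖x‖ ≤ ‖T x‖ := by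
  by_contra hcon
  push Not at hcon
  have h1 : ∀ n : ℕ, ∃ x ∈ T.kerᗮ, ‖x‖ = 1 ∧ ‖T x‖ < 1 / (n + 1 : ℝ) := by
    intro n
    obtain ⟨x, hx, hlt⟩ := hcon (1 / (n + 1 : ℝ)) (by positivity)
    have hx0 : ‖x‖ ≠ 0 := by
      intro h0
      rw [h0, mul_zero] at hlt
      exact hlt.not_ge (norm_nonneg _)
    refine ⟨((‖x‖⁻¹ : ℝ) : ℂ) • x, Submodule.smul_mem _ _ hx, ?_, ?_⟩
    · rw [norm_smul, Complex.norm_real, norm_inv, norm_norm, inv_mul_cancel₀ hx0]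
    · rw [map_smul, norm_smul, Complex.norm_real, norm_inv, norm_norm, inv_mul_lt_iff₀
        (lt_of_le_of_ne (norm_nonneg _) hx0.symm), mul_comm]
      exact hlt
  choose x hxk hx1 hxT using h1
  have hT : Tendsto (fun n => T (x n)) atTop (𝓝 0) :=
    squeeze_zero_norm (fun n => (hxT n).le) tendsto_one_div_add_atTop_nhds_zero_nat
  have hcpt := IsCompactOperator.isCompact_closure_image_closedBall (𝕜₁ := ℂ)
    (f := (K : E →ₗ[ℂ] E)) hK 1
  obtain ⟨y, -, φ, hφ, hy⟩ := hcpt.tendsto_subseq (x := fun n => K (x n)) fun n =>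
    subset_closure ⟨x n, by simp [hx1 n], rfl⟩
  have hxe : ∀ n, x n = B (T (x n)) - K (x n) := by
    intro n
    have := DFunLike.congr_fun h (x n)
    simp only [mul_apply_eq_comp, add_apply,
      one_apply_eq_self] at this
    rw [this, add_sub_cancel_right]
  have hlim : Tendsto (fun n => x (φ n)) atTop (𝓝 (-y)) := by
    have h2 : Tendsto (fun n => B (T (x (φ n)))) atTop (𝓝 0) := by
      have := (B.continuous.tendsto 0).comp (hT.comp hφ.tendsto_atTop)
      rwa [map_zero] at this
    have h3 := h2.sub hy
    rw [zero_sub] at h3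
    exact h3.congr fun n => (hxe (φ n)).symm
  have hy1 : ‖-y‖ = 1 :=
    tendsto_nhds_unique hlim.norm (by simp [hx1])
  have hyk : -y ∈ T.kerᗮ :=
    (Submodule.isClosed_orthogonal _).mem_of_tendsto hlim (Eventually.of_forall fun n => hxk _)
  have hyT : T (-y) = 0 :=
    tendsto_nhds_unique ((T.continuous.tendsto _).comp hlim) (hT.comp hφ.tendsto_atTop)
  have : inner ℂ (-y) (-y) = (0 : ℂ) := hyk _ hyT
  rw [inner_self_eq_zero.mp this, norm_zero] at hy1
  exact zero_ne_one hy1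

variable [CompleteSpace E]

theorem isUnit_of_isSelfAdjoint_of_bound {T : E →L[ℂ] E} (hT : IsSelfAdjoint T) {c : ℝ}
    (hc : 0 < c) (h : ∀ x, c * ‖x‖ ≤ ‖T x‖) : IsUnit T := by
  rw [ContinuousLinearMap.isUnit_iff_bijective,
    ContinuousLinearMap.bijective_iff_dense_range_and_antilipschitz]
  constructor
  · rw [Submodule.topologicalClosure_eq_top_iff, ContinuousLinearMap.orthogonal_range,
      ← ContinuousLinearMap.star_eq_adjoint, hT.star_eq, Submodule.eq_bot_iff]
    intro x hx
    have h1 := h x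
    rw [show T x = 0 from hx, norm_zero] at h1
    have : ‖x‖ ≤ 0 := by nlinarith [norm_nonneg x]
    exact norm_le_zero_iff.mp this
  · refine ⟨⟨c⁻¹, by positivity⟩, ContinuousLinearMap.antilipschitz_of_bound _ fun x => ?_⟩
    change ‖x‖ ≤ c⁻¹ * ‖T x‖
    rw [le_inv_mul_iff₀ hc]
    exact h x

theorem isSelfAdjoint_sub_ofReal {T : E →L[ℂ] E} (hT : IsSelfAdjoint T) (y : ℝ) :
    IsSelfAdjoint (T - algebraMap ℂ (E →L[ℂ] E) y) := by
  refine hT.sub ?_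
  rw [IsSelfAdjoint, ← algebraMap_star_comm]
  simp

/-- `T` preserves the kernel and its orthogonal complement. There `T - y` is bounded below by `|y|`
and `c - |y|` respectively, so it is bounded below by their minimum, and a self-adjoint operator
bounded below is invertible. -/
theorem isUnit_sub_of_bound {T : E →L[ℂ] E} (hT : IsSelfAdjoint T)
    [FiniteDimensional ℂ T.ker] {c : ℝ} (h : ∀ x ∈ T.kerᗮ, c * ‖x‖ ≤ ‖T x‖) {y : ℝ}
    (hy0 : y ≠ 0) (hyc : |y| < c) : IsUnit (T - algebraMap ℂ (E →L[ℂ] E) y) := by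
  have hm : 0 < min |y| (c - |y|) := lt_min (abs_pos.mpr hy0) (sub_pos.mpr hyc)
  refine isUnit_of_isSelfAdjoint_of_bound (isSelfAdjoint_sub_ofReal hT y) hm fun u => ?_
  obtain ⟨u₀, hu₀, u₁, hu₁, rfl⟩ := T.ker.exists_add_mem_mem_orthogonal u
  set m := min |y| (c - |y|)
  have hTu₀ : T u₀ = 0 := hu₀
  have hTu₁ : T u₁ ∈ T.kerᗮ := by
    intro w hw
    have : inner ℂ (T w) u₁ = inner ℂ w (T u₁) := hT.isSymmetric w u₁
    rw [← this, show T w = 0 from hw, inner_zero_left]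
  have hv : (T - algebraMap ℂ (E →L[ℂ] E) y) (u₀ + u₁)
      = (-(y : ℂ)) • u₀ + (T u₁ - (y : ℂ) • u₁) := by
    simp only [sub_apply, map_add, hTu₀, Algebra.algebraMap_eq_smul_one,
      smul_apply, one_apply_eq_self]
    module
  have o₁ : inner ℂ ((-(y : ℂ)) • u₀) (T u₁ - (y : ℂ) • u₁) = (0 : ℂ) :=
    (Submodule.sub_mem _ hTu₁ (Submodule.smul_mem _ _ hu₁)) _ (Submodule.smul_mem _ _ hu₀)
  have o₂ : inner ℂ u₀ u₁ = (0 : ℂ) := hu₁ _ hu₀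
  have n₁ := norm_add_sq_eq_norm_sq_add_norm_sq_of_inner_eq_zero _ _ o₁
  have n₂ := norm_add_sq_eq_norm_sq_add_norm_sq_of_inner_eq_zero _ _ o₂
  have b₀ : m * ‖u₀‖ ≤ ‖(-(y : ℂ)) • u₀‖ := by
    rw [norm_smul, norm_neg, Complex.norm_real]
    exact mul_le_mul_of_nonneg_right (min_le_left _ _) (norm_nonneg _)
  have b₁ : m * ‖u₁‖ ≤ ‖T u₁ - (y : ℂ) • u₁‖ := by
    have h1 := norm_sub_norm_le (T u₁) ((y : ℂ) • u₁)
    rw [norm_smul, Complex.norm_real, Real.norm_eq_abs] at h1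
    have h2 := h u₁ hu₁
    have h3 : m * ‖u₁‖ ≤ (c - |y|) * ‖u₁‖ :=
      mul_le_mul_of_nonneg_right (min_le_right _ _) (norm_nonneg _)
    linarith
  rw [hv]
  have hsq : (m * ‖u₀ + u₁‖) ^ 2 ≤ ‖(-(y : ℂ)) • u₀ + (T u₁ - (y : ℂ) • u₁)‖ ^ 2 := by
    have e₀ := mul_self_le_mul_self (by positivity) b₀
    have e₁ := mul_self_le_mul_self (by positivity) b₁
    rw [sq, sq, n₁]
    calc m * ‖u₀ + u₁‖ * (m * ‖u₀ + u₁‖) = m * m * (‖u₀ + u₁‖ * ‖u₀ + u₁‖) := by ring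
      _ = m * ‖u₀‖ * (m * ‖u₀‖) + m * ‖u₁‖ * (m * ‖u₁‖) := by rw [n₂]; ring
      _ ≤ _ := add_le_add e₀ e₁
  exact le_of_sq_le_sq hsq (norm_nonneg _)

/-- A left inverse of `A - x` modulo compact operators makes the eigenspace finite-dimensional and
bounds `A - x` below on its complement. The translate `A - y` is then invertible for `y ≠ x` within
that bound. -/
theorem isolated_of_notMem_essSpectrum {A : E →L[ℂ] E} (hA : IsSelfAdjoint A) {x : ℝ}
    (hx : (x : ℂ) ∉ essSpectrum A) :
    FiniteDimensional ℂ (Module.End.eigenspace (A : E →ₗ[ℂ] E) (x : ℂ)) ∧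
      ∃ c > 0, ∀ y : ℝ, y ≠ x → |y - x| < c → (y : ℂ) ∉ spectrum ℂ A := by
  rw [notMem_essSpectrum_iff] at hx
  obtain ⟨B, K, hK, hB⟩ := exists_left_inverse_mod_compact hx
  set T := A - algebraMap ℂ (E →L[ℂ] E) x with hTdef
  have hker : T.ker = Module.End.eigenspace (A : E →ₗ[ℂ] E) (x : ℂ) := by
    ext v
    rw [mem_eigenspace_iff', LinearMap.mem_ker]
    simp [T, Algebra.algebraMap_eq_smul_one, sub_eq_zero]
  have hf := finiteDimensional_ker_of_compact hK hB
  obtain ⟨c, hc, hb⟩ := exists_bound_orthogonal_ker_of_compact hK hB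
  refine ⟨hker ▸ hf, c, hc, fun y hy hyc => ?_⟩
  have := isUnit_sub_of_bound (isSelfAdjoint_sub_ofReal hA x) hb (sub_ne_zero.mpr hy) hyc
  rw [spectrum.notMem_iff, ← IsUnit.neg_iff, neg_sub]
  convert this using 1
  rw [Complex.ofReal_sub, map_sub]
  abel

end Essential

/-! ### Spectral projections across gaps of the spectrum -/

section Gap

/-- The function equal to `f` on `[a,b]` and to `g` outside. -/
noncomputable def pieceFun (a b : ℝ) (f g : ℝ → ℝ) (x : ℝ) : ℝ :=
  open Classical in if x ∈ Set.Icc a b then f x else g x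

theorem continuousOn_pieceFun (a b : ℝ) {f g : ℝ → ℝ} (hf : Continuous f) (hg : Continuous g) :
    ContinuousOn (pieceFun a b f g) {a, b}ᶜ := by
  intro x hx
  simp only [Set.mem_compl_iff, Set.mem_insert_iff, Set.mem_singleton_iff, not_or] at hx
  refine ContinuousAt.continuousWithinAt ?_
  by_cases h : x ∈ Set.Icc a b
  · have h' : Set.Ioo a b ∈ 𝓝 x :=
      Ioo_mem_nhds (lt_of_le_of_ne h.1 (Ne.symm hx.1)) (lt_of_le_of_ne h.2 hx.2)
    refine hf.continuousAt.congr ?_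
    filter_upwards [h'] with y hy
    rw [pieceFun, if_pos (Set.Ioo_subset_Icc_self hy)]
  · have h' : (Set.Icc a b)ᶜ ∈ 𝓝 x := isClosed_Icc.isOpen_compl.mem_nhds h
    refine hg.continuousAt.congr ?_
    filter_upwards [h'] with y hy
    rw [pieceFun, if_neg hy]

variable {E : Type*} [NormedAddCommGroup E] [InnerProductSpace ℂ E]

theorem ofReal_mem_spectrum_iff {A : E →L[ℂ] E} {x : ℝ} :
    (x : ℂ) ∈ spectrum ℂ A ↔ x ∈ spectrum ℝ A := by
  have h : algebraMap ℂ (E →L[ℂ] E) (x : ℂ) = algebraMap ℝ (E →L[ℂ] E) x := by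
    ext v
    simp [Algebra.algebraMap_eq_smul_one]
  rw [spectrum.mem_iff, spectrum.mem_iff, h]

variable [CompleteSpace E]

/-- Self-adjoint operators without `a` and `b` in the spectrum. -/
structure HasGaps (A : E →L[ℂ] E) (a b : ℝ) : Prop where
  sa : IsSelfAdjoint A
  left : (a : ℂ) ∉ spectrum ℂ A
  right : (b : ℂ) ∉ spectrum ℂ A

/-- The spectral projection of `A` for the interval `[a,b]`. -/
noncomputable def specProj (a b : ℝ) (A : E →L[ℂ] E) : E →L[ℂ] E :=
  cfc (pieceFun a b (fun _ => 1) (fun _ => 0)) A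

theorem specProj_comm (a b : ℝ) (A : E →L[ℂ] E) : specProj a b A * A = A * specProj a b A :=
  ((Commute.refl A).cfc_real _).eq

namespace HasGaps

variable {A : E →L[ℂ] E} {a b : ℝ}

theorem spectrum_subset (h : HasGaps A a b) : spectrum ℝ A ⊆ {a, b}ᶜ := by
  intro x hx
  simp only [Set.mem_compl_iff, Set.mem_insert_iff, Set.mem_singleton_iff, not_or]
  exact ⟨fun hxa => h.left (ofReal_mem_spectrum_iff.mpr (hxa ▸ hx)),
    fun hxb => h.right (ofReal_mem_spectrum_iff.mpr (hxb ▸ hx))⟩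

theorem cfc_pieceFun (h : HasGaps A a b) {f g : ℝ → ℝ} (hf : Continuous f) (hg : Continuous g) :
    cfc (pieceFun a b f g) A = specProj a b A * cfc f A + (1 - specProj a b A) * cfc g A := by
  have hsa := h.sa
  have hc : ContinuousOn (pieceFun a b (fun _ => 1) (fun _ => 0)) (spectrum ℝ A) :=
    (continuousOn_pieceFun a b continuous_const continuous_const).mono h.spectrum_subset
  have h1 : (1 : E →L[ℂ] E) = cfc (fun _ : ℝ => (1 : ℝ)) A := (cfc_const_one ℝ A).symm
  have hf' := hf.continuousOn (s := spectrum ℝ A)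
  have hg' := hg.continuousOn (s := spectrum ℝ A)
  have hc' : ContinuousOn (fun x => 1 - pieceFun a b (fun _ => 1) (fun _ => 0) x)
      (spectrum ℝ A) := continuousOn_const.sub hc
  rw [specProj, h1, ← cfc_sub _ _ A continuousOn_const hc, ← cfc_mul _ _ A hc hf',
    ← cfc_mul _ _ A hc' hg', ← cfc_add A (fun x => pieceFun a b (fun _ => 1) (fun _ => 0) x * f x)
      (fun x => (1 - pieceFun a b (fun _ => 1) (fun _ => 0) x) * g x) (hc.mul hf') (hc'.mul hg')]
  congr 1
  funext x
  simp only [pieceFun]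
  split_ifs <;> simp

theorem cfc_sub_const (h : HasGaps A a b) (x : ℝ) :
    cfc (fun y : ℝ => y - x) A = A - algebraMap ℂ (E →L[ℂ] E) x := by
  have hsa := h.sa
  have h1 : algebraMap ℂ (E →L[ℂ] E) (x : ℂ) = algebraMap ℝ (E →L[ℂ] E) x := by
    ext v
    simp [Algebra.algebraMap_eq_smul_one]
  rw [cfc_sub (fun y : ℝ => y) (fun _ => x) A continuousOn_id continuousOn_const, cfc_id' ℝ A,
    cfc_const x A, h1]

/-- This operator is `f(A)` for `f = 1` on `[a,b]` and `f(y) = y - x` outside, and `f` has no zero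
since `x ∈ [a,b]`. It detects eigenvectors inside the interval; `isUnit_one_on` is the counterpart
for `x` outside. -/
theorem isUnit_one_off (h : HasGaps A a b) {x : ℝ} (hx : x ∈ Set.Icc a b) :
    IsUnit (specProj a b A
      + (1 - specProj a b A) * (A - algebraMap ℂ (E →L[ℂ] E) x)) := by
  have hsa := h.sa
  have hf : Continuous fun y : ℝ => y - x := by fun_prop
  have h1 := h.cfc_pieceFun (f := fun _ => 1) continuous_const hf
  rw [cfc_const_one ℝ A, mul_one, h.cfc_sub_const] at h1
  rw [← h1, isUnit_cfc_iff _ A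
    ((continuousOn_pieceFun a b continuous_const hf).mono h.spectrum_subset)]
  intro y _
  rw [pieceFun]
  split_ifs with hy
  · exact one_ne_zero
  · exact sub_ne_zero.mpr fun hyx => hy (hyx ▸ hx)

theorem isUnit_one_on (h : HasGaps A a b) {x : ℝ} (hx : x ∉ Set.Icc a b) :
    IsUnit (specProj a b A * (A - algebraMap ℂ (E →L[ℂ] E) x)
      + (1 - specProj a b A)) := by
  have hsa := h.sa
  have hf : Continuous fun y : ℝ => y - x := by fun_prop
  have h1 := h.cfc_pieceFun hf (g := fun _ => 1) continuous_const
  rw [cfc_const_one ℝ A, mul_one, h.cfc_sub_const] at h1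
  rw [← h1, isUnit_cfc_iff _ A
    ((continuousOn_pieceFun a b hf continuous_const).mono h.spectrum_subset)]
  intro y _
  rw [pieceFun]
  split_ifs with hy
  · exact sub_ne_zero.mpr fun hyx => hx (hyx ▸ hy)
  · exact one_ne_zero

theorem specProj_mul_self (h : HasGaps A a b) :
    specProj a b A * specProj a b A = specProj a b A := by
  have hc : ContinuousOn (pieceFun a b (fun _ => 1) (fun _ => 0)) (spectrum ℝ A) :=
    (continuousOn_pieceFun a b continuous_const continuous_const).mono h.spectrum_subset
  rw [specProj, ← cfc_mul _ _ A hc hc]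
  congr 1
  funext x
  simp only [pieceFun]
  split_ifs <;> simp

/-- For an eigenvector `w`, the vector `E w - w`, with `E` the spectral projection, is killed both
by `E` and by `A - x`, hence by the invertible operator of `isUnit_one_off`. -/
theorem specProj_apply_of_mem (h : HasGaps A a b) {v : E}
    (hv : v ∈ specSpace A (Set.Icc a b)) : specProj a b A v = v := by
  have : specSpace A (Set.Icc a b) ≤ (specProj a b A - 1 : E →L[ℂ] E).ker := by
    refine iSup₂_le fun x hx w hw => ?_
    have hinj := (ContinuousLinearMap.isUnit_iff_bijective.mp (h.isUnit_one_off hx)).1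
    rw [mem_eigenspace_iff'] at hw
    have hE : specProj a b A (specProj a b A w) = specProj a b A w :=
      DFunLike.congr_fun h.specProj_mul_self w
    have hA : A (specProj a b A w) = (x : ℂ) • specProj a b A w := by
      rw [← map_smul, ← hw]
      exact (DFunLike.congr_fun (specProj_comm a b A) w).symm
    have h0 : specProj a b A w - w = 0 := by
      apply hinj
      simp [Algebra.algebraMap_eq_smul_one, hE, hA, hw, smul_sub]
    exact h0
  have := this hv
  rw [LinearMap.mem_ker] at this
  exact sub_eq_zero.mp this

/-- `A` restricts to a symmetric operator on the finite-dimensional range of the projection, where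
it is diagonalizable. An eigenvalue outside `[a,b]` would contradict `isUnit_one_on`. -/
theorem mem_specSpace_of_specProj_apply (h : HasGaps A a b)
    (hfin : FiniteDimensional ℂ (specProj a b A).range) {v : E}
    (hv : specProj a b A v = v) : v ∈ specSpace A (Set.Icc a b) := by
  set R := (specProj a b A).range
  have hR : ∀ w ∈ R, specProj a b A w = w := by
    rintro _ ⟨w, rfl⟩
    exact DFunLike.congr_fun h.specProj_mul_self w
  have hinv : ∀ w ∈ R, (A : E →ₗ[ℂ] E) w ∈ R := by
    intro w hw
    refine ⟨A w, ?_⟩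
    have := DFunLike.congr_fun (specProj_comm a b A) w
    simp only [mul_apply_eq_comp, hR w hw] at this
    exact this
  have hsym := h.sa.isSymmetric.restrict_invariant hinv
  have htop : (⨆ z, Module.End.eigenspace ((A : E →ₗ[ℂ] E).restrict hinv) z) = ⊤ := by
    rw [← Submodule.orthogonal_eq_bot_iff]
    exact hsym.orthogonalComplement_iSup_eigenspaces_eq_bot
  have hle : (⨆ z, Module.End.eigenspace ((A : E →ₗ[ℂ] E).restrict hinv) z)
      ≤ (specSpace A (Set.Icc a b)).comap R.subtype := by
    refine iSup_le fun z w hw => ?_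
    by_cases hw0 : w = 0
    · rw [hw0]; exact Submodule.zero_mem _
    have hz : (starRingEnd ℂ) z = z :=
      hsym.conj_eigenvalue_eq_self (Module.End.hasEigenvalue_of_hasEigenvector ⟨hw, hw0⟩)
    obtain ⟨x, rfl⟩ := Complex.conj_eq_iff_real.mp hz
    have hAw : A w = (x : ℂ) • (w : E) := congrArg Subtype.val (Module.End.mem_eigenspace_iff.mp hw)
    have hx : x ∈ Set.Icc a b := by
      by_contra hx
      have hinj := (ContinuousLinearMap.isUnit_iff_bijective.mp (h.isUnit_one_on hx)).1
      refine hw0 (Subtype.ext (hinj ?_))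
      simp [Algebra.algebraMap_eq_smul_one, hAw, hR w w.2]
    exact eigenspace_le_specSpace A hx ((mem_eigenspace_iff' A _ _).mpr hAw)
  rw [htop] at hle
  exact hle (Submodule.mem_top (x := (⟨v, v, hv⟩ : R)))

theorem range_specProj (h : HasGaps A a b)
    (hfin : FiniteDimensional ℂ (specProj a b A).range) :
    (specProj a b A).range = specSpace A (Set.Icc a b) := by
  apply le_antisymm
  · rintro _ ⟨v, rfl⟩
    apply h.mem_specSpace_of_specProj_apply hfin
    exact DFunLike.congr_fun h.specProj_mul_self v
  · intro v hv
    exact ⟨v, h.specProj_apply_of_mem hv⟩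

theorem notMem_essSpectrum (h : HasGaps A a b)
    (hfin : FiniteDimensional ℂ (specProj a b A).range) {x : ℝ} (hx : x ∈ Set.Icc a b) :
    (x : ℂ) ∉ essSpectrum A := by
  refine notMem_essSpectrum_of_sub_isUnit (h.isUnit_one_off hx)
    (K := specProj a b A * (A - algebraMap ℂ (E →L[ℂ] E) x - 1)) ?_ ?_
  · exact isCompactOperator_of_range_le (W := (specProj a b A).range) fun v => ⟨_, rfl⟩
  · noncomm_ring

/-- By compactness and isolation, the spectrum in `[a,b]` lies in a finite set `t` of points with
finite-dimensional eigenspaces. The product of the `A - x` over `x ∈ t` annihilates the range of the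
projection, and its kernel is finite-dimensional by induction on the number of factors. -/
theorem finiteDimensional_range (h : HasGaps A a b)
    (hess : ∀ x ∈ Set.Icc a b, (x : ℂ) ∉ essSpectrum A) :
    FiniteDimensional ℂ (specProj a b A).range := by
  have hsa := h.sa
  choose! hfin c hc hiso using fun x (hx : x ∈ Set.Icc a b) =>
    isolated_of_notMem_essSpectrum h.sa (hess x hx)
  obtain ⟨t, ht, hcov⟩ := (isCompact_Icc (a := a) (b := b)).elim_nhds_subcover
    (fun x => Metric.ball x (c x)) fun x hx => Metric.ball_mem_nhds x (hc x hx)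
  have hker : ∀ s : Finset ℝ, (∀ x ∈ s, x ∈ Set.Icc a b) →
      FiniteDimensional ℂ (cfc (fun y : ℝ => ∏ x ∈ s, (y - x)) A : E →L[ℂ] E).ker := by
    intro s
    induction s using Finset.induction_on with
    | empty =>
      intro _
      have : (cfc (fun y : ℝ => ∏ x ∈ (∅ : Finset ℝ), (y - x)) A : E →L[ℂ] E).ker = ⊥ := by
        simp only [Finset.prod_empty]
        rw [cfc_const_one ℝ A, LinearMap.ker_eq_bot]
        exact Function.injective_id
      rw [this]
      infer_instance
    | insert x s hxs ih =>
      intro hs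
      have := ih fun y hy => hs y (Finset.mem_insert_of_mem hy)
      have hx := hfin x (hs x (Finset.mem_insert_self _ _))
      have hins : (fun y : ℝ => ∏ x' ∈ insert x s, (y - x'))
          = fun y => (y - x) * ∏ x' ∈ s, (y - x') := funext fun y => Finset.prod_insert hxs
      rw [hins, cfc_mul (fun y : ℝ => y - x) _ A (by fun_prop) (by fun_prop), h.cfc_sub_const]
      refine ⟨Submodule.fg_top _ |>.mpr (Submodule.fg_of_fg_map_of_fg_inf_ker
        (cfc (fun y : ℝ => ∏ x ∈ s, (y - x)) A : E →L[ℂ] E).toLinearMap ?_ ?_)⟩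
      · have : FiniteDimensional ℂ (Submodule.map
            (cfc (fun y : ℝ => ∏ x ∈ s, (y - x)) A : E →L[ℂ] E).toLinearMap
            ((A - algebraMap ℂ (E →L[ℂ] E) x) *
              cfc (fun y : ℝ => ∏ x ∈ s, (y - x)) A : E →L[ℂ] E).ker) := by
          refine Submodule.finiteDimensional_of_le
            (S₂ := Module.End.eigenspace (A : E →ₗ[ℂ] E) (x : ℂ)) ?_
          rintro _ ⟨v, hv, rfl⟩
          rw [mem_eigenspace_iff', ← sub_eq_zero]
          rw [SetLike.mem_coe, LinearMap.mem_ker] at hv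
          simpa [Algebra.algebraMap_eq_smul_one] using hv
        exact Module.Finite.iff_fg.mp this
      · exact Module.Finite.iff_fg.mp (Submodule.finiteDimensional_of_le inf_le_right)
  have hprod : (cfc (fun y : ℝ => ∏ x ∈ t, (y - x)) A : E →L[ℂ] E) * specProj a b A = 0 := by
    have hc' : ContinuousOn (pieceFun a b (fun _ => 1) (fun _ => 0)) (spectrum ℝ A) :=
      (continuousOn_pieceFun a b continuous_const continuous_const).mono h.spectrum_subset
    rw [specProj, ← cfc_mul _ _ A (by fun_prop) hc', ← cfc_zero ℝ A]
    refine cfc_congr fun y hy => ?_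
    rw [pieceFun]
    split_ifs with hyI
    · obtain ⟨x, hxt, hyx⟩ := Set.mem_iUnion₂.mp (hcov hyI)
      have : y = x := by
        by_contra hne
        exact hiso x (ht x hxt) y hne hyx (ofReal_mem_spectrum_iff.mpr hy)
      rw [mul_one, Finset.prod_eq_zero hxt (sub_eq_zero.mpr this)]
      rfl
    · rw [mul_zero]; rfl
  have := hker t ht
  refine Submodule.finiteDimensional_of_le
    (S₂ := (cfc (fun y : ℝ => ∏ x ∈ t, (y - x)) A : E →L[ℂ] E).ker) ?_
  rintro _ ⟨v, rfl⟩
  exact DFunLike.congr_fun hprod v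

end HasGaps

/-- The indicator function is continuous on the open set `{a,b}ᶜ`, which contains the spectrum of
every operator considered, so the functional calculus depends continuously on the operator. -/
theorem continuousOn_specProj (a b : ℝ) :
    ContinuousOn (specProj (E := E) a b) {A | HasGaps A a b} := by
  have h := ContinuousOn.cfc_of_mem_nhdsSet (X := E →L[ℂ] E) (A := E →L[ℂ] E) (s := {a, b}ᶜ)
    (t := {A | HasGaps A a b}) (a := id) (pieceFun a b (fun _ => 1) (fun _ => 0)) ?_
    continuousOn_id (fun A hA => hA.sa)
    (continuousOn_pieceFun a b continuous_const continuous_const)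
  · exact h
  · refine (IsOpen.mem_nhdsSet ?_).mpr ?_
    · exact ((Set.finite_singleton b).insert a).isClosed.isOpen_compl
    · exact Set.iUnion₂_subset fun A hA => hA.spectrum_subset

end Gap

/-! ### Continuous frames of spectral subspaces -/

section LocalFrame

variable {E : Type*} [NormedAddCommGroup E] [InnerProductSpace ℂ E]

/-- `Q` is injective on the range of `P`: if `Q x = 0` with `P x = x`, then `‖x‖ = ‖(P - Q) x‖`,
which forces `x = 0`. -/
theorem finrank_range_le_of_norm_sub_lt {P Q : E →L[ℂ] E} (hP : P * P = P)
    (hfin : FiniteDimensional ℂ Q.range) (h : ‖P - Q‖ < 1) :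
    FiniteDimensional ℂ P.range ∧ Module.finrank ℂ P.range ≤ Module.finrank ℂ Q.range := by
  let T : P.range →ₗ[ℂ] Q.range :=
    (Q : E →ₗ[ℂ] E).restrict (p := P.range) (q := Q.range) fun x _ => ⟨x, rfl⟩
  have hT : Function.Injective T := by
    rw [injective_iff_map_eq_zero]
    rintro ⟨_, v, rfl⟩ h0
    have h1 : Q (P v) = 0 := congrArg Subtype.val h0
    have h2 : P (P v) = P v := DFunLike.congr_fun hP v
    have h3 := (P - Q).le_opNorm (P v)
    rw [sub_apply, h1, h2, sub_zero] at h3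
    have h4 : ‖P v‖ = 0 := by nlinarith [norm_nonneg (P v)]
    exact Subtype.ext (norm_eq_zero.mp h4)
  exact ⟨FiniteDimensional.of_injective T hT, LinearMap.finrank_le_finrank_of_injective hT⟩

theorem zero_notMem_essSpectrum {A : E →L[ℂ] E} (h : IsUnit (A : Calkin E)) :
    ((0 : ℝ) : ℂ) ∉ essSpectrum A := by
  rw [notMem_essSpectrum_iff]
  simpa using h

theorem notMem_essSpectrum_of_notMem_spectrum {A : E →L[ℂ] E} {z : ℂ} (h : z ∉ spectrum ℂ A) :
    z ∉ essSpectrum A := by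
  rw [notMem_essSpectrum_iff]
  rw [spectrum.notMem_iff, ← IsUnit.neg_iff, neg_sub] at h
  exact h.map (compactIdeal E).ringCon.mk'

variable [CompleteSpace E]

theorem eventually_notMem_spectrum {A₀ : E →L[ℂ] E} {z : ℂ} (h : z ∉ spectrum ℂ A₀) :
    ∀ᶠ A in 𝓝 A₀, z ∉ spectrum ℂ A := by
  simp only [spectrum.notMem_iff] at h ⊢
  have hc : Continuous fun A : E →L[ℂ] E => algebraMap ℂ (E →L[ℂ] E) z - A := by fun_prop
  exact (Units.isOpen.preimage hc).mem_nhds h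

/-- A basis of the range at `A₀` is moved by the projections of nearby operators. Independence is an
open condition, and the family still spans because ranks do not increase while the projections are
at distance less than `1`. -/
theorem exists_localFrame {A₀ : E →L[ℂ] E} {a b : ℝ} (h : HasGaps A₀ a b)
    (hess : ∀ x ∈ Set.Icc a b, (x : ℂ) ∉ essSpectrum A₀) :
    ∃ (k : ℕ) (e : (E →L[ℂ] E) → Fin k → E), ContinuousOn e {A | HasGaps A a b} ∧
      ∀ᶠ A in 𝓝 A₀, IsSelfAdjoint A → HasGaps A a b ∧
        (∀ x ∈ Set.Icc a b, (x : ℂ) ∉ essSpectrum A) ∧ LinearIndependent ℂ (e A) ∧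
        Submodule.span ℂ (Set.range (e A)) = specSpace A (Set.Icc a b) := by
  have hfin := h.finiteDimensional_range hess
  obtain ⟨b₀, hb₀, hb₀s⟩ := exists_basis_fin (specProj a b A₀).range
  have hcont : ContinuousOn (fun A => fun i => specProj a b A (b₀ i)) {A | HasGaps A a b} := by
    refine continuousOn_pi.mpr fun i => ?_
    exact (continuousOn_specProj a b).clm_apply continuousOn_const
  refine ⟨_, fun A i => specProj a b A (b₀ i), hcont, ?_⟩
  have h0 : (fun i => specProj a b A₀ (b₀ i)) = b₀ := by
    funext i
    have : b₀ i ∈ (specProj a b A₀).range := hb₀s ▸ Submodule.subset_span ⟨i, rfl⟩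
    obtain ⟨v, hv⟩ := this
    rw [← hv]
    exact DFunLike.congr_fun h.specProj_mul_self v
  have e1 : ∀ᶠ A in 𝓝[{A | HasGaps A a b}] A₀, LinearIndependent ℂ fun i => specProj a b A (b₀ i) :=
    (hcont A₀ h).eventually_mem
      (isOpen_linearIndependent.mem_nhds (show LinearIndependent ℂ fun i => specProj a b A₀ (b₀ i) from by rwa [h0]))
  have e2 : ∀ᶠ A in 𝓝[{A | HasGaps A a b}] A₀, ‖specProj a b A - specProj a b A₀‖ < 1 := by
    have := (continuousOn_specProj a b) A₀ h
    filter_upwards [this.eventually_mem (Metric.ball_mem_nhds _ one_pos)] with A hA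
    rwa [← dist_eq_norm]
  rw [eventually_nhdsWithin_iff] at e1 e2
  filter_upwards [e1, e2, eventually_notMem_spectrum h.left, eventually_notMem_spectrum h.right]
    with A h1 h2 h3 h4 hsa
  have hA : HasGaps A a b := ⟨hsa, h3, h4⟩
  obtain ⟨hf, hle⟩ := finrank_range_le_of_norm_sub_lt hA.specProj_mul_self hfin (h2 hA)
  refine ⟨hA, fun x hx => hA.notMem_essSpectrum hf hx, h1 hA, ?_⟩
  rw [← hA.range_specProj hf]
  apply Submodule.eq_of_le_of_finrank_le
  · rw [Submodule.span_le]
    rintro _ ⟨i, rfl⟩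
    exact ⟨b₀ i, rfl⟩
  · rwa [finrank_span_eq_card (h1 hA), Fintype.card_fin]

theorem HasGaps.finiteDimensional_specSpace {A : E →L[ℂ] E} {a b : ℝ} (h : HasGaps A a b)
    (hess : ∀ x ∈ Set.Icc a b, (x : ℂ) ∉ essSpectrum A) :
    FiniteDimensional ℂ (specSpace A (Set.Icc a b)) := by
  have hfin := h.finiteDimensional_range hess
  rw [← h.range_specProj hfin]
  exact hfin

end LocalFrame

/-! ### ### Parametrices of Fredholm operators and spectral gaps around zero -/

section Fredholm

variable {E : Type*} [NormedAddCommGroup E] [InnerProductSpace ℂ E] [CompleteSpace E]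

/-- `K†` vanishes on the orthogonal complement of the range of `K`, so its image is `K†(range K)`.
-/
theorem isCompactOperator_adjoint_of_finite_range {K : E →L[ℂ] E}
    (hK : FiniteDimensional ℂ K.range) :
    IsCompactOperator (ContinuousLinearMap.adjoint K) := by
  refine isCompactOperator_of_range_le
    (W := K.range.map (ContinuousLinearMap.adjoint K : E →ₗ[ℂ] E)) fun x => ?_
  obtain ⟨u, hu, w, hw, rfl⟩ := K.range.exists_add_mem_mem_orthogonal x
  rw [ContinuousLinearMap.orthogonal_range] at hw
  refine ⟨u, hu, ?_⟩
  rw [map_add, show ContinuousLinearMap.adjoint K w = 0 from hw, add_zero]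
  rfl

theorem exists_parametrix {P : E →L[ℂ] E} (hP : P.IsFredholm) :
    ∃ V : E →L[ℂ] E, IsCompactOperator (V * P - 1 : E →L[ℂ] E) ∧
      IsCompactOperator (P * V - 1 : E →L[ℂ] E) ∧
      IsCompactOperator (ContinuousLinearMap.adjoint P * ContinuousLinearMap.adjoint V - 1 :
        E →L[ℂ] E) ∧
      IsCompactOperator (ContinuousLinearMap.adjoint V * ContinuousLinearMap.adjoint P - 1 :
        E →L[ℂ] E) := by
  obtain ⟨V, hV⟩ := hP.exists_isQuasiInverse
  have f₁ : FiniteDimensional ℂ (V * P - 1 : E →L[ℂ] E).range := by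
    have := LinearMap.FiniteRangeSetoid.equiv_iff_hasNoetherianRange.mp hV.1.equiv
    have := this.isNoetherian_range
    exact IsNoetherian.iff_fg.mp this
  have f₂ : FiniteDimensional ℂ (P * V - 1 : E →L[ℂ] E).range := by
    have := LinearMap.FiniteRangeSetoid.equiv_iff_hasNoetherianRange.mp hV.2.equiv
    have := this.isNoetherian_range
    exact IsNoetherian.iff_fg.mp this
  refine ⟨V, isCompactOperator_of_range_le (W := (V * P - 1 : E →L[ℂ] E).range) fun x => ⟨x, rfl⟩,
    isCompactOperator_of_range_le (W := (P * V - 1 : E →L[ℂ] E).range) fun x => ⟨x, rfl⟩, ?_, ?_⟩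
  · convert! isCompactOperator_adjoint_of_finite_range f₁ using 2
    simp only [← ContinuousLinearMap.star_eq_adjoint, star_sub, star_mul, star_one]
  · convert! isCompactOperator_adjoint_of_finite_range f₂ using 2
    simp only [← ContinuousLinearMap.star_eq_adjoint, star_sub, star_mul, star_one]

theorem isUnit_calkin_of_isFredholm {P : E →L[ℂ] E} (hP : P.IsFredholm) :
    IsUnit (P : Calkin E) ∧ IsUnit (ContinuousLinearMap.adjoint P : Calkin E) := by
  obtain ⟨V, h₁, h₂, h₃, h₄⟩ := exists_parametrix hP
  exact ⟨isUnit_calkin_of_compact h₂ h₁, isUnit_calkin_of_compact h₃ h₄⟩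

/-- A self-adjoint operator with `0` not in the essential spectrum has small admissible
cutoffs. -/
theorem exists_small_gap {A : E →L[ℂ] E} (hA : IsSelfAdjoint A) (h : IsUnit (A : Calkin E)) :
    ∃ c > 0, ∀ μ, 0 < μ → μ < c → HasGaps A (-μ) μ ∧
      ∀ x ∈ Set.Icc (-μ) μ, (x : ℂ) ∉ essSpectrum A := by
  have h0 := zero_notMem_essSpectrum h
  obtain ⟨-, c, hc, hiso⟩ := isolated_of_notMem_essSpectrum hA h0
  refine ⟨c, hc, fun μ hμ hμc => ⟨⟨hA, ?_, ?_⟩, fun x hx => ?_⟩⟩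
  · exact hiso (-μ) (by linarith) (by rw [sub_zero, abs_neg, abs_of_pos hμ]; exact hμc)
  · exact hiso μ hμ.ne' (by rw [sub_zero, abs_of_pos hμ]; exact hμc)
  · by_cases hx0 : x = 0
    · rw [hx0]; exact h0
    · refine notMem_essSpectrum_of_notMem_spectrum (hiso x hx0 ?_)
      rw [sub_zero]
      exact (abs_le.mpr hx).trans_lt hμc

theorem exists_admissible (P : FredSA E) : ∃ μ, Admissible P.1 μ := by
  obtain ⟨c, hc, h⟩ := exists_small_gap P.2.1 (isUnit_calkin_of_isFredholm P.2.2).1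
  obtain ⟨h1, h2⟩ := h (c / 2) (by linarith) (by linarith)
  exact ⟨c / 2, by linarith, h1.right, h1.left, h2⟩

end Fredholm

/-! ### Continuity of the transition functions -/

section WedgeContinuity

variable {E X : Type*} [NormedAddCommGroup E] [TopologicalSpace X]

theorem continuousAt_append {m n : ℕ} {a : X → Fin m → E} {b : X → Fin n → E} {x₀ : X}
    (ha : ContinuousAt a x₀) (hb : ContinuousAt b x₀) :
    ContinuousAt (fun x => Fin.append (a x) (b x)) x₀ := by
  refine continuousAt_pi.mpr fun i => ?_
  induction i using Fin.addCases with
  | left i => simpa using continuousAt_pi.mp ha i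
  | right i => simpa using continuousAt_pi.mp hb i

variable [InnerProductSpace ℂ E]

theorem continuousAt_wedgeCoef {k : ℕ} {b x : X → Fin k → E} {x₀ : X} (hb : ContinuousAt b x₀)
    (hx : ContinuousAt x x₀) (hi : LinearIndependent ℂ (b x₀)) :
    ContinuousAt (fun y => wedgeCoef (b y) (x y)) x₀ := by
  have h1 : ContinuousAt (fun p : (Fin k → E) × (Fin k → E) => wedgeCoef p.1 p.2) (b x₀, x x₀) :=
    continuousOn_wedgeCoef.continuousAt
      ((isOpen_linearIndependent.preimage continuous_fst).mem_nhds hi)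
  exact ContinuousAt.comp (f := fun y => (b y, x y)) h1 (hb.prodMk hx)

end WedgeContinuity

section Transition

variable {E F : Type*}
  [NormedAddCommGroup E] [InnerProductSpace ℂ E] [CompleteSpace E]
  [NormedAddCommGroup F] [InnerProductSpace ℂ F] [CompleteSpace F]

theorem domSpace_Icc_union (P : E →L[ℂ] F) {μ μ' : ℝ} (h0 : 0 ≤ μ) (hμ : μ ≤ μ') :
    domSpace P (Set.Icc 0 μ') = domSpace P (Set.Icc 0 μ) ⊔ domSpace P (Set.Ioc μ μ') := by
  rw [domSpace, domSpace, domSpace, ← specSpace_union, Set.Icc_union_Ioc_eq_Icc h0 hμ]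

theorem disjoint_domSpace_Icc_Ioc (P : E →L[ℂ] F) (μ μ' : ℝ) :
    Disjoint (domSpace P (Set.Icc 0 μ)) (domSpace P (Set.Ioc μ μ')) :=
  disjoint_specSpace _ (Set.disjoint_left.mpr fun _ hx hx' => hx'.1.not_ge hx.2)

/-- A basis of `V_{(μ,μ']}(P†P)` extending a frame at `μ` to one at `μ'`. -/
theorem IsFrameStab.exists_complement {P : E →L[ℂ] F} {μ μ' : ℝ} (hμ : μ ≤ μ') {k l k' l' : ℕ}
    {e : Fin k → E} {f : Fin l → F} {d : DetLine P} (h : IsFrameStab P μ e f d)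
    {e' : Fin k' → E} {f' : Fin l' → F} {d' : DetLine P} (h' : IsFrameStab P μ' e' f' d') :
    ∃ (m : ℕ) (g : Fin m → E), k' = k + m ∧ l' = l + m ∧
      (∀ i, g i ∈ domSpace P (Set.Icc 0 μ')) ∧ LinearIndependent ℂ (Fin.append e g) := by
  have hJ : (0 : ℝ) ∉ Set.Ioc μ μ' := fun h0 => h0.1.not_ge h.pos
  have hfV' := finiteDimensional_of_span_eq h'.span_e
  have hV := domSpace_Icc_union P h.pos hμ
  have hle : domSpace P (Set.Ioc μ μ') ≤ domSpace P (Set.Icc 0 μ') := le_sup_right.trans hV.ge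
  have hfJ : FiniteDimensional ℂ (domSpace P (Set.Ioc μ μ')) :=
    Submodule.finiteDimensional_of_le hle
  obtain ⟨g, hg, hgs⟩ := exists_basis_fin (domSpace P (Set.Ioc μ μ'))
  have hi : LinearIndependent ℂ (Fin.append e g) := by
    refine linearIndependent_append h.indep_e hg ?_
    rw [h.span_e, hgs]
    exact disjoint_domSpace_Icc_Ioc P μ μ'
  have hi' : LinearIndependent ℂ (Fin.append f (P ∘ g)) := by
    refine linearIndependent_append h.indep_f (linearIndependent_map_domSpace P hJ hg hgs.le) ?_
    rw [h.span_f, span_map_domSpace P hJ hgs, codSpace_eq, codSpace_eq]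
    exact disjoint_domSpace_Icc_Ioc _ μ μ'
  refine ⟨_, g, ?_, ?_, fun i => hle (hgs ▸ Submodule.subset_span ⟨i, rfl⟩), hi⟩
  · have hs : Submodule.span ℂ (Set.range (Fin.append e g)) = domSpace P (Set.Icc 0 μ') := by
      rw [span_append, h.span_e, hgs, hV]
    have := finrank_span_eq_card hi
    rw [hs, ← h'.span_e, finrank_span_eq_card h'.indep_e, Fintype.card_fin,
      Fintype.card_fin] at this
    exact this
  · have hs : Submodule.span ℂ (Set.range (Fin.append f (P ∘ g))) = codSpace P (Set.Icc 0 μ') := by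
      rw [span_append, h.span_f, span_map_domSpace P hJ hgs, codSpace_eq, codSpace_eq, codSpace_eq,
        domSpace_Icc_union _ h.pos hμ]
    have := finrank_span_eq_card hi'
    rw [hs, ← h'.span_f, finrank_span_eq_card h'.indep_f, Fintype.card_fin,
      Fintype.card_fin] at this
    exact this

variable {X : Type*} [TopologicalSpace X]

/-- The transition formula needs only vectors of `V_{[0,μ']}` that complete `e` to an independent
family. Such vectors can be chosen at `x₀` and carried along continuously, whereas `V_{(μ,μ']}` need
not vary continuously: `μ` and `μ'` are not assumed to do so, and may coincide at some points. -/
theorem exists_transition_of_le {Q : X → E →L[ℂ] F} {μ μ' : X → ℝ} {k l k' l' : ℕ}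
    {e : X → Fin k → E} {f : X → Fin l → F} {e' : X → Fin k' → E} {f' : X → Fin l' → F}
    {d d' : ∀ x, DetLine (Q x)} {x₀ : X} (hQ : ContinuousAt Q x₀) (he : ContinuousAt e x₀)
    (hf : ContinuousAt f x₀) (he' : ContinuousAt e' x₀) (hf' : ContinuousAt f' x₀)
    (h : ∀ᶠ x in 𝓝 x₀, IsFrameStab (Q x) (μ x) (e x) (f x) (d x))
    (h' : ∀ᶠ x in 𝓝 x₀, IsFrameStab (Q x) (μ' x) (e' x) (f' x) (d' x))
    (hμ : ∀ᶠ x in 𝓝 x₀, μ x ≤ μ' x) :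
    ∃ r : X → ℂ, ContinuousAt r x₀ ∧ ∀ᶠ x in 𝓝 x₀, d' x = r x • d x := by
  have h0 := h.self_of_nhds
  have h0' := h'.self_of_nhds
  obtain ⟨m, g, rfl, rfl, hg, hi⟩ := h0.exists_complement hμ.self_of_nhds h0'
  -- The coordinates of `g` in the frame `e'` at `x₀` are kept constant; this extends `g` to the
  -- continuous family `G` inside the span of `e'`.
  have hZ : ∀ j, ∃ Z : Fin (k + m) → ℂ, ∑ i, Z i • e' x₀ i = g j := by
    intro j
    have := hg j
    rw [← h0'.span_e] at this
    exact (Submodule.mem_span_range_iff_exists_fun ℂ).mp this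
  choose Z hZ using hZ
  let G : X → Fin m → E := fun x j => ∑ i, Z j i • e' x i
  have hG0 : G x₀ = g := funext hZ
  have hG : ContinuousAt G x₀ := by
    refine continuousAt_pi.mpr fun j => ?_
    have := continuousAt_pi.mp he'
    fun_prop
  have hPG : ContinuousAt (fun x => Q x ∘ G x) x₀ :=
    continuousAt_pi.mpr fun j => hQ.clm_apply (continuousAt_pi.mp hG j)
  have hev : ∀ᶠ x in 𝓝 x₀, LinearIndependent ℂ (Fin.append (e x) (G x)) :=
    (continuousAt_append he hG).eventually_mem
      (isOpen_linearIndependent.mem_nhds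
        (show LinearIndependent ℂ (Fin.append (e x₀) (G x₀)) from hG0 ▸ hi))
  refine ⟨fun x => wedgeCoef (f' x) (Fin.append (f x) (Q x ∘ G x))
    / wedgeCoef (e' x) (Fin.append (e x) (G x)), ?_, ?_⟩
  · refine ContinuousAt.div
      (continuousAt_wedgeCoef hf' (continuousAt_append hf hPG) h0'.indep_f)
      (continuousAt_wedgeCoef he' (continuousAt_append he hG) h0'.indep_e) ?_
    refine wedgeCoef_ne_zero h0'.indep_e (hG0 ▸ hi) fun i => ?_
    rw [h0'.span_e, hG0]
    induction i using Fin.addCases with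
    | left i =>
      rw [Fin.append_left, domSpace_Icc_union _ h0.pos hμ.self_of_nhds, ← h0.span_e]
      exact Submodule.mem_sup_left (Submodule.subset_span ⟨i, rfl⟩)
    | right i => rw [Fin.append_right]; exact hg i
  · filter_upwards [h, h', hμ, hev] with x hx hx' hμx hix
    refine hx.transition hμx hx' (fun j => ?_) hix
    rw [← hx'.span_e]
    exact Submodule.sum_mem _ fun i _ => Submodule.smul_mem _ _ (Submodule.subset_span ⟨i, rfl⟩)

theorem exists_transition {Q : X → E →L[ℂ] F} {μ μ' : X → ℝ} {k l k' l' : ℕ}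
    {e : X → Fin k → E} {f : X → Fin l → F} {e' : X → Fin k' → E} {f' : X → Fin l' → F}
    {d d' : ∀ x, DetLine (Q x)} {x₀ : X} (hQ : ContinuousAt Q x₀) (he : ContinuousAt e x₀)
    (hf : ContinuousAt f x₀) (he' : ContinuousAt e' x₀) (hf' : ContinuousAt f' x₀)
    (h : ∀ᶠ x in 𝓝 x₀, IsFrameStab (Q x) (μ x) (e x) (f x) (d x))
    (h' : ∀ᶠ x in 𝓝 x₀, IsFrameStab (Q x) (μ' x) (e' x) (f' x) (d' x))
    (hμ : (∀ᶠ x in 𝓝 x₀, μ x ≤ μ' x) ∨ ∀ᶠ x in 𝓝 x₀, μ' x ≤ μ x) :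
    ∃ r : X → ℂ, ContinuousAt r x₀ ∧ ∀ᶠ x in 𝓝 x₀, d' x = r x • d x := by
  rcases hμ with hμ | hμ
  · exact exists_transition_of_le hQ he hf he' hf' h h' hμ
  · obtain ⟨r, hr, hrd⟩ := exists_transition_of_le hQ he' hf' he hf h' h hμ
    have hr0 : r x₀ ≠ 0 := by
      intro h0
      have := hrd.self_of_nhds
      rw [h0, zero_smul] at this
      exact h.self_of_nhds.spans.1 this
    refine ⟨fun x => (r x)⁻¹, hr.inv₀ hr0, ?_⟩
    filter_upwards [hrd, hr.eventually_ne hr0] with x hx hx0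
    rw [hx, inv_smul_smul₀ hx0]

end Transition

/-! ### Line bundles -/

section LineBundle

variable {X : Type*} [TopologicalSpace X] (L : X → Type*)
  [∀ x, AddCommGroup (L x)] [∀ x, Module ℂ (L x)] [TopologicalSpace (Bundle.TotalSpace ℂ L)]

/-- A nowhere zero section `s` over an open set `U` that trivializes `L` over `U`. -/
structure IsLocalTriv (U : Set X) (s : ∀ x, L x) : Prop where
  isOpen : IsOpen U
  ne_zero : ∀ x ∈ U, s x ≠ 0
  spans : ∀ x ∈ U, ∀ v : L x, ∃ c : ℂ, v = c • s x
  continuousOn_smul : ContinuousOn (fun p : X × ℂ => (⟨p.1, p.2 • s p.1⟩ : Bundle.TotalSpace ℂ L))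
    (U ×ˢ Set.univ)
  exists_coord : ∃ ρ : Bundle.TotalSpace ℂ L → ℂ, ContinuousOn ρ (Bundle.TotalSpace.proj ⁻¹' U) ∧
    ∀ x ∈ U, ∀ c : ℂ, ρ ⟨x, c • s x⟩ = c

/-- Locally trivial complex line bundles. -/
structure IsLineBundle : Prop where
  continuous_proj : Continuous (Bundle.TotalSpace.proj : Bundle.TotalSpace ℂ L → X)
  exists_localTriv : ∀ x : X, ∃ (U : Set X) (s : ∀ x, L x), x ∈ U ∧ IsLocalTriv L U s

end LineBundle

/-! ### The determinant line bundle is a line bundle -/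

section DetBundle

variable {E F : Type*}
  [NormedAddCommGroup E] [InnerProductSpace ℂ E] [CompleteSpace E]
  [NormedAddCommGroup F] [InnerProductSpace ℂ F] [CompleteSpace F]

namespace DetFrame

variable (c : DetFrame E F)

theorem isFrameStab (P : c.U) : IsFrameStab P.1.1 c.μ (c.e P) (c.f P) (c.sec P) :=
  ⟨c.μ_pos.le, c.indep_e P, c.span_e P, c.indep_f P, c.span_f P, c.isStab_sec P⟩

open Classical in
/-- Extension of the section of a frame by zero. -/
noncomputable def secExt (P : Fred E F) : DetBundle E F P :=
  if h : P ∈ c.U then c.sec ⟨P, h⟩ else 0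

open Classical in
/-- Extension of the frame of `V_{[0,μ]}(P†P)` by zero. -/
noncomputable def eExt (P : Fred E F) : Fin c.k → E := if h : P ∈ c.U then c.e ⟨P, h⟩ else 0

open Classical in
/-- Extension of the frame of `V_{[0,μ]}(PP†)` by zero. -/
noncomputable def fExt (P : Fred E F) : Fin c.l → F := if h : P ∈ c.U then c.f ⟨P, h⟩ else 0

theorem secExt_of_mem {P : Fred E F} (h : P ∈ c.U) : c.secExt P = c.sec ⟨P, h⟩ := dif_pos h

theorem isFrameStab_ext {P : Fred E F} (h : P ∈ c.U) :
    IsFrameStab P.1 c.μ (c.eExt P) (c.fExt P) (c.secExt P) := by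
  rw [eExt, fExt, secExt, dif_pos h, dif_pos h, dif_pos h]
  exact c.isFrameStab ⟨P, h⟩

theorem continuousAt_eExt {P : Fred E F} (h : P ∈ c.U) : ContinuousAt c.eExt P := by
  refine ContinuousOn.continuousAt ?_ (c.isOpen_U.mem_nhds h)
  rw [continuousOn_iff_continuous_domRestrict]
  convert c.continuous_e using 1
  funext Q
  exact dif_pos Q.2

theorem continuousAt_fExt {P : Fred E F} (h : P ∈ c.U) : ContinuousAt c.fExt P := by
  refine ContinuousOn.continuousAt ?_ (c.isOpen_U.mem_nhds h)
  rw [continuousOn_iff_continuous_domRestrict]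
  convert c.continuous_f using 1
  funext Q
  exact dif_pos Q.2

theorem exists_transition (c' : DetFrame E F) {P₀ : Fred E F} (h : P₀ ∈ c.U) (h' : P₀ ∈ c'.U) :
    ∃ r : Fred E F → ℂ, ContinuousAt r P₀ ∧ ∀ᶠ P in 𝓝 P₀, c'.secExt P = r P • c.secExt P := by
  refine SpectralCover.exists_transition (Q := fun P : Fred E F => P.1) (μ := fun _ => c.μ)
    (μ' := fun _ => c'.μ) continuous_subtype_val.continuousAt (c.continuousAt_eExt h)
    (c.continuousAt_fExt h) (c'.continuousAt_eExt h') (c'.continuousAt_fExt h') ?_ ?_ ?_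
  · filter_upwards [c.isOpen_U.mem_nhds h] with P hP using c.isFrameStab_ext hP
  · filter_upwards [c'.isOpen_U.mem_nhds h'] with P hP using c'.isFrameStab_ext hP
  · rcases le_total c.μ c'.μ with hle | hle
    · exact Or.inl (Eventually.of_forall fun _ => hle)
    · exact Or.inr (Eventually.of_forall fun _ => hle)

theorem continuous_smul_sec : Continuous fun p : c.U × ℂ =>
    (⟨p.1.1, p.2 • c.sec p.1⟩ : Bundle.TotalSpace ℂ (DetBundle E F)) :=
  continuous_iff_coinduced_le.mpr (le_iSup (fun c : DetFrame E F =>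
    TopologicalSpace.coinduced (fun p : c.U × ℂ =>
      (⟨p.1.1, p.2 • c.sec p.1⟩ : Bundle.TotalSpace ℂ (DetBundle E F))) inferInstance) c)

/-- The total space has a final topology, so maps out of it are tested on every frame. In another
frame `c'` the fibre coordinate becomes multiplication by the transition function from `c` to `c'`,
which is continuous. -/
theorem isLocalTriv : IsLocalTriv (DetBundle E F) c.U c.secExt where
  isOpen := c.isOpen_U
  ne_zero P hP := (c.isFrameStab_ext hP).spans.1
  spans P hP := (c.isFrameStab_ext hP).spans.2
  continuousOn_smul := by
    rw [continuousOn_iff_continuous_domRestrict]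
    have h1 : Continuous fun p : (c.U ×ˢ Set.univ : Set (Fred E F × ℂ)) =>
        ((⟨p.1.1, p.2.1⟩, p.1.2) : c.U × ℂ) := by fun_prop
    convert c.continuous_smul_sec.comp h1 using 1
    funext p
    simp only [Set.domRestrict_apply, Function.comp_apply]
    rw [c.secExt_of_mem p.2.1]
  exists_coord := by
    have hex : ∀ x : Bundle.TotalSpace ℂ (DetBundle E F), ∃ z : ℂ,
        x.proj ∈ c.U → x.snd = z • c.secExt x.proj := by
      intro x
      by_cases h : x.proj ∈ c.U
      · obtain ⟨z, hz⟩ := (c.isFrameStab_ext h).spans.2 x.snd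
        exact ⟨z, fun _ => hz⟩
      · exact ⟨0, fun h' => (h h').elim⟩
    choose ρ hρ using hex
    have hρs : ∀ P ∈ c.U, ∀ z : ℂ, ρ ⟨P, z • c.secExt P⟩ = z := by
      intro P hP z
      have := hρ ⟨P, z • c.secExt P⟩ hP
      exact (smul_left_injective ℂ (c.isFrameStab_ext hP).spans.1 this).symm
    refine ⟨ρ, ?_, hρs⟩
    have hpre : ∀ c' : DetFrame E F, ∀ O : Set ℂ, IsOpen O →
        IsOpen {p : c'.U × ℂ | p.1.1 ∈ c.U ∧
          ρ (⟨p.1.1, p.2 • c'.sec p.1⟩ : Bundle.TotalSpace ℂ (DetBundle E F)) ∈ O} := by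
      intro c' O hO
      rw [isOpen_iff_mem_nhds]
      rintro ⟨P₀, z₀⟩ ⟨hP₀, hm⟩
      obtain ⟨r, hr, hrs⟩ := c.exists_transition c' hP₀ P₀.2
      have hev : ∀ᶠ p : c'.U × ℂ in 𝓝 (P₀, z₀), p.1.1 ∈ c.U ∧
          c'.secExt p.1.1 = r p.1.1 • c.secExt p.1.1 := by
        have hc : ContinuousAt (fun p : c'.U × ℂ => p.1.1) (P₀, z₀) := by fun_prop
        exact hc.eventually ((c.isOpen_U.eventually_mem hP₀).and hrs)
      have hval : ∀ p : c'.U × ℂ, p.1.1 ∈ c.U → c'.secExt p.1.1 = r p.1.1 • c.secExt p.1.1 →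
          ρ (⟨p.1.1, p.2 • c'.sec p.1⟩ : Bundle.TotalSpace ℂ (DetBundle E F))
            = p.2 * r p.1.1 := by
        intro p hp hp'
        rw [c'.secExt_of_mem p.1.2] at hp'
        rw [hp', smul_smul]
        exact hρs _ hp _
      have hcont : ContinuousAt (fun p : c'.U × ℂ => p.2 * r p.1.1) (P₀, z₀) := by
        refine continuousAt_snd.mul ?_
        exact ContinuousAt.comp (f := fun p : c'.U × ℂ => p.1.1) hr (by fun_prop)
      have h0 := hev.self_of_nhds
      rw [hval (P₀, z₀) h0.1 h0.2] at hm
      filter_upwards [hev, hcont.eventually_mem (hO.mem_nhds hm)] with p hp hpO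
      exact ⟨hp.1, (hval p hp.1 hp.2).symm ▸ hpO⟩
    have hop : ∀ O : Set ℂ, IsOpen O →
        IsOpen (Bundle.TotalSpace.proj ⁻¹' c.U ∩ ρ ⁻¹' O : Set (Bundle.TotalSpace ℂ (DetBundle E F)))
        := by
      intro O hO
      rw [isOpen_iSup_iff]
      intro c'
      rw [isOpen_coinduced]
      exact hpre c' O hO
    intro x hx
    rw [ContinuousWithinAt, tendsto_nhds]
    intro O hO hxO
    exact mem_nhdsWithin_of_mem_nhds
      (mem_of_superset ((hop O hO).mem_nhds ⟨hx, hxO⟩) Set.inter_subset_right)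

end DetFrame

theorem continuous_proj_detBundle :
    Continuous (Bundle.TotalSpace.proj : Bundle.TotalSpace ℂ (DetBundle E F) → Fred E F) := by
  rw [continuous_iSup_dom]
  intro c
  rw [continuous_coinduced_dom]
  exact continuous_subtype_val.comp continuous_fst

end DetBundle

/-! ### ### Existence of local frames of the determinant line bundle -/

section Existence

variable {E : Type*} [NormedAddCommGroup E] [InnerProductSpace ℂ E] [CompleteSpace E]

/-- `P†P` has no negative eigenvalues. Passing to the symmetric interval moves the endpoint off `0`,
which may be an eigenvalue, to `-μ`, which is not, as spectral projections require. -/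
theorem domSpace_Icc_eq_specSpace (P : E →L[ℂ] E) {μ : ℝ} (hμ : 0 ≤ μ) :
    domSpace P (Set.Icc 0 μ)
      = specSpace ((ContinuousLinearMap.adjoint P).comp P) (Set.Icc (-μ) μ) := by
  refine le_antisymm (specSpace_mono _ (Set.Icc_subset_Icc_left (by linarith))) ?_
  refine iSup₂_le fun x hx v hv => ?_
  by_cases hx0 : 0 ≤ x
  · exact eigenspace_le_specSpace _ (I := Set.Icc 0 μ) (x := x) ⟨hx0, hx.2⟩ hv
  · rw [mem_eigenspace_iff'] at hv
    have h1 : inner ℂ v ((ContinuousLinearMap.adjoint P).comp P v) = inner ℂ (P v) (P v) := by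
      rw [ContinuousLinearMap.comp_apply, ContinuousLinearMap.adjoint_inner_right]
    rw [hv, inner_smul_right, inner_self_eq_norm_sq_to_K, inner_self_eq_norm_sq_to_K] at h1
    have h2 : x * ‖v‖ ^ 2 = ‖P v‖ ^ 2 := by
      apply Complex.ofReal_injective
      simpa using h1
    have h3 : ‖v‖ ^ 2 = 0 := by nlinarith [sq_nonneg ‖v‖, sq_nonneg ‖P v‖]
    have h4 : v = 0 := by simpa using h3
    rw [h4]
    exact Submodule.zero_mem _

theorem continuous_adjoint_comp : Continuous fun P : E →L[ℂ] E =>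
    (ContinuousLinearMap.adjoint P).comp P :=
  (LinearIsometryEquiv.continuous _).clm_comp continuous_id

theorem continuous_comp_adjoint : Continuous fun P : E →L[ℂ] E =>
    P.comp (ContinuousLinearMap.adjoint P) :=
  continuous_id.clm_comp (LinearIsometryEquiv.continuous _)

theorem isSelfAdjoint_adjoint_comp (P : E →L[ℂ] E) :
    IsSelfAdjoint ((ContinuousLinearMap.adjoint P).comp P) := IsSelfAdjoint.star_mul_self P

theorem isSelfAdjoint_comp_adjoint (P : E →L[ℂ] E) :
    IsSelfAdjoint (P.comp (ContinuousLinearMap.adjoint P)) := IsSelfAdjoint.mul_star_self P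

/-- Small nonzero numbers avoid the spectra of `P†P` and `PP†` at `P₀`, and `exists_localFrame`
applies to both. All small cutoffs are provided, so that one can later avoid a given value. -/
theorem exists_detFrame (P₀ : Fred E E) : ∃ c > 0, ∀ μ, 0 < μ → μ < c →
    ∃ D : DetFrame E E, P₀ ∈ D.U ∧ D.μ = μ := by
  obtain ⟨u₁, u₂⟩ := isUnit_calkin_of_isFredholm P₀.2
  obtain ⟨c₁, hc₁, h₁⟩ := exists_small_gap (isSelfAdjoint_adjoint_comp P₀.1) (u₂.mul u₁)
  obtain ⟨c₂, hc₂, h₂⟩ := exists_small_gap (isSelfAdjoint_comp_adjoint P₀.1) (u₁.mul u₂)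
  refine ⟨min c₁ c₂, lt_min hc₁ hc₂, fun μ hμ hμc => ?_⟩
  obtain ⟨g₁, s₁⟩ := h₁ μ hμ (hμc.trans_le (min_le_left _ _))
  obtain ⟨g₂, s₂⟩ := h₂ μ hμ (hμc.trans_le (min_le_right _ _))
  obtain ⟨k, e, he, hev₁⟩ := exists_localFrame g₁ s₁
  obtain ⟨l, f, hf, hev₂⟩ := exists_localFrame g₂ s₂
  have q₁ : Continuous fun P : Fred E E => (ContinuousLinearMap.adjoint P.1).comp P.1 :=
    continuous_adjoint_comp.comp continuous_subtype_val
  have q₂ : Continuous fun P : Fred E E => P.1.comp (ContinuousLinearMap.adjoint P.1) :=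
    continuous_comp_adjoint.comp continuous_subtype_val
  obtain ⟨U, hU, hUo, hPU⟩ := eventually_nhds_iff.mp
    ((q₁.continuousAt.eventually hev₁).and (q₂.continuousAt.eventually hev₂))
  have a₁ := fun P hP => (hU P hP).1 (isSelfAdjoint_adjoint_comp P.1)
  have a₂ := fun P hP => (hU P hP).2 (isSelfAdjoint_comp_adjoint P.1)
  have hes : ∀ P ∈ U, Submodule.span ℂ (Set.range (e ((ContinuousLinearMap.adjoint P.1).comp P.1)))
      = domSpace P.1 (Set.Icc 0 μ) := fun P hP => by
    rw [(a₁ P hP).2.2.2, domSpace_Icc_eq_specSpace P.1 hμ.le]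
  have hfs : ∀ P ∈ U, Submodule.span ℂ (Set.range (f (P.1.comp (ContinuousLinearMap.adjoint P.1))))
      = codSpace P.1 (Set.Icc 0 μ) := fun P hP => by
    rw [(a₂ P hP).2.2.2, codSpace_eq, domSpace_Icc_eq_specSpace _ hμ.le,
      ContinuousLinearMap.adjoint_adjoint]
  choose! sec hsec using fun P hP => exists_isFrameStab hμ.le (a₁ P hP).2.2.1 (hes P hP)
    (a₂ P hP).2.2.1 (hfs P hP)
  refine ⟨{
    U := U
    isOpen_U := hUo
    μ := μ
    μ_pos := hμ
    small := fun P hP x hx => (a₁ P hP).2.1 x ⟨by linarith [hx.1], hx.2⟩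
    gap := fun P hP => (a₁ P hP).1.right
    k := k
    e := fun P => e ((ContinuousLinearMap.adjoint P.1.1).comp P.1.1)
    continuous_e := he.comp_continuous (q₁.comp continuous_subtype_val) fun P => (a₁ P.1 P.2).1
    indep_e := fun P => (a₁ P.1 P.2).2.2.1
    span_e := fun P => hes P.1 P.2
    l := l
    f := fun P => f (P.1.1.comp (ContinuousLinearMap.adjoint P.1.1))
    continuous_f := hf.comp_continuous (q₂.comp continuous_subtype_val) fun P => (a₂ P.1 P.2).1
    indep_f := fun P => (a₂ P.1 P.2).2.2.1
    span_f := fun P => hfs P.1 P.2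
    sec := fun P => sec P.1
    isStab_sec := fun P => (hsec P.1 P.2).isStab }, hPU, rfl⟩

theorem isLineBundle_detBundle : IsLineBundle (DetBundle E E) where
  continuous_proj := continuous_proj_detBundle
  exists_localTriv P := by
    obtain ⟨c, hc, h⟩ := exists_detFrame P
    obtain ⟨D, hD, -⟩ := h (c / 2) (by linarith) (by linarith)
    exact ⟨D.U, D.secExt, hD, D.isLocalTriv⟩

end Existence

/-! ### Sections of line bundles along maps -/

section Sections

variable {X : Type*} [TopologicalSpace X] {L : X → Type*}
  [∀ x, AddCommGroup (L x)] [∀ x, Module ℂ (L x)] [TopologicalSpace (Bundle.TotalSpace ℂ L)]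

theorem IsLocalTriv.exists_coeff {Y : Type*} {U : Set X} {s : ∀ x, L x} (h : IsLocalTriv L U s)
    (g : Y → X) (σ : ∀ y, L (g y)) : ∃ a : Y → ℂ, ∀ y, g y ∈ U → σ y = a y • s (g y) := by
  choose! a ha using fun y (hy : g y ∈ U) => h.spans _ hy (σ y)
  exact ⟨a, ha⟩

variable {Y : Type*} [TopologicalSpace Y] {g : Y → X} {y₀ : Y}

theorem IsLocalTriv.continuousAt_iff {U : Set X} {s : ∀ x, L x} (h : IsLocalTriv L U s)
    (hg : ContinuousAt g y₀) (hy : g y₀ ∈ U) {σ : ∀ y, L (g y)} {a : Y → ℂ}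
    (ha : ∀ᶠ y in 𝓝 y₀, σ y = a y • s (g y)) :
    ContinuousAt (fun y => (⟨g y, σ y⟩ : Bundle.TotalSpace ℂ L)) y₀ ↔ ContinuousAt a y₀ := by
  have hU : ∀ᶠ y in 𝓝 y₀, g y ∈ U := hg.eventually_mem (h.isOpen.mem_nhds hy)
  constructor
  · intro hσ
    obtain ⟨ρ, hρ, hρs⟩ := h.exists_coord
    have h1 : ContinuousAt (fun y => (⟨g y, a y • s (g y)⟩ : Bundle.TotalSpace ℂ L)) y₀ :=
      hσ.congr (ha.mono fun y hy => by simp only [hy])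
    have h2 : ∀ᶠ y in 𝓝 y₀, (⟨g y, a y • s (g y)⟩ : Bundle.TotalSpace ℂ L)
        ∈ Bundle.TotalSpace.proj ⁻¹' U := hU
    have h3 : Tendsto (fun y => (⟨g y, a y • s (g y)⟩ : Bundle.TotalSpace ℂ L)) (𝓝 y₀)
        (𝓝[Bundle.TotalSpace.proj ⁻¹' U] ⟨g y₀, a y₀ • s (g y₀)⟩) :=
      tendsto_nhdsWithin_iff.mpr ⟨h1, h2⟩
    have h4 := (hρ ⟨g y₀, a y₀ • s (g y₀)⟩ hy).tendsto.comp h3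
    rw [hρs _ hy] at h4
    exact h4.congr' (hU.mono fun y hy => hρs _ hy _)
  · intro hc
    have h1 : ContinuousAt (fun p : X × ℂ => (⟨p.1, p.2 • s p.1⟩ : Bundle.TotalSpace ℂ L))
        (g y₀, a y₀) :=
      h.continuousOn_smul.continuousAt ((h.isOpen.prod isOpen_univ).mem_nhds ⟨hy, trivial⟩)
    exact (ContinuousAt.comp (f := fun y => (g y, a y)) h1 (hg.prodMk hc)).congr
      (ha.mono fun y hy => by simp only [Function.comp_apply, hy])

namespace IsLineBundle

theorem continuousAt_of_section (hL : IsLineBundle L) {σ : ∀ y, L (g y)}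
    (hσ : ContinuousAt (fun y => (⟨g y, σ y⟩ : Bundle.TotalSpace ℂ L)) y₀) : ContinuousAt g y₀ :=
  ContinuousAt.comp (f := fun y => (⟨g y, σ y⟩ : Bundle.TotalSpace ℂ L))
    hL.continuous_proj.continuousAt hσ

theorem exists_smul_eq (hL : IsLineBundle L) {x : X} {v w : L x} (hv : v ≠ 0) : ∃ c : ℂ, w = c • v := by
  obtain ⟨U, s, hx, h⟩ := hL.exists_localTriv x
  obtain ⟨c, hc⟩ := h.spans x hx v
  obtain ⟨c', hc'⟩ := h.spans x hx w
  have h0 : c ≠ 0 := fun h0 => hv (by rw [hc, h0, zero_smul])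
  exact ⟨c' * c⁻¹, by rw [hc', hc, smul_smul, inv_mul_cancel_right₀ h0]⟩

theorem continuousAt_smul (hL : IsLineBundle L) {σ : ∀ y, L (g y)} {r : Y → ℂ} (hr : ContinuousAt r y₀)
    (hσ : ContinuousAt (fun y => (⟨g y, σ y⟩ : Bundle.TotalSpace ℂ L)) y₀) :
    ContinuousAt (fun y => (⟨g y, r y • σ y⟩ : Bundle.TotalSpace ℂ L)) y₀ := by
  have hg := hL.continuousAt_of_section hσ
  obtain ⟨U, s, hx, h⟩ := hL.exists_localTriv (g y₀)
  obtain ⟨a, ha⟩ := h.exists_coeff g σ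
  have hU : ∀ᶠ y in 𝓝 y₀, g y ∈ U := hg.eventually_mem (h.isOpen.mem_nhds hx)
  have h1 := (h.continuousAt_iff hg hx (hU.mono ha)).mp hσ
  refine (h.continuousAt_iff (a := fun y => r y * a y) hg hx
    (hU.mono fun y hy => ?_)).mpr (hr.mul h1)
  rw [ha y hy, smul_smul]

theorem continuousAt_of_smul (hL : IsLineBundle L) {σ σ' : ∀ y, L (g y)} {r : Y → ℂ}
    (hσ : ContinuousAt (fun y => (⟨g y, σ y⟩ : Bundle.TotalSpace ℂ L)) y₀)
    (hσ' : ContinuousAt (fun y => (⟨g y, σ' y⟩ : Bundle.TotalSpace ℂ L)) y₀)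
    (hr : ∀ᶠ y in 𝓝 y₀, σ' y = r y • σ y) (h0 : σ y₀ ≠ 0) : ContinuousAt r y₀ := by
  have hg := hL.continuousAt_of_section hσ
  obtain ⟨U, s, hx, h⟩ := hL.exists_localTriv (g y₀)
  obtain ⟨a, ha⟩ := h.exists_coeff g σ
  have hU : ∀ᶠ y in 𝓝 y₀, g y ∈ U := hg.eventually_mem (h.isOpen.mem_nhds hx)
  have h1 := (h.continuousAt_iff hg hx (hU.mono ha)).mp hσ
  have h2 : ContinuousAt (fun y => r y * a y) y₀ := by
    refine (h.continuousAt_iff hg hx ?_).mp hσ'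
    filter_upwards [hr, hU] with y hy hyU
    rw [hy, ha y hyU, smul_smul]
  have ha0 : a y₀ ≠ 0 := fun h' => h0 (by rw [ha _ hx, h', zero_smul])
  refine (h2.div h1 ha0).congr ?_
  filter_upwards [h1.eventually_ne ha0] with y hy using mul_div_cancel_right₀ _ hy

theorem continuousAt_sum (hL : IsLineBundle L) {ι : Type*} (S : Finset ι) {σ : ι → ∀ y, L (g y)}
    (hg : ContinuousAt g y₀)
    (hσ : ∀ i ∈ S, ContinuousAt (fun y => (⟨g y, σ i y⟩ : Bundle.TotalSpace ℂ L)) y₀) :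
    ContinuousAt (fun y => (⟨g y, ∑ i ∈ S, σ i y⟩ : Bundle.TotalSpace ℂ L)) y₀ := by
  obtain ⟨U, s, hx, h⟩ := hL.exists_localTriv (g y₀)
  choose a ha using fun i => h.exists_coeff g (σ i)
  have hU : ∀ᶠ y in 𝓝 y₀, g y ∈ U := hg.eventually_mem (h.isOpen.mem_nhds hx)
  refine (h.continuousAt_iff (a := fun y => ∑ i ∈ S, a i y) hg hx
    (hU.mono fun y hy => ?_)).mpr (tendsto_finsetSum _ fun i hi =>
      (h.continuousAt_iff hg hx (hU.mono (ha i))).mp (hσ i hi))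
  rw [Finset.sum_smul]
  exact Finset.sum_congr rfl fun i _ => ha i y hy

theorem eventually_ne_zero (hL : IsLineBundle L) {σ : ∀ y, L (g y)}
    (hσ : ContinuousAt (fun y => (⟨g y, σ y⟩ : Bundle.TotalSpace ℂ L)) y₀) (h0 : σ y₀ ≠ 0) :
    ∀ᶠ y in 𝓝 y₀, σ y ≠ 0 := by
  have hg := hL.continuousAt_of_section hσ
  obtain ⟨U, s, hx, h⟩ := hL.exists_localTriv (g y₀)
  obtain ⟨a, ha⟩ := h.exists_coeff g σ
  have hU : ∀ᶠ y in 𝓝 y₀, g y ∈ U := hg.eventually_mem (h.isOpen.mem_nhds hx)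
  have h1 := (h.continuousAt_iff hg hx (hU.mono ha)).mp hσ
  have ha0 : a y₀ ≠ 0 := fun h' => h0 (by rw [ha _ hx, h', zero_smul])
  filter_upwards [hU, h1.eventually_ne ha0] with y hy hy0
  rw [ha y hy, Ne, smul_eq_zero, not_or]
  exact ⟨hy0, h.ne_zero _ hy⟩

/-- The ratio of two continuous sections, the first of which is nowhere zero. -/
theorem exists_ratio (hL : IsLineBundle L) {σ σ' : ∀ y, L (g y)}
    (hσ : Continuous fun y => (⟨g y, σ y⟩ : Bundle.TotalSpace ℂ L))
    (hσ' : Continuous fun y => (⟨g y, σ' y⟩ : Bundle.TotalSpace ℂ L)) (h0 : ∀ y, σ y ≠ 0) :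
    ∃ r : Y → ℂ, Continuous r ∧ ∀ y, σ' y = r y • σ y := by
  choose r hr using fun y => hL.exists_smul_eq (w := σ' y) (h0 y)
  exact ⟨r, continuous_iff_continuousAt.mpr fun y => hL.continuousAt_of_smul hσ.continuousAt
    hσ'.continuousAt (Eventually.of_forall hr) (h0 y), hr⟩

end IsLineBundle

end Sections

/-! ### Continuous logarithms -/

section Logarithm

variable {K : Type*} [TopologicalSpace K]

/-- `f` has a continuous logarithm. -/
def HasLog (f : K → ℂ) : Prop := ∃ h : K → ℂ, Continuous h ∧ ∀ x, f x = Complex.exp (h x)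

theorem HasLog.mul {f f' : K → ℂ} (hf : HasLog f) (hf' : HasLog f') :
    HasLog fun x => f x * f' x := by
  obtain ⟨h, hc, he⟩ := hf
  obtain ⟨h', hc', he'⟩ := hf'
  exact ⟨fun x => h x + h' x, hc.add hc', fun x => by simp only [he, he', Complex.exp_add]⟩

theorem HasLog.inv {f : K → ℂ} (hf : HasLog f) : HasLog fun x => (f x)⁻¹ := by
  obtain ⟨h, hc, he⟩ := hf
  exact ⟨fun x => -h x, hc.neg, fun x => by simp only [he, Complex.exp_neg]⟩

theorem HasLog.prod {ι : Type*} (S : Finset ι) {f : ι → K → ℂ} (hf : ∀ i ∈ S, HasLog (f i)) :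
    HasLog fun x => ∏ i ∈ S, f i x := by
  classical
  induction S using Finset.induction_on with
  | empty => exact ⟨fun _ => 0, continuous_const, fun x => by simp⟩
  | insert i S hi ih =>
    have := (hf i (Finset.mem_insert_self _ _)).mul
      (ih fun j hj => hf j (Finset.mem_insert_of_mem hj))
    simpa only [Finset.prod_insert hi] using this

theorem hasLog_of_mem_slitPlane {f : K → ℂ} (hf : Continuous f) (h : ∀ x, f x ∈ Complex.slitPlane) :
    HasLog f :=
  ⟨fun x => Complex.log (f x), hf.clog h, fun x =>
    (Complex.exp_log (Complex.slitPlane_ne_zero (h x))).symm⟩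

/-- By compactness of `K`, for `z` near `z₀` the quotient `R z / R z₀` stays in the slit plane,
where the principal logarithm is continuous. -/
theorem isLocallyConstant_hasLog [CompactSpace K] {Z : Type*} [TopologicalSpace Z]
    {R : Z → K → ℂ} (hR : Continuous fun p : Z × K => R p.1 p.2) (h0 : ∀ z x, R z x ≠ 0) :
    IsLocallyConstant fun z => HasLog (R z) := by
  rw [IsLocallyConstant.iff_eventually_eq]
  intro z₀
  have hq : Continuous fun p : Z × K => R p.1 p.2 / R z₀ p.2 :=
    hR.div (hR.comp (continuous_const.prodMk continuous_snd)) fun p => h0 _ _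
  have h1 : ∀ x ∈ (Set.univ : Set K), ∀ᶠ p : Z × K in 𝓝 (z₀, x),
      R p.1 p.2 / R z₀ p.2 ∈ Complex.slitPlane := by
    intro x _
    refine hq.continuousAt.eventually_mem (Complex.isOpen_slitPlane.mem_nhds ?_)
    simp [div_self (h0 z₀ x)]
  have h2 := isCompact_univ.eventually_forall_of_forall_eventually
    (P := fun z x => R z x / R z₀ x ∈ Complex.slitPlane) h1
  filter_upwards [h2] with z hz
  have hl : HasLog fun x => R z x / R z₀ x :=
    hasLog_of_mem_slitPlane (hq.comp (Continuous.prodMk_right z)) fun x => hz x trivial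
  refine propext ⟨fun h => ?_, fun h => ?_⟩
  · convert! h.mul hl.inv using 2 with x
    rw [inv_div, mul_div_cancel₀ _ (h0 z x)]
  · convert! h.mul hl using 2 with x
    rw [mul_div_cancel₀ _ (h0 z₀ x)]

theorem hasLog_of_preconnected [CompactSpace K] {Z : Type*} [TopologicalSpace Z]
    [PreconnectedSpace Z] {R : Z → K → ℂ} (hR : Continuous fun p : Z × K => R p.1 p.2)
    (h0 : ∀ z x, R z x ≠ 0) {z₁ z₂ : Z} (h : HasLog (R z₁)) : HasLog (R z₂) :=
  ((isLocallyConstant_hasLog hR h0).apply_eq_of_preconnectedSpace z₁ z₂).mp h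

end Logarithm

/-! ### Winding numbers -/

section Winding

instance : Fact (0 < 2 * Real.pi) := ⟨Real.two_pi_pos⟩

instance : CompactSpace Real.Angle := inferInstanceAs (CompactSpace (AddCircle (2 * Real.pi)))

theorem coe_toCircle_zpow (j : ℤ) (t : ℝ) :
    (((t : Real.Angle).toCircle ^ j : Circle) : ℂ) = Complex.exp (j * (t * Complex.I)) := by
  rw [Real.Angle.toCircle_coe, Circle.coe_zpow, Circle.coe_exp, Complex.exp_int_mul]

theorem exists_winding {r : Real.Angle → ℂ} (hr : Continuous r) (h0 : ∀ θ, r θ ≠ 0) :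
    ∃ (j : ℤ) (h : Real.Angle → ℂ), Continuous h ∧
      ∀ θ, r θ = ((θ.toCircle ^ j : Circle) : ℂ) * Complex.exp (h θ) := by
  -- Shrinking the interval to the point `0` deforms the pullback of `r` to a constant, which has a
  -- logarithm.
  have hlog : HasLog fun t : Set.Icc 0 (2 * Real.pi) => r ((1 * t.1 : ℝ) : Real.Angle) := by
    refine hasLog_of_preconnected (Z := ℝ)
      (R := fun z (t : Set.Icc 0 (2 * Real.pi)) => r ((z * t.1 : ℝ) : Real.Angle)) ?_
      (fun _ _ => h0 _) (z₁ := 0) ?_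
    · exact hr.comp (Real.Angle.continuous_coe.comp (by fun_prop))
    · exact ⟨fun _ => Complex.log (r 0), continuous_const, fun _ => by
        simp [Complex.exp_log (h0 0)]⟩
  obtain ⟨h, hc, he⟩ := hlog
  simp only [one_mul] at he
  have h2π := Real.two_pi_pos.le
  have hend : Complex.exp (h ⟨2 * Real.pi, h2π, le_rfl⟩) = Complex.exp (h ⟨0, le_rfl, h2π⟩) := by
    rw [← he, ← he]
    simp
  obtain ⟨j, hj⟩ := Complex.exp_eq_exp_iff_exists_int.mp hend
  -- The logarithm increases by `2πij` around the circle; subtracting `ijt` makes it periodic.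
  let G : ℝ → ℂ := fun t => Set.IccExtend h2π h t - j * (t * Complex.I)
  have hG : Continuous G := hc.Icc_extend'.sub (by fun_prop)
  have hG0 : G 0 = G (0 + 2 * Real.pi) := by
    simp only [G, zero_add]
    rw [Set.IccExtend_left, Set.IccExtend_right, hj]
    push_cast
    ring
  refine ⟨j, AddCircle.liftIco (2 * Real.pi) 0 G, AddCircle.liftIco_continuous hG0 hG.continuousOn,
    fun θ => ?_⟩
  obtain ⟨t, ht, rfl⟩ : ∃ t ∈ Set.Ico 0 (0 + 2 * Real.pi), (t : Real.Angle) = θ := by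
    have := (AddCircle.coe_image_Ico_eq (2 * Real.pi) 0).ge (Set.mem_univ θ)
    exact this
  have h1 : AddCircle.liftIco (2 * Real.pi) 0 G (t : Real.Angle) = G t :=
    AddCircle.liftIco_coe_apply ht
  rw [h1, coe_toCircle_zpow, ← Complex.exp_add]
  have ht' : t ∈ Set.Icc 0 (2 * Real.pi) := ⟨ht.1, by linarith [ht.2]⟩
  simp only [G]
  rw [Set.IccExtend_of_mem h2π h ht', he ⟨t, ht'⟩]
  congr 1
  ring

/-- A logarithm `g` differs from `ijt` by an integer multiple of `2πi` that is continuous in `t`,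
hence constant. Since `g` is periodic, comparing `t = 0` with `t = 2π` gives `j = 0`. -/
theorem eq_zero_of_hasLog_toCircle {j : ℤ}
    (h : HasLog fun θ : Real.Angle => ((θ.toCircle ^ j : Circle) : ℂ)) : j = 0 := by
  obtain ⟨g, hg, he⟩ := h
  have h1 : ∀ t : ℝ, ∃ k : ℤ, g t = j * (t * Complex.I) + k * (2 * Real.pi * Complex.I) := by
    intro t
    apply Complex.exp_eq_exp_iff_exists_int.mp
    exact (he t).symm.trans (coe_toCircle_zpow j t)
  choose k hk using h1
  have hkc : Continuous k := by
    rw [Int.isClosedEmbedding_coe_real.isInducing.continuous_iff]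
    have h2 : (fun t : ℝ => ((g t - j * (t * Complex.I)) / (2 * Real.pi * Complex.I)).re)
        = ((↑) : ℤ → ℝ) ∘ k := by
      funext t
      rw [hk, add_sub_cancel_left, mul_div_cancel_right₀ _ Complex.two_pi_I_ne_zero]
      simp
    rw [← h2]
    have := hg.comp Real.Angle.continuous_coe
    simp only [Function.comp_def] at this
    fun_prop
  have h3 := PreconnectedSpace.constant (inferInstance : PreconnectedSpace ℝ) hkc
    (x := 0) (y := 2 * Real.pi)
  have h4 := hk 0
  have h5 := hk (2 * Real.pi)
  rw [← h3, Real.Angle.coe_two_pi] at h5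
  rw [Real.Angle.coe_zero, h5] at h4
  have h6 : (j : ℂ) * (2 * Real.pi * Complex.I) = 0 := by
    push_cast at h4
    linear_combination h4
  simpa [Complex.two_pi_I_ne_zero] using h6

end Winding

/-! ### Homotopy classes of trivializations along loops -/

section Transgression

variable {X : Type*} [TopologicalSpace X] {L : X → Type*}
  [∀ x, AddCommGroup (L x)] [∀ x, Module ℂ (L x)] [TopologicalSpace (Bundle.TotalSpace ℂ L)]

/-- The ratio of two trivializations is an exponential. -/
def LoopTriv.LogRel {γ : C(Real.Angle, X)} (τ τ' : LoopTriv L γ) : Prop :=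
  ∃ h : Real.Angle → ℂ, Continuous h ∧ ∀ θ, τ'.val θ = Complex.exp (h θ) • τ.val θ

theorem LoopTriv.logRel_iff_hasLog {γ : C(Real.Angle, X)} {τ τ' : LoopTriv L γ}
    {r : Real.Angle → ℂ} (hr : ∀ θ, τ'.val θ = r θ • τ.val θ) : τ.LogRel τ' ↔ HasLog r := by
  refine exists_congr fun h => and_congr_right fun _ => forall_congr' fun θ => ?_
  rw [hr θ]
  exact ⟨fun h => smul_left_injective ℂ (τ.ne_zero θ) h, fun h => by rw [h]⟩

/-- Along a homotopy the ratio to the initial trivialization is a path of nowhere zero functions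
starting at `1`, and having a logarithm is locally constant along it. Conversely, scaling the
logarithm by `s ∈ [0,1]` gives a homotopy. As the quotient is by the generated equivalence relation,
`LogRel` is seen to be an equivalence relation along the way. -/
theorem IsLineBundle.mk_eq_mk_iff (hL : IsLineBundle L) {γ : C(Real.Angle, X)}
    {τ τ' : LoopTriv L γ} : Transg.mk τ = Transg.mk τ' ↔ τ.LogRel τ' := by
  constructor
  · intro h
    have h1 := Quot.eqvGen_exact h
    clear h
    induction h1 with
    | rel τ τ' h =>
      obtain ⟨σ, hσ, h0, h1, h2⟩ := h
      have hc : Continuous fun p : unitInterval × Real.Angle =>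
          (⟨γ p.2, τ.val p.2⟩ : Bundle.TotalSpace ℂ L) :=
        τ.continuous_val.comp continuous_snd
      obtain ⟨r, hr, hrs⟩ := hL.exists_ratio hc hσ fun p => τ.ne_zero p.2
      rw [LoopTriv.logRel_iff_hasLog (r := fun θ => r (1, θ)) fun θ => by
        rw [← hrs (1, θ), h2]]
      refine hasLog_of_preconnected (Z := unitInterval) (R := fun s θ => r (s, θ)) hr ?_
        (z₁ := 0) ?_
      · intro s θ h
        apply h0 s θ
        rw [hrs (s, θ), h, zero_smul]
      · rw [← LoopTriv.logRel_iff_hasLog (τ := τ) (τ' := τ) fun θ => by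
          rw [← hrs (0, θ), h1]]
        exact ⟨fun _ => 0, continuous_const, fun θ => by simp⟩
    | refl τ => exact ⟨fun _ => 0, continuous_const, fun θ => by simp⟩
    | symm τ τ' _ ih =>
      obtain ⟨h, hc, he⟩ := ih
      refine ⟨fun θ => -h θ, hc.neg, fun θ => ?_⟩
      rw [he, smul_smul, ← Complex.exp_add, neg_add_cancel, Complex.exp_zero, one_smul]
    | trans τ₁ τ₂ τ₃ _ _ ih ih' =>
      obtain ⟨h, hc, he⟩ := ih
      obtain ⟨h', hc', he'⟩ := ih'
      refine ⟨fun θ => h' θ + h θ, hc'.add hc, fun θ => ?_⟩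
      rw [he', he, smul_smul, ← Complex.exp_add]
  · rintro ⟨h, hc, he⟩
    refine Quot.sound ⟨fun s θ => Complex.exp (s.1 * h θ) • τ.val θ, ?_, ?_, ?_, ?_⟩
    · refine continuous_iff_continuousAt.mpr fun p => ?_
      refine hL.continuousAt_smul (g := fun p : unitInterval × Real.Angle => γ p.2) ?_
        (τ.continuous_val.comp continuous_snd).continuousAt
      fun_prop
    · intro s θ
      exact smul_ne_zero (Complex.exp_ne_zero _) (τ.ne_zero θ)
    · funext θ
      simp
    · funext θ
      simp [he]

theorem continuous_toCircle : Continuous Real.Angle.toCircle :=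
  continuous_quot_lift _ Circle.exp.continuous

theorem continuous_toCircle_zpow (j : ℤ) :
    Continuous fun θ : Real.Angle => ((θ.toCircle ^ j : Circle) : ℂ) :=
  continuous_subtype_val.comp (continuous_toCircle.zpow j)

/-- Multiplication of a trivialization with `e^{ijθ}`. -/
noncomputable def LoopTriv.twist (hL : IsLineBundle L) {γ : C(Real.Angle, X)} (j : ℤ) (τ : LoopTriv L γ) :
    LoopTriv L γ where
  val θ := ((θ.toCircle ^ j : Circle) : ℂ) • τ.val θ
  continuous_val := continuous_iff_continuousAt.mpr fun _ =>
    hL.continuousAt_smul (g := γ) (continuous_toCircle_zpow j).continuousAt τ.continuous_val.continuousAt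
  ne_zero θ := smul_ne_zero (Circle.coe_ne_zero _) (τ.ne_zero θ)

theorem IsLineBundle.exists_mk_eq_twist (hL : IsLineBundle L) {γ : C(Real.Angle, X)}
    (τ τ' : LoopTriv L γ) : ∃ j : ℤ, Transg.mk τ' = Transg.mk (τ.twist hL j) := by
  obtain ⟨r, hr, hrs⟩ := hL.exists_ratio τ.continuous_val τ'.continuous_val τ.ne_zero
  obtain ⟨j, h, hc, he⟩ := exists_winding hr fun θ h => τ'.ne_zero θ (by rw [hrs, h, zero_smul])
  refine ⟨j, ((hL.mk_eq_mk_iff).mpr ⟨h, hc, fun θ => ?_⟩).symm⟩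
  rw [hrs, he, mul_comm, mul_smul]
  rfl

theorem IsLineBundle.eq_zero_of_mk_twist_eq (hL : IsLineBundle L) {γ : C(Real.Angle, X)}
    {τ : LoopTriv L γ} {j : ℤ} (h : Transg.mk τ = Transg.mk (τ.twist hL j)) : j = 0 := by
  rw [hL.mk_eq_mk_iff, LoopTriv.logRel_iff_hasLog fun θ => rfl] at h
  exact eq_zero_of_hasLog_toCircle h

/-! ### ### Families of trivializations -/

section Families

variable {Z : Type*} [TopologicalSpace Z]

theorem IsLineBundle.isLocallyConstant_mk_eq (hL : IsLineBundle L) {G : Z → C(Real.Angle, X)}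
    {τ τ' : ∀ z, LoopTriv L (G z)}
    (hτ : Continuous fun p : Z × Real.Angle =>
      (⟨G p.1 p.2, (τ p.1).val p.2⟩ : Bundle.TotalSpace ℂ L))
    (hτ' : Continuous fun p : Z × Real.Angle =>
      (⟨G p.1 p.2, (τ' p.1).val p.2⟩ : Bundle.TotalSpace ℂ L)) :
    IsLocallyConstant fun z => Transg.mk (τ z) = Transg.mk (τ' z) := by
  obtain ⟨r, hr, hrs⟩ := hL.exists_ratio (g := fun p : Z × Real.Angle => G p.1 p.2) hτ hτ'
    fun p => (τ p.1).ne_zero p.2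
  have h1 : (fun z => Transg.mk (τ z) = Transg.mk (τ' z)) = fun z => HasLog fun θ => r (z, θ) := by
    funext z
    rw [hL.mk_eq_mk_iff, LoopTriv.logRel_iff_hasLog fun θ => hrs (z, θ)]
  rw [h1]
  refine isLocallyConstant_hasLog hr fun z θ h => (τ' z).ne_zero θ ?_
  rw [hrs (z, θ), h, zero_smul]

theorem IsLineBundle.isOpen_mk_eq_at (hL : IsLineBundle L) {G : Z → C(Real.Angle, X)}
    (hG : Continuous G) {τ : ∀ z, LoopTriv L (G z)}
    (hτ : Continuous fun p : Z × Real.Angle =>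
      (⟨G p.1 p.2, (τ p.1).val p.2⟩ : Bundle.TotalSpace ℂ L)) (T : LoopTrivFamily L) :
    IsOpen {z | ∃ h : G z ∈ T.U, Transg.mk (τ z) = Transg.mk (T.at ⟨G z, h⟩)} := by
  have hZ : IsOpen (G ⁻¹' T.U) := T.isOpen_U.preimage hG
  have h1 : IsLocallyConstant fun z : G ⁻¹' T.U =>
      Transg.mk (τ z.1) = Transg.mk (T.at ⟨G z.1, z.2⟩) := by
    refine hL.isLocallyConstant_mk_eq (G := fun z : G ⁻¹' T.U => G z.1) ?_ ?_
    · exact hτ.comp (f := fun p : (G ⁻¹' T.U) × Real.Angle => (p.1.1, p.2)) (by fun_prop)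
    · exact T.continuous_val.comp
        (f := fun p : (G ⁻¹' T.U) × Real.Angle => ((⟨G p.1.1, p.1.2⟩ : T.U), p.2)) (by fun_prop)
  have h2 := hZ.isOpenMap_subtype_val _ (h1.isOpen_fiber True)
  convert h2 using 1
  ext z
  simp

end Families

theorem IsLineBundle.isOpen_range_at (hL : IsLineBundle L) (T : LoopTrivFamily L) :
    IsOpen {x : Bundle.TotalSpace ℤ (Transg L) |
      ∃ h : x.proj ∈ T.U, x.snd = Transg.mk (T.at ⟨x.proj, h⟩)} := by
  rw [isOpen_iSup_iff]
  intro T'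
  rw [isOpen_coinduced]
  exact hL.isOpen_mk_eq_at (G := fun γ : T'.U => γ.1) continuous_subtype_val
    (τ := fun γ => T'.at γ) T'.continuous_val T

/-- Every trivialization along a loop extends to a family of trivializations. -/
theorem IsLineBundle.exists_family (hL : IsLineBundle L) {γ₀ : C(Real.Angle, X)}
    (τ₀ : LoopTriv L γ₀) :
    ∃ (T : LoopTrivFamily L) (h : γ₀ ∈ T.U), T.at ⟨γ₀, h⟩ = τ₀ := by
  choose U s hU hs using fun θ => hL.exists_localTriv (γ₀ θ)
  have hVo : ∀ θ, IsOpen (γ₀ ⁻¹' U θ) := fun θ => (hs θ).isOpen.preimage γ₀.continuous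
  obtain ⟨S, hS⟩ := isCompact_univ.elim_finite_subcover (fun θ => γ₀ ⁻¹' U θ) hVo
    fun θ _ => Set.mem_iUnion.mpr ⟨θ, hU θ⟩
  have hS' : (Set.univ : Set Real.Angle) ⊆ ⋃ i : S, γ₀ ⁻¹' U i.1 := by
    intro θ hθ
    simpa using hS hθ
  obtain ⟨ρ, hρ⟩ := PartitionOfUnity.exists_isSubordinate isClosed_univ
    (fun i : S => γ₀ ⁻¹' U i.1) (fun i => hVo i) hS'
  choose a ha using fun i : S => (hs i.1).exists_coeff γ₀ τ₀.val
  have hac : ∀ (i : S) (θ : Real.Angle), γ₀ θ ∈ U i.1 → ContinuousAt (a i) θ := by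
    intro i θ hθ
    refine ((hs i.1).continuousAt_iff γ₀.continuous.continuousAt hθ ?_).mp
      τ₀.continuous_val.continuousAt
    filter_upwards [(hVo i.1).mem_nhds hθ] with θ' hθ' using ha i θ' hθ'
  let val : ∀ (γ : C(Real.Angle, X)) (θ : Real.Angle), L (γ θ) := fun γ θ =>
    ∑ i : S, ((ρ i θ : ℂ) * a i θ) • s i.1 (γ θ)
  have hev : Continuous fun p : C(Real.Angle, X) × Real.Angle => p.1 p.2 := by fun_prop
  -- These loops map the compact support of each weight into the corresponding trivializing set;
  -- this is an open condition in the compact-open topology.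
  let W : Set C(Real.Angle, X) := ⋂ i : S, {γ | Set.MapsTo γ (tsupport (ρ i)) (U i.1)}
  have hW : IsOpen W := isOpen_iInter_of_finite fun i =>
    ContinuousMap.isOpen_setOfPred_mapsTo (isClosed_tsupport _).isCompact (hs i.1).isOpen
  have hval : ∀ γ ∈ W, ∀ θ, ContinuousAt (fun p : C(Real.Angle, X) × Real.Angle =>
      (⟨p.1 p.2, val p.1 p.2⟩ : Bundle.TotalSpace ℂ L)) (γ, θ) := by
    intro γ hγ θ
    refine hL.continuousAt_sum (g := fun p : C(Real.Angle, X) × Real.Angle => p.1 p.2)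
      Finset.univ hev.continuousAt fun i _ => ?_
    have hsnd : ContinuousAt (fun p : C(Real.Angle, X) × Real.Angle => p.2) (γ, θ) :=
      continuousAt_snd
    by_cases hθ : θ ∈ tsupport (ρ i)
    · have h1 : ContinuousAt (fun p : C(Real.Angle, X) × Real.Angle => (ρ i p.2 : ℂ) * a i p.2)
          (γ, θ) := by
        refine ContinuousAt.mul (by fun_prop) ?_
        exact ContinuousAt.comp (f := fun p : C(Real.Angle, X) × Real.Angle => p.2)
          (hac i θ (hρ i hθ)) hsnd
      exact ((hs i.1).continuousAt_iff (g := fun p : C(Real.Angle, X) × Real.Angle => p.1 p.2)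
        hev.continuousAt (Set.mem_iInter.mp hγ i hθ) (Eventually.of_forall fun _ => rfl)).mpr h1
    -- Off the support of `ρ i` the summand vanishes nearby. Continuity of the zero section is the
    -- case of an empty sum.
    · have h1 := hL.continuousAt_sum (g := fun p : C(Real.Angle, X) × Real.Angle => p.1 p.2)
        (y₀ := (γ, θ)) (∅ : Finset ℕ) (σ := fun _ _ => 0) hev.continuousAt (by simp)
      refine h1.congr ?_
      filter_upwards [hsnd.eventually_mem ((isClosed_tsupport (ρ i)).isOpen_compl.mem_nhds hθ)]
        with p hp
      simp [image_eq_zero_of_notMem_tsupport hp]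
  have hγ₀ : γ₀ ∈ W := Set.mem_iInter.mpr fun i θ hθ => hρ i hθ
  have hval₀ : ∀ θ, val γ₀ θ = τ₀.val θ := by
    intro θ
    have h1 : ∀ i : S, ((ρ i θ : ℂ) * a i θ) • s i.1 (γ₀ θ) = (ρ i θ : ℂ) • τ₀.val θ := by
      intro i
      by_cases h : ρ i θ = 0
      · simp [h]
      · have h2 : θ ∈ tsupport (ρ i) := subset_tsupport _ h
        rw [mul_smul, ← ha i θ (hρ i h2)]
    have h2 := ρ.sum_eq_one (Set.mem_univ θ)
    rw [finsum_eq_sum_of_fintype] at h2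
    simp only [val, h1]
    rw [← Finset.sum_smul, ← Complex.ofReal_sum, h2, Complex.ofReal_one, one_smul]
  refine ⟨{
    U := {γ ∈ W | ∀ θ, val γ θ ≠ 0}
    isOpen_U := ?_
    val := fun γ θ => val γ.1 θ
    continuous_val := ?_
    ne_zero := fun γ θ => γ.2.2 θ }, ⟨hγ₀, fun θ => ?_⟩, ?_⟩
  · rw [isOpen_iff_mem_nhds]
    rintro γ ⟨hγ, h0⟩
    have h1 : ∀ θ ∈ (Set.univ : Set Real.Angle), ∀ᶠ p : C(Real.Angle, X) × Real.Angle in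
        𝓝 (γ, θ), val p.1 p.2 ≠ 0 := fun θ _ =>
      hL.eventually_ne_zero (g := fun p : C(Real.Angle, X) × Real.Angle => p.1 p.2)
        (hval γ hγ θ) (h0 θ)
    filter_upwards [hW.mem_nhds hγ, isCompact_univ.eventually_forall_of_forall_eventually
      (P := fun γ θ => val γ θ ≠ 0) h1] with γ' h2 h3 using ⟨h2, fun θ => h3 θ trivial⟩
  · refine continuous_iff_continuousAt.mpr fun p => ?_
    exact ContinuousAt.comp (f := fun p : {γ ∈ W | ∀ θ, val γ θ ≠ 0} × Real.Angle => (p.1.1, p.2))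
      (hval p.1.1 p.1.2.1 p.2) (by fun_prop)
  · rw [hval₀]
    exact τ₀.ne_zero θ
  · rw [LoopTrivFamily.at]
    congr 1
    funext θ
    exact hval₀ θ

/-- Only families over open sets of loops are continuous by definition. Near `z₀`, the classes of
`τ` agree with those of such a family extending `τ z₀`, since equality of classes is locally
constant. -/
theorem IsLineBundle.continuous_mk {Z : Type*} [TopologicalSpace Z] (hL : IsLineBundle L)
    {G : Z → C(Real.Angle, X)} (hG : Continuous G) {τ : ∀ z, LoopTriv L (G z)}
    (hτ : Continuous fun p : Z × Real.Angle =>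
      (⟨G p.1 p.2, (τ p.1).val p.2⟩ : Bundle.TotalSpace ℂ L)) :
    Continuous fun z => (⟨G z, Transg.mk (τ z)⟩ : Bundle.TotalSpace ℤ (Transg L)) := by
  refine continuous_iff_continuousAt.mpr fun z₀ => ?_
  obtain ⟨T, hT, hT₀⟩ := hL.exists_family (τ z₀)
  have hO := hL.isOpen_mk_eq_at hG hτ T
  refine ContinuousOn.continuousAt ?_ (hO.mem_nhds ⟨hT, by rw [hT₀]⟩)
  rw [continuousOn_iff_continuous_domRestrict]
  have hTc : Continuous fun γ : T.U =>
      (⟨γ.1, Transg.mk (T.at γ)⟩ : Bundle.TotalSpace ℤ (Transg L)) :=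
    continuous_iff_coinduced_le.mpr (le_iSup (fun T : LoopTrivFamily L =>
      TopologicalSpace.coinduced (fun γ : T.U =>
        (⟨γ.1, Transg.mk (T.at γ)⟩ : Bundle.TotalSpace ℤ (Transg L))) inferInstance) T)
  convert hTc.comp (f := fun z : {z | ∃ h : G z ∈ T.U, Transg.mk (τ z) =
    Transg.mk (T.at ⟨G z, h⟩)} => (⟨G z.1, z.2.1⟩ : T.U)) (by fun_prop) using 1
  funext z
  simp only [Set.domRestrict_apply, Function.comp_apply]
  rw [z.2.2]

end Transgression

/-! ### ### Eigenbases and admissible cutoffs -/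

section General

variable {E : Type*} [NormedAddCommGroup E] [InnerProductSpace ℂ E]

/-- A finite-dimensional spectral subspace has a basis of eigenvectors. -/
theorem exists_eigenbasis (A : E →L[ℂ] E) (I : Set ℝ) [FiniteDimensional ℂ (specSpace A I)] :
    ∃ (g : Fin (specCount A I) → E) (lam : Fin (specCount A I) → ℝ), LinearIndependent ℂ g ∧
      Submodule.span ℂ (Set.range g) = specSpace A I ∧
      ∀ i, lam i ∈ I ∧ A (g i) = (lam i : ℂ) • g i := by
  let S : Set E := ⋃ x ∈ I, (Module.End.eigenspace (A : E →ₗ[ℂ] E) (x : ℂ) : Set E)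
  have hS : Submodule.span ℂ S = specSpace A I := by
    simp only [S, Submodule.span_iUnion, Submodule.span_eq, specSpace]
  obtain ⟨b, hbS, hbs, hb⟩ := exists_linearIndependent ℂ S
  rw [hS] at hbs
  have hbV : ∀ x : b, (x : E) ∈ specSpace A I := fun x => hbs ▸ Submodule.subset_span x.2
  have hfin : Finite b := by
    have : LinearIndependent ℂ fun x : b => (⟨x, hbV x⟩ : specSpace A I) :=
      LinearIndependent.of_comp (specSpace A I).subtype hb
    exact this.finite
  have := Fintype.ofFinite b
  have hcard : Fintype.card b = specCount A I := by
    rw [specCount, ← hbs]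
    have := finrank_span_eq_card hb
    rw [Subtype.range_coe] at this
    exact this.symm
  let eq := (Fintype.equivFinOfCardEq hcard).symm
  have hg : ∀ i, ∃ x ∈ I, A (eq i) = (x : ℂ) • (eq i : E) := by
    intro i
    have := hbS (eq i).2
    simp only [S, Set.mem_iUnion] at this
    obtain ⟨x, hx, hm⟩ := this
    exact ⟨x, hx, (mem_eigenspace_iff' A x _).mp hm⟩
  choose lam hlam hA using hg
  refine ⟨fun i => eq i, lam, hb.comp _ eq.injective, ?_, fun i => ⟨hlam i, hA i⟩⟩
  rw [← hbs]
  congr 1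
  have := eq.surjective.range_comp ((↑) : b → E)
  rw [Subtype.range_coe] at this
  exact this

theorem ker_eq_bot_of_isUnit {Q : E →L[ℂ] E} (h : IsUnit Q) : Q.ker = ⊥ := by
  obtain ⟨u, rfl⟩ := h
  rw [eq_bot_iff]
  intro v hv
  have hv' : (u : E →L[ℂ] E) v = 0 := hv
  have h2 : ((u⁻¹ : (E →L[ℂ] E)ˣ) : E →L[ℂ] E) ((u : E →L[ℂ] E) v) = v :=
    DFunLike.congr_fun (Units.inv_mul u) v
  rw [hv', map_zero] at h2
  exact h2.symm

theorem specSpace_singleton_of_notMem {P : E →L[ℂ] E} {x : ℝ} (h : (x : ℂ) ∉ spectrum ℂ P) :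
    specSpace P {x} = ⊥ := by
  rw [specSpace, iSup_singleton, eq_bot_iff]
  intro v hv
  rw [mem_eigenspace_iff'] at hv
  rw [spectrum.notMem_iff] at h
  obtain ⟨u, hu⟩ := h
  have h1 : (u : E →L[ℂ] E) v = 0 := by
    rw [hu, sub_apply, hv, Algebra.algebraMap_eq_smul_one, smul_apply,
      one_apply_eq_self, sub_self]
  have h2 : ((u⁻¹ : (E →L[ℂ] E)ˣ) : E →L[ℂ] E) ((u : E →L[ℂ] E) v) = v :=
    DFunLike.congr_fun (Units.inv_mul u) v
  rw [h1, map_zero] at h2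
  exact h2.symm

theorem Admissible.specSpace_Ioo {P : E →L[ℂ] E} {μ : ℝ} (h : Admissible P μ) :
    specSpace P (Set.Ioo (-μ) μ) = specSpace P (Set.Icc (-μ) μ) := by
  have h1 : Set.Icc (-μ) μ = Set.Ioo (-μ) μ ∪ {μ} ∪ {-μ} := by
    have h0 := h.1
    ext x
    simp only [Set.mem_Icc, Set.union_singleton, Set.mem_insert_iff, Set.mem_Ioo]
    grind
  rw [h1, specSpace_union, specSpace_union, specSpace_singleton_of_notMem h.2.1,
    specSpace_singleton_of_notMem h.2.2.1, sup_bot_eq, sup_bot_eq]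

theorem Admissible.specSpace_Icc_of_lt {P : E →L[ℂ] E} {μ ν : ℝ} (h : Admissible P μ)
    (h' : Admissible P ν) (hlt : μ < ν) :
    specSpace P (Set.Icc (-ν) ν) = specSpace P (Set.Icc (-μ) μ) ⊔
      (specSpace P (Set.Ioo (-ν) (-μ)) ⊔ specSpace P (Set.Ioo μ ν)) := by
  have h1 : Set.Icc (-ν) ν = Set.Icc (-μ) μ ∪ (Set.Ioo (-ν) (-μ) ∪ Set.Ioo μ ν) ∪ {ν} ∪ {-ν} := by
    have h0 := h.1
    ext x
    simp only [Set.mem_Icc, Set.union_singleton, Set.mem_insert_iff, Set.mem_Ioo, Set.mem_union]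
    grind
  rw [h1, specSpace_union, specSpace_union, specSpace_union, specSpace_union,
    specSpace_singleton_of_notMem h'.2.1, specSpace_singleton_of_notMem h'.2.2.1, sup_bot_eq,
    sup_bot_eq]

theorem Admissible.specCount_eq {P : E →L[ℂ] E} {μ : ℝ} (h : Admissible P μ) {k : ℕ}
    {v : Fin k → E} (hv : LinearIndependent ℂ v)
    (hvs : Submodule.span ℂ (Set.range v) = specSpace P (Set.Icc (-μ) μ)) :
    specCount P (Set.Ioo (-μ) μ) = k := by
  rw [specCount, h.specSpace_Ioo, ← hvs, finrank_span_eq_card hv, Fintype.card_fin]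

end General

variable {E : Type*} [NormedAddCommGroup E] [InnerProductSpace ℂ E] [CompleteSpace E]

/-! ### Spectral subspaces of `a + i b P` for self-adjoint `P` -/

section Affine

theorem adjoint_affine {P : E →L[ℂ] E} (hP : IsSelfAdjoint P) (a b : ℝ) :
    ContinuousLinearMap.adjoint ((a : ℂ) • (1 : E →L[ℂ] E) + (Complex.I * b) • P)
      = (a : ℂ) • (1 : E →L[ℂ] E) + (Complex.I * (-b : ℝ)) • P := by
  rw [← ContinuousLinearMap.star_eq_adjoint, star_add, star_smul, star_smul, star_one, hP.star_eq]
  simp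

theorem adjoint_affine_comp {P : E →L[ℂ] E} (hP : IsSelfAdjoint P) (a b : ℝ) (x : E) :
    (ContinuousLinearMap.adjoint ((a : ℂ) • (1 : E →L[ℂ] E) + (Complex.I * b) • P)).comp
      ((a : ℂ) • (1 : E →L[ℂ] E) + (Complex.I * b) • P) x
      = ((a ^ 2 : ℝ) : ℂ) • x + ((b ^ 2 : ℝ) : ℂ) • P (P x) := by
  rw [adjoint_affine hP]
  simp only [ContinuousLinearMap.comp_apply, add_apply, smul_apply,
    one_apply_eq_self, map_add, map_smul]
  have hI := Complex.I_mul_I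
  push_cast
  match_scalars
  · ring
  · ring
  · linear_combination (-(b : ℂ) ^ 2) * hI

/-- Here `(a + ibP)†(a + ibP) = a² + b²P²`, so an eigenvector `v` satisfies `P²v = κv`. For `κ > 0`
it is the sum of its components with `P = √κ` and `P = -√κ`; for `κ ≤ 0`, positivity of `P²` forces
`P v = 0`. -/
theorem domSpace_affine {P : E →L[ℂ] E} (hP : IsSelfAdjoint P) (a : ℝ) {b μ : ℝ} (hb : b ≠ 0)
    (hμ : 0 ≤ μ) :
    domSpace ((a : ℂ) • (1 : E →L[ℂ] E) + (Complex.I * b) • P)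
      (Set.Icc 0 (a ^ 2 + b ^ 2 * μ ^ 2)) = specSpace P (Set.Icc (-μ) μ) := by
  have hb2 : 0 < b ^ 2 := by positivity
  have hb2' : ((b ^ 2 : ℝ) : ℂ) ≠ 0 := by exact_mod_cast hb2.ne'
  apply le_antisymm
  · refine iSup₂_le fun x hx v hv => ?_
    rw [mem_eigenspace_iff', adjoint_affine_comp hP] at hv
    set κ : ℝ := (x - a ^ 2) / b ^ 2 with hκ
    have hx' : x = a ^ 2 + b ^ 2 * κ := by rw [hκ]; field_simp; ring
    have h1 : P (P v) = (κ : ℂ) • v := by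
      apply smul_right_injective E hb2'
      simp only [smul_smul]
      rw [← sub_eq_zero, ← sub_eq_zero.mpr hv, hx']
      push_cast
      module
    have h2 : κ * ‖v‖ ^ 2 = ‖P v‖ ^ 2 := by
      have h3 : inner ℂ v (P (P v)) = inner ℂ (P v) (P v) := (hP.isSymmetric v (P v)).symm
      rw [h1, inner_smul_right, inner_self_eq_norm_sq_to_K, inner_self_eq_norm_sq_to_K] at h3
      apply Complex.ofReal_injective
      simpa using h3
    have hκμ : κ ≤ μ ^ 2 := by
      have := hx.2
      rw [hx'] at this
      nlinarith
    rcases lt_or_ge 0 κ with hpos | hneg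
    · have hs : (0 : ℝ) < √κ := Real.sqrt_pos.mpr hpos
      have hs' : ((√κ : ℝ) : ℂ) ≠ 0 := by exact_mod_cast hs.ne'
      have hss : ((√κ : ℝ) : ℂ) * (√κ : ℝ) = κ := by
        exact_mod_cast Real.mul_self_sqrt hpos.le
      have hsμ : √κ ≤ μ := Real.sqrt_le_left hμ |>.mpr hκμ
      have hv2 : v = ((1 / 2 : ℂ) • v + (1 / (2 * (√κ : ℝ)) : ℂ) • P v)
          + ((1 / 2 : ℂ) • v - (1 / (2 * (√κ : ℝ)) : ℂ) • P v) := by module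
      rw [hv2]
      refine add_mem (eigenspace_le_specSpace P (I := Set.Icc (-μ) μ) (x := √κ) ⟨by linarith, hsμ⟩ ?_)
        (eigenspace_le_specSpace P (I := Set.Icc (-μ) μ) (x := -√κ) ⟨by linarith, by linarith⟩ ?_)
      · rw [mem_eigenspace_iff', map_add, map_smul, map_smul, h1, ← hss]
        match_scalars <;> field_simp
      · rw [mem_eigenspace_iff', map_sub, map_smul, map_smul, h1, ← hss]
        push_cast
        match_scalars <;> field_simp
    · have h4 : P v = 0 := by
        have : ‖P v‖ ^ 2 = 0 := by nlinarith [sq_nonneg ‖v‖, sq_nonneg ‖P v‖]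
        simpa using this
      refine eigenspace_le_specSpace P (I := Set.Icc (-μ) μ) (x := 0) ⟨by linarith, hμ⟩ ?_
      rw [mem_eigenspace_iff', h4]
      simp
  · refine iSup₂_le fun x hx v hv => ?_
    rw [mem_eigenspace_iff'] at hv
    have hxμ : x ^ 2 ≤ μ ^ 2 := sq_le_sq' hx.1 hx.2
    refine eigenspace_le_specSpace _ (I := Set.Icc 0 (a ^ 2 + b ^ 2 * μ ^ 2))
      (x := a ^ 2 + b ^ 2 * x ^ 2) ⟨by positivity, by gcongr⟩ ?_
    rw [mem_eigenspace_iff', adjoint_affine_comp hP, hv, map_smul, hv]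
    push_cast
    module

theorem codSpace_affine {P : E →L[ℂ] E} (hP : IsSelfAdjoint P) (a : ℝ) {b μ : ℝ} (hb : b ≠ 0)
    (hμ : 0 ≤ μ) :
    codSpace ((a : ℂ) • (1 : E →L[ℂ] E) + (Complex.I * b) • P)
      (Set.Icc 0 (a ^ 2 + b ^ 2 * μ ^ 2)) = specSpace P (Set.Icc (-μ) μ) := by
  rw [codSpace_eq, adjoint_affine hP, ← neg_sq b, domSpace_affine hP a (neg_ne_zero.mpr hb) hμ]

end Affine

/-! ### Counting eigenvalues -/

section Count

theorem Admissible.hasGaps {P : E →L[ℂ] E} {μ : ℝ} (h : Admissible P μ) (hP : IsSelfAdjoint P) :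
    HasGaps P (-μ) μ := ⟨hP, h.2.2.1, h.2.1⟩

theorem Admissible.finiteDimensional {P : E →L[ℂ] E} {μ : ℝ} (h : Admissible P μ)
    (hP : IsSelfAdjoint P) : FiniteDimensional ℂ (specSpace P (Set.Icc (-μ) μ)) :=
  (h.hasGaps hP).finiteDimensional_specSpace h.2.2.2

end Count

/-! ### Canonical sections -/

section Canonical

theorem ker_adjoint_eq_bot_of_isUnit {Q : E →L[ℂ] E} (h : IsUnit Q) :
    (ContinuousLinearMap.adjoint Q).ker = ⊥ := ker_eq_bot_of_isUnit h.star

theorem exists_isDetOne {Q : E →L[ℂ] E} (h : IsUnit Q) : ∃ d, IsDetOne Q d := by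
  have h0 : LinearIndependent ℂ (Fin.elim0 : Fin 0 → E) := linearIndependent_empty_type
  have h1 : Submodule.span ℂ (Set.range (Fin.elim0 : Fin 0 → E)) = Q.ker := by
    simp [ker_eq_bot_of_isUnit h]
  have h2 : Submodule.span ℂ (Set.range (Fin.elim0 : Fin 0 → E))
      = (ContinuousLinearMap.adjoint Q).ker := by
    simp [ker_adjoint_eq_bot_of_isUnit h]
  obtain ⟨α, hα⟩ := exists_dual_topPow h0 h2 1
  exact ⟨_, ⟨_, wedge_mem_topPow h0 h1⟩, α, ⟨_, wedge_mem_topPow h0 h2⟩, by simp, by simp, hα, rfl⟩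

/-- For invertible `Q` the canonical element is the stabilization at cutoff `0` with empty frames.
It thereby falls under the same continuity statement as stabilized sections. -/
theorem IsDetOne.isFrameStab {Q : E →L[ℂ] E} (h : IsUnit Q) {d : DetLine Q} (hd : IsDetOne Q d) :
    IsFrameStab Q 0 (Fin.elim0 : Fin 0 → E) (Fin.elim0 : Fin 0 → E) d := by
  have h0 : LinearIndependent ℂ (Fin.elim0 : Fin 0 → E) := linearIndependent_empty_type
  have h1 : Submodule.span ℂ (Set.range (Fin.elim0 : Fin 0 → E)) = domSpace Q (Set.Icc 0 0) := by
    rw [Set.Icc_self, domSpace_zero, ker_eq_bot_of_isUnit h]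
    simp
  have h2 : Submodule.span ℂ (Set.range (Fin.elim0 : Fin 0 → E)) = codSpace Q (Set.Icc 0 0) := by
    rw [codSpace_eq, Set.Icc_self, domSpace_zero, ker_adjoint_eq_bot_of_isUnit h]
    simp
  obtain ⟨d', hd'⟩ := exists_isFrameStab le_rfl h0 h1 h0 h2
  have h3 := (hd'.eq_smul_isDetOne (ker_eq_bot_of_isUnit h) (ker_adjoint_eq_bot_of_isUnit h) hd).1
  rw [show (Q ∘ (Fin.elim0 : Fin 0 → E)) = Fin.elim0 from Subsingleton.elim _ _,
    wedgeCoef_self h0, one_smul] at h3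
  exact h3 ▸ hd'

/-- A choice of `det Q`. -/
noncomputable def detOne (Q : E →L[ℂ] E) : DetLine Q := Classical.epsilon (IsDetOne Q)

theorem isDetOne_detOne {Q : E →L[ℂ] E} (h : IsUnit Q) : IsDetOne Q (detOne Q) :=
  Classical.epsilon_spec (exists_isDetOne h)

/-- A choice of the image of `1` under the stabilization. -/
noncomputable def stabOne (Q : E →L[ℂ] E) (μ : ℝ) : DetLine Q :=
  Classical.epsilon fun d => ∃ (k : ℕ) (v : Fin k → E), IsFrameStab Q μ v v d

/-- With the same frame on both sides, the change of basis enters the numerator and the denominator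
of the transition function equally. -/
theorem IsFrameStab.eq_of_diag {Q : E →L[ℂ] E} {μ : ℝ} {k l : ℕ} {v : Fin k → E} {w : Fin l → E}
    {d d' : DetLine Q} (h : IsFrameStab Q μ v v d) (h' : IsFrameStab Q μ w w d') : d = d' := by
  obtain ⟨m, g, hm, -, hg, hi⟩ := h.exists_complement le_rfl h'
  subst hm
  have h1 := finrank_span_eq_card h.indep_e
  have h2 := finrank_span_eq_card h'.indep_e
  rw [h.span_e, ← h'.span_e, h2, Fintype.card_fin, Fintype.card_fin] at h1
  obtain rfl : m = 0 := by omega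
  have h3 := h.transition le_rfl h' hg hi
  rw [show Q ∘ g = g from Subsingleton.elim _ _, div_self, one_smul] at h3
  · exact h3.symm
  · refine wedgeCoef_ne_zero h'.indep_e hi fun i => ?_
    rw [h'.span_e, ← h.span_e]
    refine Submodule.subset_span ⟨i, ?_⟩
    exact (Fin.append_left v g i).symm

theorem isFrameStab_stabOne {Q : E →L[ℂ] E} {μ : ℝ} (hμ : 0 ≤ μ) {k : ℕ} {v : Fin k → E}
    (hv : LinearIndependent ℂ v) (h : Submodule.span ℂ (Set.range v) = domSpace Q (Set.Icc 0 μ))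
    (h' : Submodule.span ℂ (Set.range v) = codSpace Q (Set.Icc 0 μ)) :
    IsFrameStab Q μ v v (stabOne Q μ) := by
  obtain ⟨d, hd⟩ := exists_isFrameStab hμ hv h hv h'
  obtain ⟨l, w, hw⟩ : ∃ (l : ℕ) (w : Fin l → E), IsFrameStab Q μ w w (stabOne Q μ) :=
    Classical.epsilon_spec (p := fun d => ∃ (k : ℕ) (v : Fin k → E), IsFrameStab Q μ v v d)
      ⟨d, k, v, hd⟩
  exact hd.eq_of_diag hw ▸ hd

theorem IsFrameStab.isStabOne {Q : E →L[ℂ] E} {μ : ℝ} {k : ℕ} {v : Fin k → E} {d : DetLine Q}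
    (h : IsFrameStab Q μ v v d) : IsStabOne Q μ d := by
  obtain ⟨φ, z, hz, hφ, hs⟩ := h.isStab
  exact ⟨⟨wedge v, wedge_mem_topPow h.indep_e h.span_e⟩, φ, z, hz, hφ, hs⟩

variable {Y : Type*} [TopologicalSpace Y]

/-- Compared with the section of a `DetFrame`, the given section has a continuous coefficient, by
`exists_transition`. The cutoff `μ y` may vary with `y` and need not lie in a spectral gap. -/
theorem continuousAt_of_isFrameStab {g : Y → Fred E E} {y₀ : Y} (hg : ContinuousAt g y₀)
    {μ : Y → ℝ} (hμ : ContinuousAt μ y₀) {k l : ℕ} {e : Y → Fin k → E} {f : Y → Fin l → E}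
    (he : ContinuousAt e y₀) (hf : ContinuousAt f y₀) {d : ∀ y, DetBundle E E (g y)}
    (h : ∀ᶠ y in 𝓝 y₀, IsFrameStab (g y).1 (μ y) (e y) (f y) (d y)) :
    ContinuousAt (fun y => (⟨g y, d y⟩ : Bundle.TotalSpace ℂ (DetBundle E E))) y₀ := by
  obtain ⟨c, hc, hD⟩ := exists_detFrame (g y₀)
  -- A cutoff different from `μ y₀` keeps the order of the two cutoffs constant near `y₀`, as
  -- `exists_transition` requires.
  obtain ⟨m, hm, hne⟩ : ∃ m ∈ Set.Ioo 0 c, m ≠ μ y₀ := by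
    by_cases h : c / 2 = μ y₀
    · exact ⟨c / 3, ⟨by linarith, by linarith⟩, by rw [← h]; intro h; linarith⟩
    · exact ⟨c / 2, ⟨by linarith, by linarith⟩, h⟩
  obtain ⟨D, hD₀, rfl⟩ := hD m hm.1 hm.2
  have hU := hg.eventually_mem (D.isOpen_U.mem_nhds hD₀)
  obtain ⟨r, hr, hrs⟩ := exists_transition (Q := fun y => (g y).1) (μ := fun _ => D.μ) (μ' := μ)
    (e := fun y => D.eExt (g y)) (f := fun y => D.fExt (g y)) (d := fun y => D.secExt (g y))
    (d' := d) (x₀ := y₀) (continuous_subtype_val.continuousAt.comp hg)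
    (ContinuousAt.comp (f := g) (D.continuousAt_eExt hD₀) hg)
    (ContinuousAt.comp (f := g) (D.continuousAt_fExt hD₀) hg) he hf
    (hU.mono fun y hy => D.isFrameStab_ext hy) h (by
      rcases lt_or_gt_of_ne hne with hlt | hlt
      · exact Or.inl ((hμ.eventually_const_lt hlt).mono fun _ h => h.le)
      · exact Or.inr ((hμ.eventually_lt_const hlt).mono fun _ h => h.le))
  exact (D.isLocalTriv.continuousAt_iff hg hD₀ hrs).mpr hr

theorem continuousAt_detOne {g : Y → Fred E E} {y₀ : Y} (hg : ContinuousAt g y₀)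
    (h : IsUnit (g y₀).1) : ContinuousAt (fun y =>
      (⟨g y, (detOne (g y).1 : DetLine (g y).1)⟩ : Bundle.TotalSpace ℂ (DetBundle E E))) y₀ := by
  have hu : ∀ᶠ y in 𝓝 y₀, IsUnit (g y).1 :=
    (continuous_subtype_val.continuousAt.comp hg).eventually_mem (Units.isOpen.mem_nhds h)
  refine continuousAt_of_isFrameStab hg (μ := fun _ => 0) continuousAt_const
    (e := fun _ => Fin.elim0) (f := fun _ => Fin.elim0) continuousAt_const continuousAt_const ?_
  exact hu.mono fun y hy => (isDetOne_detOne hy).isFrameStab hy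

end Canonical

section General

variable {H : Type*} [NormedAddCommGroup H] [InnerProductSpace ℂ H]

/-! ### The canonical trivializations along the Atiyah–Singer loops -/

theorem asOp_of_sin_pos (P : H →L[ℂ] H) {θ : Real.Angle} (h : 0 < θ.sin) :
    asOp P θ = (θ.cos : ℂ) • 1 + (Complex.I * θ.sin) • P := if_pos h.le

theorem isUnit_asOp_of_sin_eq_zero (P : H →L[ℂ] H) {θ : Real.Angle} (h : θ.sin = 0) :
    IsUnit (asOp P θ) := by
  rw [asOp, if_pos h.ge, h]
  have h1 := θ.cos_sq_add_sin_sq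
  have h2 : θ.cos ≠ 0 := fun h0 => by simp [h, h0] at h1
  simpa using isUnit_smul_one (H := H) (c := (θ.cos : ℂ)) (by exact_mod_cast h2)

theorem isUnit_asOp_of_sin_neg (P : H →L[ℂ] H) {θ : Real.Angle} (h : θ.sin < 0) :
    IsUnit (asOp P θ) := by
  rw [asOp, if_neg h.not_ge, ← add_smul]
  refine isUnit_smul_one fun h0 => ?_
  have h1 := congrArg Complex.im h0
  simp at h1
  exact h.ne h1

theorem isUnit_asOp_of_sin_nonpos (P : H →L[ℂ] H) {θ : Real.Angle} (h : θ.sin ≤ 0) :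
    IsUnit (asOp P θ) := by
  rcases h.eq_or_lt with h | h
  · exact isUnit_asOp_of_sin_eq_zero P h
  · exact isUnit_asOp_of_sin_neg P h

end General

variable {H : Type*} [NormedAddCommGroup H] [InnerProductSpace ℂ H] [CompleteSpace H]

theorem continuous_asOp_uncurry :
    Continuous fun p : (H →L[ℂ] H) × Real.Angle => asOp p.1 p.2 := by
  have hs : Continuous fun p : (H →L[ℂ] H) × Real.Angle => p.2.sin :=
    Real.Angle.continuous_sin.comp continuous_snd
  have h1 : Continuous fun p : (H →L[ℂ] H) × Real.Angle => ((p.2.cos : ℝ) : ℂ) :=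
    Complex.continuous_ofReal.comp (Real.Angle.continuous_cos.comp continuous_snd)
  have h2 : Continuous fun p : (H →L[ℂ] H) × Real.Angle => Complex.I * ((p.2.sin : ℝ) : ℂ) :=
    continuous_const.mul (Complex.continuous_ofReal.comp hs)
  refine Continuous.if_le ((h1.smul continuous_const).add (h2.smul continuous_fst))
    ((h1.smul continuous_const).add (h2.smul continuous_const)) continuous_const hs ?_
  intro p h
  simp [← h]

theorem continuous_asLoop_uncurry :
    Continuous fun p : FredSA H × Real.Angle => asLoop p.1 p.2 :=
  (continuous_asOp_uncurry.comp
    (f := fun p : FredSA H × Real.Angle => (p.1.1, p.2)) (by fun_prop)).subtype_mk _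

theorem continuous_asLoop : Continuous (asLoop (H := H)) :=
  ContinuousMap.continuous_of_continuous_uncurry _ continuous_asLoop_uncurry

/-- The cutoff `cos² θ + μ² sin² θ` for `P_θ`. -/
noncomputable def cutoff (μ : ℝ) (θ : Real.Angle) : ℝ := θ.cos ^ 2 + θ.sin ^ 2 * μ ^ 2

theorem cutoff_nonneg (μ : ℝ) (θ : Real.Angle) : 0 ≤ cutoff μ θ := by
  unfold cutoff
  positivity

theorem continuous_cutoff (μ : ℝ) : Continuous (cutoff μ) := by
  have h1 := Real.Angle.continuous_cos
  have h2 := Real.Angle.continuous_sin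
  unfold cutoff
  fun_prop

theorem isFrameStab_asOp {P : H →L[ℂ] H} (hP : IsSelfAdjoint P) {μ : ℝ} (hμ : 0 ≤ μ)
    {θ : Real.Angle} (h : 0 < θ.sin) {k : ℕ} {v : Fin k → H} (hv : LinearIndependent ℂ v)
    (hvs : Submodule.span ℂ (Set.range v) = specSpace P (Set.Icc (-μ) μ)) :
    IsFrameStab (asOp P θ) (cutoff μ θ) v v (stabOne (asOp P θ) (cutoff μ θ)) := by
  refine isFrameStab_stabOne (cutoff_nonneg μ θ) hv ?_ ?_
  · rw [hvs, asOp_of_sin_pos P h]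
    exact (domSpace_affine hP _ h.ne' hμ).symm
  · rw [hvs, asOp_of_sin_pos P h]
    exact (codSpace_affine hP _ h.ne' hμ).symm

/-- The trivialization `τ` with `τ(θ) = e^{i(N-2n)θ} s_θ` on the upper half circle and
`τ(θ) = det P_θ` on the lower one. -/
noncomputable def asSec (P : FredSA H) (μ : ℝ) (n : ℤ) (θ : Real.Angle) :
    DetBundle H H (asLoop P θ) :=
  if 0 < θ.sin then
    ((θ.toCircle ^ ((specCount P.1 (Set.Ioo (-μ) μ) : ℤ) - 2 * n) : Circle) : ℂ) •
      (stabOne (asOp P.1 θ) (cutoff μ θ) : DetLine (asOp P.1 θ))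
  else (detOne (asOp P.1 θ) : DetLine (asOp P.1 θ))

theorem asSec_of_sin_pos (P : FredSA H) (μ : ℝ) (n : ℤ) {θ : Real.Angle} (h : 0 < θ.sin) :
    asSec P μ n θ =
      ((θ.toCircle ^ ((specCount P.1 (Set.Ioo (-μ) μ) : ℤ) - 2 * n) : Circle) : ℂ) •
      (stabOne (asOp P.1 θ) (cutoff μ θ) : DetLine (asOp P.1 θ)) := if_pos h

theorem asSec_of_sin_nonpos (P : FredSA H) (μ : ℝ) (n : ℤ) {θ : Real.Angle} (h : θ.sin ≤ 0) :
    asSec P μ n θ = (detOne (asOp P.1 θ) : DetLine (asOp P.1 θ)) := if_neg h.not_gt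

theorem asSec_ne_zero (P : FredSA H) {μ : ℝ} (hμ : Admissible P.1 μ) (n : ℤ) (θ : Real.Angle) :
    asSec P μ n θ ≠ 0 := by
  rcases lt_or_ge 0 θ.sin with h | h
  · rw [asSec_of_sin_pos P μ n h]
    have := hμ.finiteDimensional P.2.1
    obtain ⟨v, hv, hvs⟩ := exists_basis_fin (specSpace P.1 (Set.Icc (-μ) μ))
    exact smul_ne_zero (Circle.coe_ne_zero _)
      (isFrameStab_asOp P.2.1 hμ.1.le h hv hvs).spans.1
  · rw [asSec_of_sin_nonpos P μ n h]
    have hu := isUnit_asOp_of_sin_nonpos P.1 h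
    exact ((isDetOne_detOne hu).isFrameStab hu).spans.1

/-! ### ### Joint continuity of the trivializations in the operator and the angle -/

section JointContinuity

variable (H) in
/-- The operators for which `μ` is an admissible cutoff. -/
abbrev AdmissibleLocus (μ : ℝ) : Type _ := {P : FredSA H // Admissible P.1 μ}

variable {μ : ℝ}

/-- A continuous local frame of `V_{[-μ,μ]}(P)` over the set where `μ` is admissible. -/
theorem exists_localFrame_admissible (P₀ : AdmissibleLocus H μ) :
    ∃ (k : ℕ) (v : AdmissibleLocus H μ → Fin k → H), ContinuousAt v P₀ ∧
      ∀ᶠ P in 𝓝 P₀, LinearIndependent ℂ (v P) ∧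
        Submodule.span ℂ (Set.range (v P)) = specSpace P.1.1 (Set.Icc (-μ) μ) := by
  obtain ⟨k, e, he, hev⟩ := exists_localFrame (P₀.2.hasGaps P₀.1.2.1) P₀.2.2.2.2
  have hc : Continuous fun P : AdmissibleLocus H μ => P.1.1 := by fun_prop
  refine ⟨k, fun P => e P.1.1,
    (he.comp_continuous hc fun P => P.2.hasGaps P.1.2.1).continuousAt, ?_⟩
  filter_upwards [hc.continuousAt.eventually hev] with P hP
  exact (hP P.1.2.1).2.2

theorem isOpen_admissible (μ : ℝ) : IsOpen {P : FredSA H | Admissible P.1 μ} := by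
  rw [isOpen_iff_mem_nhds]
  intro P₀ hP₀
  obtain ⟨k, e, he, hev⟩ := exists_localFrame (hP₀.hasGaps P₀.2.1) hP₀.2.2.2
  filter_upwards [continuous_subtype_val.continuousAt.eventually hev] with P hP
  obtain ⟨h1, h2, -⟩ := hP P.2.1
  exact ⟨hP₀.1, h1.right, h1.left, h2⟩

/-- The two open half circles are covered by continuity of stabilized sections and of the canonical
element. At `sin θ = 0` the operator is invertible, and the section is a piecewise coefficient times
`det P_θ`. -/
theorem continuous_asSec (n : ℤ) :
    Continuous fun p : AdmissibleLocus H μ × Real.Angle =>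
      (⟨asLoop p.1.1 p.2, asSec p.1.1 μ n p.2⟩ : Bundle.TotalSpace ℂ (DetBundle H H)) := by
  rw [continuous_iff_continuousAt]
  rintro ⟨P₀, θ₀⟩
  have hg : Continuous fun p : AdmissibleLocus H μ × Real.Angle => asLoop p.1.1 p.2 :=
    continuous_asLoop_uncurry.comp (f := fun p : AdmissibleLocus H μ × Real.Angle => (p.1.1, p.2)) (by fun_prop)
  have hsin : Continuous fun p : AdmissibleLocus H μ × Real.Angle => p.2.sin := Real.Angle.continuous_sin.comp continuous_snd
  have hcut : Continuous fun p : AdmissibleLocus H μ × Real.Angle => cutoff μ p.2 := (continuous_cutoff μ).comp continuous_snd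
  have hfst : ContinuousAt (fun p : AdmissibleLocus H μ × Real.Angle => p.1) (P₀, θ₀) := continuousAt_fst
  obtain ⟨k, v, hv, hvev⟩ := exists_localFrame_admissible P₀
  have hv' : ContinuousAt (fun p : AdmissibleLocus H μ × Real.Angle => v p.1) (P₀, θ₀) :=
    ContinuousAt.comp (f := fun p : AdmissibleLocus H μ × Real.Angle => p.1) hv hfst
  have hvev' := hfst.eventually hvev
  have hN : ∀ᶠ p : AdmissibleLocus H μ × Real.Angle in 𝓝 (P₀, θ₀), specCount p.1.1.1 (Set.Ioo (-μ) μ) = k :=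
    hvev'.mono fun p hp => p.1.2.specCount_eq hp.1 hp.2
  have hu : Continuous fun p : AdmissibleLocus H μ × Real.Angle => ((p.2.toCircle ^ ((k : ℤ) - 2 * n) : Circle) : ℂ) :=
    (continuous_toCircle_zpow _).comp continuous_snd
  rcases lt_trichotomy θ₀.sin 0 with hs | hs | hs
  · refine (continuousAt_detOne (g := fun p : AdmissibleLocus H μ × Real.Angle => asLoop p.1.1 p.2) hg.continuousAt
      (isUnit_asOp_of_sin_neg _ hs)).congr ?_
    filter_upwards [hsin.continuousAt.eventually_lt_const hs] with p hp
    rw [asSec_of_sin_nonpos _ _ _ hp.le]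
    rfl
  · have hunit : IsUnit (asLoop P₀.1 θ₀).1 := isUnit_asOp_of_sin_eq_zero _ hs
    have hunit' : ∀ᶠ p : AdmissibleLocus H μ × Real.Angle in 𝓝 (P₀, θ₀), IsUnit (asLoop p.1.1 p.2).1 :=
      (Units.isOpen.preimage (continuous_subtype_val.comp hg)).mem_nhds hunit
    let a : AdmissibleLocus H μ × Real.Angle → ℂ := fun p => ((p.2.toCircle ^ ((k : ℤ) - 2 * n) : Circle) : ℂ) *
      wedgeCoef (v p.1) ((asLoop p.1.1 p.2).1 ∘ v p.1)
    have hv₀ := hvev.self_of_nhds.1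
    have hQv : ContinuousAt (fun p : AdmissibleLocus H μ × Real.Angle => (asLoop p.1.1 p.2).1 ∘ v p.1) (P₀, θ₀) :=
      continuousAt_pi.mpr fun j => ContinuousAt.clm_apply
        (continuous_subtype_val.comp hg).continuousAt (continuousAt_pi.mp hv' j)
    have ha : ContinuousAt a (P₀, θ₀) :=
      hu.continuousAt.mul (continuousAt_wedgeCoef hv' hQv hv₀)
    -- Here `P_θ` is the scalar `cos θ = ±1`, so its determinant on `V` is `(cos θ)^k`. With the
    -- phase `(cos θ)^(k-2n)` this gives an even power.
    have ha1 : a (P₀, θ₀) = 1 := by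
      have hcs := θ₀.cos_sq_add_sin_sq
      have hQ : (asLoop P₀.1 θ₀).1 ∘ v P₀ = fun j => (θ₀.cos : ℂ) • v P₀ j := by
        funext j
        have : (asLoop P₀.1 θ₀).1 = asOp P₀.1.1 θ₀ := rfl
        rw [Function.comp_apply, this, asOp, if_pos hs.ge, hs]
        simp
      have hw : wedgeCoef (v P₀) (fun j => (θ₀.cos : ℂ) • v P₀ j) = (θ₀.cos : ℂ) ^ k := by
        refine wedgeCoef_eq_of_wedge_eq hv₀ ?_
        have := (ExteriorAlgebra.ιMulti ℂ (M := H) k).map_smul_univ (fun _ => (θ₀.cos : ℂ)) (v P₀)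
        rw [Finset.prod_const, Finset.card_univ, Fintype.card_fin] at this
        exact this
      have hcc : (θ₀.cos : ℂ) * θ₀.cos = 1 := by
        rw [hs] at hcs
        exact_mod_cast (by linarith : θ₀.cos * θ₀.cos = 1)
      have hc0 : (θ₀.cos : ℂ) ≠ 0 := left_ne_zero_of_mul_eq_one hcc
      have hto : (θ₀.toCircle : ℂ) = θ₀.cos := by
        rw [Real.Angle.coe_toCircle, hs]
        simp
      simp only [a]
      rw [hQ, hw, Circle.coe_zpow, hto, ← zpow_natCast, ← zpow_add₀ hc0,
        show (k : ℤ) - 2 * n + k = 2 * (k - n) by ring, zpow_mul, zpow_two, hcc, one_zpow]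
    classical
    have hb : ContinuousAt (fun p : AdmissibleLocus H μ × Real.Angle => if 0 < p.2.sin then a p else 1) (P₀, θ₀) := by
      have h1 : Tendsto a (𝓝 (P₀, θ₀)) (𝓝 1) := ha1 ▸ ha
      have h2 : (fun p : AdmissibleLocus H μ × Real.Angle => if 0 < p.2.sin then a p else 1) (P₀, θ₀) = 1 := if_neg hs.le.not_gt
      rw [ContinuousAt]
      rw [show (if 0 < ((P₀, θ₀) : AdmissibleLocus H μ × Real.Angle).2.sin then a (P₀, θ₀) else 1) = 1 from h2]
      exact h1.if' tendsto_const_nhds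
    refine (isLineBundle_detBundle.continuousAt_smul (g := fun p : AdmissibleLocus H μ × Real.Angle => asLoop p.1.1 p.2) hb
      (continuousAt_detOne hg.continuousAt hunit)).congr ?_
    filter_upwards [hvev', hN, hunit'] with p hp hNp hup
    congr 1
    split_ifs with h
    · rw [asSec_of_sin_pos _ _ _ h, hNp]
      have hf := isFrameStab_asOp p.1.1.2.1 p.1.2.1.le h hp.1 hp.2
      have h2 := (hf.eq_smul_isDetOne (ker_eq_bot_of_isUnit hup) (ker_adjoint_eq_bot_of_isUnit hup)
        (isDetOne_detOne hup)).1
      rw [h2]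
      exact mul_smul _ _ _
    · rw [asSec_of_sin_nonpos _ _ _ (not_lt.mp h)]
      exact one_smul ℂ _
  · have hpos : ∀ᶠ p : AdmissibleLocus H μ × Real.Angle in 𝓝 (P₀, θ₀), 0 < p.2.sin :=
      (isOpen_lt continuous_const hsin).mem_nhds hs
    refine (isLineBundle_detBundle.continuousAt_smul (g := fun p : AdmissibleLocus H μ × Real.Angle => asLoop p.1.1 p.2)
      (r := fun p => ((p.2.toCircle ^ ((k : ℤ) - 2 * n) : Circle) : ℂ)) hu.continuousAt
      (continuousAt_of_isFrameStab hg.continuousAt (μ := fun p => cutoff μ p.2) hcut.continuousAt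
        (e := fun p => v p.1) (f := fun p => v p.1)
        (d := fun p => (stabOne (asOp p.1.1.1 p.2) (cutoff μ p.2))) hv' hv' ?_)).congr ?_
    · filter_upwards [hpos, hvev'] with p h hp
      exact isFrameStab_asOp p.1.1.2.1 p.1.2.1.le h hp.1 hp.2
    · filter_upwards [hpos, hN] with p h hNp
      rw [asSec_of_sin_pos _ _ _ h, hNp]
      rfl

end JointContinuity

/-- The trivialization representing the image of `[μ, n]`. -/
noncomputable def asTriv (P : FredSA H) {μ : ℝ} (hμ : Admissible P.1 μ) (n : ℤ) :
    LoopTriv (DetBundle H H) (asLoop P) where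
  val := asSec P μ n
  continuous_val := (continuous_asSec n).comp
    (f := fun θ => ((⟨P, hμ⟩ : AdmissibleLocus H μ), θ)) (by fun_prop)
  ne_zero := asSec_ne_zero P hμ n

theorem smul_smul_eq_smul_smul {M : Type*} [AddCommGroup M] [Module ℂ M] {a b c d : ℂ} (x : M)
    (h : a * b = c * d) : a • b • x = c • d • x := by rw [smul_smul, h, mul_smul]

theorem smul_eq_smul_smul_smul {M : Type*} [AddCommGroup M] [Module ℂ M] {a b c d : ℂ} (x : M)
    (h : a = b * c * d) : a • x = b • c • d • x := by rw [h, mul_smul, mul_smul]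

theorem eq_smul_smul {M : Type*} [AddCommGroup M] [Module ℂ M] {a b : ℂ} (x : M)
    (h : a * b = 1) : x = a • b • x := by rw [smul_smul, h, one_smul]

/-! ### Dependence of the canonical trivializations on the cutoff -/

section Circle

theorem exp_arccos_of_sin_nonneg {θ : Real.Angle} (h : 0 ≤ θ.sin) :
    Complex.exp (Real.arccos θ.cos * Complex.I) = (θ.toCircle : ℂ) := by
  have h1 := θ.cos_sq_add_sin_sq
  rw [Complex.exp_mul_I, ← Complex.ofReal_cos, ← Complex.ofReal_sin, Real.sin_arccos,
    Real.cos_arccos (by nlinarith [sq_nonneg θ.sin]) (by nlinarith [sq_nonneg θ.sin]),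
    show 1 - θ.cos ^ 2 = θ.sin ^ 2 by linarith, Real.sqrt_sq h, Real.Angle.coe_toCircle]

theorem coe_toCircle_inv (θ : Real.Angle) :
    ((θ.toCircle⁻¹ : Circle) : ℂ) = θ.cos - θ.sin * Complex.I := by
  rw [Circle.coe_inv_eq_conj, Real.Angle.coe_toCircle]
  simp [sub_eq_add_neg]

theorem exp_arccos_of_sin_nonpos {θ : Real.Angle} (h : θ.sin ≤ 0) :
    Complex.exp (Real.arccos θ.cos * Complex.I) = ((θ.toCircle⁻¹ : Circle) : ℂ) := by
  have h1 := θ.cos_sq_add_sin_sq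
  rw [Complex.exp_mul_I, ← Complex.ofReal_cos, ← Complex.ofReal_sin, Real.sin_arccos,
    Real.cos_arccos (by nlinarith [sq_nonneg θ.sin]) (by nlinarith [sq_nonneg θ.sin]),
    show 1 - θ.cos ^ 2 = (-θ.sin) ^ 2 by linarith, Real.sqrt_sq (by linarith), coe_toCircle_inv]
  push_cast
  ring

-- The real part on the upper half is `cos² θ + sin² θ · εx > 0`, so the values avoid the slit.
-- Continuity at `sin θ = 0` holds because the product is `cos² θ = 1` there. It is used with `ε`
-- the sign of an eigenvalue `x`.
open Classical in
theorem hasLog_eigenvalueFactor {ε x : ℝ} (hx : 0 < ε * x) :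
    HasLog fun θ : Real.Angle => if θ.sin ≤ 0 then (1 : ℂ) else
      (θ.cos - θ.sin * ε * Complex.I) * (θ.cos + Complex.I * θ.sin * x) := by
  have hc := Real.Angle.continuous_cos
  have hs := Real.Angle.continuous_sin
  refine hasLog_of_mem_slitPlane ?_ fun θ => ?_
  · refine Continuous.if_le continuous_const (by fun_prop) hs continuous_const fun θ h => ?_
    have h1 := θ.cos_sq_add_sin_sq
    rw [h] at h1 ⊢
    have h2 : (θ.cos : ℂ) ^ 2 = 1 := by exact_mod_cast (by linarith : θ.cos ^ 2 = 1)
    simp [← h2, sq]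
  · have h1 := θ.cos_sq_add_sin_sq
    split_ifs with h
    · exact Complex.one_mem_slitPlane
    · left
      have h3 : 0 < θ.sin ^ 2 := by
        have := not_le.mp h
        positivity
      have h4 : 0 < θ.cos ^ 2 + θ.sin ^ 2 * (ε * x) := by positivity
      convert h4 using 1
      simp
      ring

end Circle

/-- The passage from `n` to `n + j` multiplies by `e^{-2ijθ}` on the upper half and by `1` on the
lower. Relative to the twist `e^{-ijθ}` this leaves `e^{-ijθ}` above and `e^{ijθ}` below, that is
`exp(-ij arccos(cos θ))`, with a continuous logarithm on the whole circle. -/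
theorem mk_asTriv_add (P : FredSA H) {μ : ℝ} (hμ : Admissible P.1 μ) (n j : ℤ) :
    Transg.mk (asTriv P hμ (n + j))
      = Transg.mk ((asTriv P hμ n).twist isLineBundle_detBundle (-j)) := by
  symm
  have hr : ∀ θ, (asTriv P hμ (n + j)).val θ
      = Complex.exp (((-j : ℤ) : ℂ) * (Real.arccos θ.cos * Complex.I)) •
        ((asTriv P hμ n).twist isLineBundle_detBundle (-j)).val θ := by
    intro θ
    change asSec P μ (n + j) θ = _ • (((θ.toCircle ^ (-j) : Circle) : ℂ) • asSec P μ n θ)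
    rw [Complex.exp_int_mul]
    rcases lt_or_ge 0 θ.sin with h | h
    · rw [exp_arccos_of_sin_nonneg h.le, asSec_of_sin_pos _ _ _ h, asSec_of_sin_pos _ _ _ h]
      refine smul_eq_smul_smul_smul (M := DetLine (asOp P.1 θ)) _ ?_
      rw [← Circle.coe_zpow, ← Circle.coe_mul, ← Circle.coe_mul, ← zpow_add, ← zpow_add]
      congr 2
      ring
    · rw [exp_arccos_of_sin_nonpos h, asSec_of_sin_nonpos _ _ _ h, asSec_of_sin_nonpos _ _ _ h]
      refine eq_smul_smul (M := DetLine (asOp P.1 θ)) _ ?_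
      rw [← Circle.coe_zpow, ← Circle.coe_mul, inv_zpow, inv_mul_cancel, Circle.coe_one]
  rw [isLineBundle_detBundle.mk_eq_mk_iff, LoopTriv.logRel_iff_hasLog hr]
  have hc := Real.continuous_arccos.comp Real.Angle.continuous_cos
  exact ⟨_, by fun_prop, fun _ => rfl⟩

/-- The effect of enlarging the cutoff on the stabilized section. -/
theorem stabOne_cutoff_eq {P : H →L[ℂ] H} (hP : IsSelfAdjoint P) {μ ν : ℝ} (hμ : 0 ≤ μ)
    (hlt : μ ≤ ν) {θ : Real.Angle} (h : 0 < θ.sin) {k m : ℕ} {v : Fin k → H} {g : Fin m → H}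
    (hv : LinearIndependent ℂ v)
    (hvs : Submodule.span ℂ (Set.range v) = specSpace P (Set.Icc (-μ) μ))
    (hw : LinearIndependent ℂ (Fin.append v g))
    (hws : Submodule.span ℂ (Set.range (Fin.append v g)) = specSpace P (Set.Icc (-ν) ν))
    {lam : Fin m → ℝ} (hg : ∀ i, P (g i) = (lam i : ℂ) • g i) :
    stabOne (asOp P θ) (cutoff ν θ)
      = (∏ i, ((θ.cos : ℂ) + Complex.I * θ.sin * lam i)) • stabOne (asOp P θ) (cutoff μ θ) := by
  have h1 := isFrameStab_asOp hP hμ h hv hvs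
  have h2 := isFrameStab_asOp hP (hμ.trans hlt) h hw hws
  have hcut : cutoff μ θ ≤ cutoff ν θ := by
    unfold cutoff
    gcongr
  have hgm : ∀ i, g i ∈ domSpace (asOp P θ) (Set.Icc 0 (cutoff ν θ)) := by
    intro i
    rw [← h2.span_e]
    refine Submodule.subset_span ⟨Fin.natAdd k i, ?_⟩
    rw [Fin.append_right]
  have hQ : asOp P θ ∘ g = fun i => ((θ.cos : ℂ) + Complex.I * θ.sin * lam i) • g i := by
    funext i
    rw [Function.comp_apply, asOp_of_sin_pos P h]
    simp only [add_apply, smul_apply, one_apply_eq_self, hg]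
    module
  rw [h1.transition hcut h2 hgm hw, wedgeCoef_self hw, div_one]
  congr 1
  refine wedgeCoef_eq_of_wedge_eq hw ?_
  rw [wedge_append, wedge_append, hQ]
  have : wedge (fun i => ((θ.cos : ℂ) + Complex.I * θ.sin * lam i) • g i) = _ :=
    (ExteriorAlgebra.ιMulti ℂ (M := H) m).map_smul_univ
    (fun i => (θ.cos : ℂ) + Complex.I * θ.sin * lam i) g
  rw [this, mul_smul_comm]

/-- Negative and positive eigenvalues between the cutoffs are kept apart because they are
compensated by opposite phases. The positive ones are counted by `specCount P (Set.Ioo μ ν)`, the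
shift of `n`. -/
theorem exists_adapted_eigenframe {P : H →L[ℂ] H} (hP : IsSelfAdjoint P) {μ ν : ℝ}
    (hμ : Admissible P μ) (hν : Admissible P ν) (hlt : μ < ν) :
    ∃ (k a : ℕ) (v : Fin k → H)
      (g : Fin (a + specCount P (Set.Ioo μ ν)) → H)
      (x : Fin a → ℝ) (y : Fin (specCount P (Set.Ioo μ ν)) → ℝ),
      LinearIndependent ℂ v ∧
      Submodule.span ℂ (Set.range v) = specSpace P (Set.Icc (-μ) μ) ∧
      LinearIndependent ℂ (Fin.append v g) ∧
      Submodule.span ℂ (Set.range (Fin.append v g)) = specSpace P (Set.Icc (-ν) ν) ∧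
      (∀ i, P (g i) = ((Fin.append x y i : ℝ) : ℂ) • g i) ∧ (∀ i, x i < 0) ∧ ∀ i, 0 < y i := by
  have h0 := hμ.1
  have hsplit := hμ.specSpace_Icc_of_lt hν hlt
  have hfν := hν.finiteDimensional hP
  have hfμ := hμ.finiteDimensional hP
  have hf₁ : FiniteDimensional ℂ (specSpace P (Set.Ioo (-ν) (-μ))) :=
    Submodule.finiteDimensional_of_le ((le_sup_left.trans le_sup_right).trans hsplit.ge)
  have hf₂ : FiniteDimensional ℂ (specSpace P (Set.Ioo μ ν)) :=
    Submodule.finiteDimensional_of_le ((le_sup_right.trans le_sup_right).trans hsplit.ge)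
  obtain ⟨v, hv, hvs⟩ := exists_basis_fin (specSpace P (Set.Icc (-μ) μ))
  obtain ⟨g₁, x, hg₁, hgs₁, hx⟩ := exists_eigenbasis P (Set.Ioo (-ν) (-μ))
  obtain ⟨g₂, y, hg₂, hgs₂, hy⟩ := exists_eigenbasis P (Set.Ioo μ ν)
  have hgs : Submodule.span ℂ (Set.range (Fin.append g₁ g₂))
      = specSpace P (Set.Ioo (-ν) (-μ) ∪ Set.Ioo μ ν) := by
    rw [span_append, hgs₁, hgs₂, specSpace_union]
  have hg : LinearIndependent ℂ (Fin.append g₁ g₂) := by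
    refine linearIndependent_append hg₁ hg₂ ?_
    rw [hgs₁, hgs₂]
    refine disjoint_specSpace P (Set.disjoint_left.mpr fun t ht ht' => ?_)
    linarith [ht.2, ht'.1]
  refine ⟨_, _, v, Fin.append g₁ g₂, x, y, hv, hvs, ?_, ?_, fun i => ?_, fun i => ?_, fun i => ?_⟩
  · refine linearIndependent_append hv hg ?_
    rw [hvs, hgs]
    refine disjoint_specSpace P (Set.disjoint_left.mpr fun t ht ht' => ?_)
    rcases ht' with ht' | ht'
    · linarith [ht.1, ht'.2]
    · linarith [ht.2, ht'.1]
  · rw [span_append, hvs, hgs, hsplit, specSpace_union]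
  · induction i using Fin.addCases with
    | left i => simpa using (hx i).2
    | right i => simpa using (hy i).2
  · linarith [(hx i).1.2]
  · linarith [(hy i).1.1]

/-- The ratio of the two trivializations splits into one factor per eigenvalue between the cutoffs,
each with a logarithm by `hasLog_eigenvalueFactor`. -/
theorem mk_asTriv_eq_of_lt (P : FredSA H) {μ ν : ℝ} (hμ : Admissible P.1 μ)
    (hν : Admissible P.1 ν) (hlt : μ < ν) (n : ℤ) :
    Transg.mk (asTriv P hμ n)
      = Transg.mk (asTriv P hν (n + specCount P.1 (Set.Ioo μ ν))) := by
  classical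
  obtain ⟨k, a, v, g, x, y, hv, hvs, hw, hws, hg, hx, hy⟩ :=
    exists_adapted_eigenframe P.2.1 hμ hν hlt
  let F : ℝ → ℝ → Real.Angle → ℂ := fun ε x θ => if θ.sin ≤ 0 then (1 : ℂ) else
      (θ.cos - θ.sin * ε * Complex.I) * (θ.cos + Complex.I * θ.sin * x)
  have hr : ∀ θ, (asTriv P hν (n + specCount P.1 (Set.Ioo μ ν))).val θ
      = ((∏ i, F (-1) (x i) θ) * ∏ i, F 1 (y i) θ) • (asTriv P hμ n).val θ := by
    intro θ
    change asSec P ν _ θ = _ • asSec P μ n θ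
    rcases lt_or_ge 0 θ.sin with h | h
    · have hN : specCount P.1 (Set.Ioo (-ν) ν)
          = specCount P.1 (Set.Ioo (-μ) μ) + (a + specCount P.1 (Set.Ioo μ ν)) := by
        rw [hμ.specCount_eq hv hvs, hν.specCount_eq hw hws]
      have hF₁ : ∀ i, F (-1) (x i) θ
          = (θ.toCircle : ℂ) * (θ.cos + Complex.I * θ.sin * x i) := fun i => by
        simp only [F, if_neg h.not_ge]
        rw [Real.Angle.coe_toCircle]
        push_cast
        ring
      have hF₂ : ∀ i, F 1 (y i) θ
          = ((θ.toCircle⁻¹ : Circle) : ℂ) * (θ.cos + Complex.I * θ.sin * y i) := fun i => by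
        simp only [F, if_neg h.not_ge]
        rw [coe_toCircle_inv]
        push_cast
        ring
      rw [asSec_of_sin_pos _ _ _ h, asSec_of_sin_pos _ _ _ h,
        stabOne_cutoff_eq P.2.1 hμ.1.le hlt.le h hv hvs hw hws hg, hN]
      simp only [hF₁, hF₂, Finset.prod_mul_distrib, Finset.prod_const, Finset.card_univ,
        Fintype.card_fin, Fin.prod_univ_add, Fin.append_left, Fin.append_right]
      refine smul_smul_eq_smul_smul (M := DetLine (asOp P.1 θ)) _ ?_
      have hu : (θ.toCircle : ℂ) ≠ 0 := Circle.coe_ne_zero _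
      -- With `b` positive eigenvalues, the extra exponent is `(a + b) - 2b = a - b`: one `e^{iθ}`
      -- per negative and one `e^{-iθ}` per positive eigenvalue.
      have hexp : (θ.toCircle : ℂ) ^ (((specCount P.1 (Set.Ioo (-μ) μ) +
          (a + specCount P.1 (Set.Ioo μ ν)) : ℕ) : ℤ) - 2 * (n + specCount P.1 (Set.Ioo μ ν)))
          = (θ.toCircle : ℂ) ^ a * (θ.toCircle : ℂ)⁻¹ ^ specCount P.1 (Set.Ioo μ ν) *
            (θ.toCircle : ℂ) ^ ((specCount P.1 (Set.Ioo (-μ) μ) : ℤ) - 2 * n) := by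
        rw [← zpow_natCast, ← zpow_natCast, inv_zpow', ← zpow_add₀ hu, ← zpow_add₀ hu]
        congr 1
        push_cast
        ring
      rw [Circle.coe_zpow, Circle.coe_zpow, Circle.coe_inv, hexp]
      ring
    · rw [asSec_of_sin_nonpos _ _ _ h, asSec_of_sin_nonpos _ _ _ h]
      simp only [F, if_pos h, Finset.prod_const_one, mul_one]
      exact (one_smul ℂ (detOne (asOp P.1 θ))).symm
  rw [isLineBundle_detBundle.mk_eq_mk_iff, LoopTriv.logRel_iff_hasLog hr]
  exact (HasLog.prod _ fun i _ => hasLog_eigenvalueFactor (by linarith [hx i])).mul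
    (HasLog.prod _ fun i _ => hasLog_eigenvalueFactor (by linarith [hy i]))

/-! ### The isomorphism of the spectral cover with the pullback of the transgression -/

/-- The map `[μ, n] ↦ [τ]` from the spectral torsor to the transgression. -/
noncomputable def Sp.toTransg {P : FredSA H} :
    Sp P → Transg (DetBundle H H) (asLoop P) :=
  Quot.lift (fun a => Transg.mk (asTriv P a.1.2 a.2)) fun a b h => by
    have h1 : b.2 = a.2 + specCount P.1 (Set.Ioo a.1.1 b.1.1) := by
      have := h.2
      linarith
    rw [h1]
    exact mk_asTriv_eq_of_lt P a.1.2 b.1.2 h.1 a.2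

theorem Sp.toTransg_mk {P : FredSA H} {μ : ℝ} (hμ : Admissible P.1 μ) (n : ℤ) :
    (Sp.mk μ hμ n).toTransg = Transg.mk (asTriv P hμ n) := rfl

theorem Sp.exists_mk {P : FredSA H} (x : Sp P) :
    ∃ (μ : ℝ) (h : Admissible P.1 μ) (n : ℤ), x = Sp.mk μ h n := by
  induction x using Quot.ind with
  | mk a => exact ⟨a.1.1, a.1.2, a.2, rfl⟩

theorem Sp.mk_eq_of_lt {P : FredSA H} {μ ν : ℝ} (hμ : Admissible P.1 μ) (hν : Admissible P.1 ν)
    (hlt : μ < ν) (n : ℤ) :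
    Sp.mk μ hμ n = Sp.mk ν hν (n + specCount P.1 (Set.Ioo μ ν)) :=
  Quot.sound ⟨hlt, by simp⟩

theorem eq_of_mk_asTriv_eq {P : FredSA H} {μ : ℝ} {hμ : Admissible P.1 μ} {n m : ℤ}
    (h : Transg.mk (asTriv P hμ n) = Transg.mk (asTriv P hμ m)) : n = m := by
  rw [show m = n + (m - n) by ring, mk_asTriv_add] at h
  have := isLineBundle_detBundle.eq_zero_of_mk_twist_eq h
  omega

/-- Two elements are brought to the larger of their cutoffs, where winding numbers separate the
integers. -/
theorem Sp.toTransg_injective (P : FredSA H) : Function.Injective (Sp.toTransg (P := P)) := by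
  have key : ∀ {μ ν : ℝ} (hμ : Admissible P.1 μ) (hν : Admissible P.1 ν) (n m : ℤ), μ ≤ ν →
      (Sp.mk μ hμ n).toTransg = (Sp.mk ν hν m).toTransg → Sp.mk μ hμ n = Sp.mk ν hν m := by
    intro μ ν hμ hν n m hle h
    rcases hle.eq_or_lt with rfl | hlt
    · have h1 : n = m := eq_of_mk_asTriv_eq h
      rw [h1]
    · rw [Sp.mk_eq_of_lt hμ hν hlt] at h ⊢
      have h1 : n + specCount P.1 (Set.Ioo μ ν) = m := eq_of_mk_asTriv_eq h
      rw [h1]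
  intro x y h
  obtain ⟨μ, hμ, n, rfl⟩ := x.exists_mk
  obtain ⟨ν, hν, m, rfl⟩ := y.exists_mk
  rcases le_total μ ν with hle | hle
  · exact key hμ hν n m hle h
  · exact (key hν hμ m n hle h.symm).symm

theorem Sp.toTransg_surjective (P : FredSA H) : Function.Surjective (Sp.toTransg (P := P)) := by
  intro y
  induction y using Quot.ind with
  | mk τ =>
    obtain ⟨μ, hμ⟩ := exists_admissible P
    obtain ⟨j, hj⟩ := isLineBundle_detBundle.exists_mk_eq_twist (asTriv P hμ 0) τ
    -- The sign reflects that adding to `n` twists in the opposite direction; the summand `0`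
    -- matches the form of `mk_asTriv_add`.
    refine ⟨Sp.mk μ hμ (0 + -j), ?_⟩
    rw [Sp.toTransg_mk, mk_asTriv_add, neg_neg]
    exact hj.symm

theorem Sp.isTranslate_toTransg_shift {P : FredSA H} (j : ℤ) (x : Sp P) :
    Transg.IsTranslate (-j) x.toTransg (Sp.shift j x).toTransg := by
  obtain ⟨μ, hμ, n, rfl⟩ := x.exists_mk
  exact ⟨asTriv P hμ n, (asTriv P hμ n).twist isLineBundle_detBundle (-j), rfl,
    mk_asTriv_add P hμ n j, fun θ => rfl⟩

/-! ### ### Comparison of the topologies on the total spaces -/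

section Topology

variable (H) in
/-- The map of total spaces from the spectral cover to the pullback of the transgression. -/
noncomputable def totalToTransg (x : Bundle.TotalSpace ℤ (Sp (E := H))) :
    Bundle.TotalSpace ℤ (Bundle.Pullback asLoop (Transg (DetBundle H H))) :=
  ⟨x.proj, x.snd.toTransg⟩

theorem continuous_spSection (μ : ℝ) (n : ℤ) : Continuous fun P : AdmissibleLocus H μ =>
    (⟨P.1, Sp.mk μ P.2 n⟩ : Bundle.TotalSpace ℤ (Sp (E := H))) :=
  continuous_iff_coinduced_le.mpr (le_iSup₂ (f := fun (μ : ℝ) (n : ℤ) =>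
    TopologicalSpace.coinduced (fun P : AdmissibleLocus H μ =>
      (⟨P.1, Sp.mk μ P.2 n⟩ : Bundle.TotalSpace ℤ (Sp (E := H)))) inferInstance) μ n)

theorem continuous_totalToTransg : Continuous (totalToTransg H) := by
  rw [(inducing_pullbackTotalSpaceEmbedding ℤ (Transg (DetBundle H H)) asLoop).continuous_iff]
  refine continuous_iSup_dom.mpr fun μ => continuous_iSup_dom.mpr fun n =>
    continuous_coinduced_dom.mpr ?_
  refine continuous_subtype_val.prodMk ?_
  exact isLineBundle_detBundle.continuous_mk (G := fun P : AdmissibleLocus H μ => asLoop P.1)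
    (continuous_asLoop.comp continuous_subtype_val) (τ := fun P => asTriv P.1 P.2 n)
    (continuous_asSec n)

/-- Near the image of `[μ, n]`, a point of the pullback is determined by its base point once it lies
on the sheet of a family `T` through the image. Over the operators where the section `[μ, n]` maps
into this sheet and lies in `O`, an open condition, the sheet is contained in the image of `O`. -/
theorem isOpenMap_totalToTransg : IsOpenMap (totalToTransg H) := by
  intro O hO
  rw [isOpen_iff_mem_nhds]
  rintro _ ⟨⟨P₀, x₀⟩, hx₀, rfl⟩
  obtain ⟨μ, hμ, n, rfl⟩ := x₀.exists_mk
  obtain ⟨T, hT, hT₀⟩ := isLineBundle_detBundle.exists_family (asTriv P₀ hμ n)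
  have h1 : IsOpen {P : AdmissibleLocus H μ | ∃ h : asLoop P.1 ∈ T.U,
      Transg.mk (asTriv P.1 P.2 n) = Transg.mk (T.at ⟨asLoop P.1, h⟩)} :=
    isLineBundle_detBundle.isOpen_mk_eq_at (G := fun P : AdmissibleLocus H μ => asLoop P.1)
      (continuous_asLoop.comp continuous_subtype_val) (τ := fun P => asTriv P.1 P.2 n)
      (continuous_asSec n) T
  have h2 := (isOpen_admissible μ).isOpenMap_subtype_val _
    (h1.inter (hO.preimage (continuous_spSection μ n)))
  have hemb :=
    (inducing_pullbackTotalSpaceEmbedding ℤ (Transg (DetBundle H H)) (asLoop (H := H))).continuous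
  have hproj : Continuous fun y :
      Bundle.TotalSpace ℤ (Bundle.Pullback asLoop (Transg (DetBundle H H))) => y.proj :=
    continuous_fst.comp hemb
  have hlift : Continuous fun y :
      Bundle.TotalSpace ℤ (Bundle.Pullback asLoop (Transg (DetBundle H H))) =>
      (⟨asLoop y.proj, y.snd⟩ : Bundle.TotalSpace ℤ (Transg (DetBundle H H))) :=
    continuous_snd.comp hemb
  have h3 := (h2.preimage hproj).inter
    ((isLineBundle_detBundle.isOpen_range_at T).preimage hlift)
  refine mem_of_superset (h3.mem_nhds ⟨⟨⟨P₀, hμ⟩, ⟨⟨hT, ?_⟩, hx₀⟩, rfl⟩, hT, ?_⟩) ?_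
  · rw [hT₀]
  · exact congrArg Transg.mk hT₀.symm
  · rintro ⟨_, y⟩ ⟨⟨P, ⟨⟨_, hm⟩, hPO⟩, rfl⟩, _, hy⟩
    exact ⟨⟨P.1, Sp.mk μ P.2 n⟩, hPO, congrArg (Bundle.TotalSpace.mk P.1) (hm.trans hy.symm)⟩

theorem isHomeomorph_totalToTransg : IsHomeomorph (totalToTransg H) where
  continuous := continuous_totalToTransg
  isOpenMap := isOpenMap_totalToTransg
  bijective := by
    constructor
    · rintro ⟨P, x⟩ ⟨P', x'⟩ h
      obtain rfl : P = P' := congrArg Bundle.TotalSpace.proj h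
      exact congrArg (Bundle.TotalSpace.mk P)
        (Sp.toTransg_injective P (eq_of_heq (Bundle.TotalSpace.mk.inj h).2))
    · rintro ⟨P, y⟩
      obtain ⟨x, hx⟩ := Sp.toTransg_surjective P y
      exact ⟨⟨P, x⟩, congrArg (Bundle.TotalSpace.mk P) hx⟩

end Topology

theorem asTriv_val_of_mem_Ioo {P : FredSA H} {μ : ℝ} (hμ : Admissible P.1 μ) (n : ℤ) {t : ℝ}
    (ht : t ∈ Set.Ioo 0 Real.pi) : ∃ d : DetLine (asOp P.1 t),
      IsStabOne (asOp P.1 t) (Real.cos t ^ 2 + Real.sin t ^ 2 * μ ^ 2) d ∧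
      (asTriv P hμ n).val t =
        Complex.exp (Complex.I * ((specCount P.1 (Set.Ioo (-μ) μ) : ℂ) - 2 * n) * t) • d := by
  have hs : 0 < Real.Angle.sin t := by
    rw [Real.Angle.sin_coe]
    exact Real.sin_pos_of_mem_Ioo ht
  have := hμ.finiteDimensional P.2.1
  obtain ⟨v, hv, hvs⟩ := exists_basis_fin (specSpace P.1 (Set.Icc (-μ) μ))
  refine ⟨stabOne (asOp P.1 t) (cutoff μ t),
    (isFrameStab_asOp P.2.1 hμ.1.le hs hv hvs).isStabOne, ?_⟩
  have h1 : (asTriv P hμ n).val t = _ := asSec_of_sin_pos P μ n hs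
  rw [h1, coe_toCircle_zpow]
  congr 2
  push_cast
  ring

theorem asTriv_val_of_mem_Icc {P : FredSA H} {μ : ℝ} (hμ : Admissible P.1 μ) (n : ℤ) {t : ℝ}
    (ht : t ∈ Set.Icc Real.pi (2 * Real.pi)) : IsDetOne (asOp P.1 t) ((asTriv P hμ n).val t) := by
  have hs : Real.Angle.sin t ≤ 0 := by
    rw [Real.Angle.sin_coe, ← Real.sin_sub_two_pi]
    exact Real.sin_nonpos_of_nonpos_of_neg_pi_le (by linarith [ht.2]) (by linarith [ht.1])
  have h1 : (asTriv P hμ n).val t = _ := asSec_of_sin_nonpos P μ n hs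
  rw [h1]
  exact isDetOne_detOne (isUnit_asOp_of_sin_nonpos P.1 hs)

end SpectralCover

open SpectralCover in
theorem theorem3p21 {H : Type*} [NormedAddCommGroup H] [InnerProductSpace ℂ H] [CompleteSpace H] :
    ∃ ψ : ∀ P : FredSA H, Sp P ≃ Transg (DetBundle H H) (asLoop P),
      IsHomeomorph (fun x : Bundle.TotalSpace ℤ (Sp (E := H)) =>
        (⟨x.proj, ψ x.proj x.snd⟩ :
          Bundle.TotalSpace ℤ (Bundle.Pullback asLoop (Transg (DetBundle H H))))) ∧
      (∀ (P : FredSA H) (j : ℤ) (x : Sp P),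
        Transg.IsTranslate (-j) (ψ P x) (ψ P (Sp.shift j x))) ∧
      (∀ (P : FredSA H) (μ : ℝ) (hμ : Admissible P.1 μ) (n : ℤ),
        ∃ τ : LoopTriv (DetBundle H H) (asLoop P),
          ψ P (Sp.mk μ hμ n) = Transg.mk τ ∧
          (∀ t ∈ Set.Ioo 0 Real.pi, ∃ d : DetLine (asOp P.1 t),
            IsStabOne (asOp P.1 t) (Real.cos t ^ 2 + Real.sin t ^ 2 * μ ^ 2) d ∧
            τ.val t =
              Complex.exp (Complex.I *
                ((specCount P.1 (Set.Ioo (-μ) μ) : ℂ) - 2 * n) * t) • d) ∧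
          (∀ t ∈ Set.Icc Real.pi (2 * Real.pi), IsDetOne (asOp P.1 t) (τ.val t))) :=
  ⟨fun P => Equiv.ofBijective Sp.toTransg ⟨Sp.toTransg_injective P, Sp.toTransg_surjective P⟩,
    isHomeomorph_totalToTransg, fun _ j x => Sp.isTranslate_toTransg_shift j x,
    fun P _ hμ n => ⟨asTriv P hμ n, rfl, fun _ ht => asTriv_val_of_mem_Ioo hμ n ht,
      fun _ ht => asTriv_val_of_mem_Icc hμ n ht⟩⟩
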